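/- Let $\alpha$ be a continuous automorphism of a compact connected abelian (Hausdorff) group $X$ with normalized Haar measure $\lambda_X$. Assume that $\alpha$ is nonexpansive (there is no neighbourhood $U$ of $0$ with $\bigcap_{n\in\mathbb Z}\alpha^n(U)=\{0\}$), ergodic (topologically transitive), and totally irreducible (for every $n\neq 0$, every closed subgroup $Y\subsetneq X$ with $\alpha^n(Y)=Y$ is finite). *Algebraic form.* Write $\alpha$, as one may, as multiplication by $\theta$ on $W/\iota(L)$: here $\theta\neq 0$ is an algebraic number, $K=\mathbb Q(\theta)$, $L\subset K$ is a finitely generated $\mathbb Z[\theta^{\pm1}]$-submodule, $P$ is the set of finite places $v$ of $K$ with $|\theta|_v\ne 1$, $S$ is the union of $P$ and the set of infinite places, $W=\prod_{v\in S}K_v$, $\iota:K\to W$ is the diagonal embedding, $X\cong W/\iota(L)$ as topological groups, and $\pi:W\to X$ is the quotient map, with $\alpha(\pi(w))=\pi(\theta w)$. Put $S^{(0)}=\{v\in S:|\theta|_v=1\}$, $W^{(0)}=\{w\in W: w_v=0 \text{ for } v\in S\smallsetminus S^{(0)}\}$ with norm $\|w\|=\max_v|w_v|$ and open balls $B(r)=\{w\in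 W^{(0)}:\|w\|<r\}$, let $\kappa$ be the coordinate projection of $W$ onto $W'=\prod_{v\in S\smallsetminus S^{(0)}}K_v$, and let $B_{\mathcal F}(x,r)=x+\pi(B(r))$ be the ball of radius $r$ around $x$ in the central leaf $x+\pi(W^{(0)})$. *Leaf measures.* Let $\mu$ be an $\alpha$-invariant Borel probability measure on $X$. Let $q>1$ be an integer with $|q|_v=1$ for all $v\in P$, and $\Lambda=\frac1qL$. Let $\Delta^{(n)}\subset W$, $n\ge1$, be relatively compact Borel fundamental domains for $\iota(\Lambda)$ such that the finite partitions $\mathcal Q^{(n)}=\{\pi(\Delta^{(n)}+\iota(a)):a\in\Lambda\}$ of $X$ satisfy: $\mu(\partial Q)=0$ for $Q\in\mathcal Q^{(n)}$; for every $w\in W$ and every class of $\Lambda$ modulo $L$, the sets $W^{(0)}\cap(\Delta^{(n)}+\iota(a)-w)$, with $a$ in that class, have pairwise disjoint compact closures; and $\sum_{Q\in\mathcal Q^{(n)}}\mu\bigl((Q+\pi(B(n)))\bigtriangleup Q\bigr)\le 2^{-n}$. Let $\mathscr A^{(n)}$ be the sigma-algebra generated by the sets $\pi(\kappa^{-1}(B)\cap(\Delta^{(n)}+\iota(a)))$,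 $B\subset W'$ Borel, $a\in\Lambda$; its atoms are the pieces of leaves $\pi\bigl((W^{(0)}+w)\cap(\Delta^{(n)}+\iota(a))\bigr)$, $w\in\Delta^{(n)}+\iota(a)$. Let $(\mu_x^{\mathscr A^{(n)}})_{x\in X}$ be a system of conditional probability measures of $\mu$ given $\mathscr A^{(n)}$, constant on the atoms and (for $\mu$-a.e. $x$) carried by the atom of $x$. Let $r_0$ be such that the atom of every $x\in X$ in $\mathscr A^{(1)}$ is contained in $B_{\mathcal F}(x,r_0)$. The central-leaf measure $\rho_x$ is the Borel measure on $W^{(0)}$ with $$\rho_x(B)=\lim_{k\to\infty}\frac{\mu_x^{\mathscr A^{(k)}}(x+\pi(B))}{\mu_x^{\mathscr A^{(k)}}(B_{\mathcal F}(x,r_0))}\qquad\text{for every Borel set } B\subset W^{(0)}.$$ **Theorem.** If $\mu$ is singular with respect to $\lambda_X$, then, for all such choices, there is a Borel set $X'\subset X$ with $\mu(X')=1$ such that for every $x\in X'$ the measure $\rho_x$ exists and $\rho_x(W^{(0)})<\infty$. -/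

import Mathlib

open MeasureTheory Topology Filter NumberField IsDedekindDomain
open scoped Pointwise ENNReal

noncomputable section

namespace CentralFoliation

section Dynamics

variable {X : Type*} [AddCommGroup X] [TopologicalSpace X]

/-- The power `α ^ n`, `n ∈ ℤ`, of a continuous automorphism `α` of `X`. -/
def iter (α : X ≃ₜ+ X) (n : ℤ) : Equiv.Perm X :=
  (α.toEquiv : Equiv.Perm X) ^ n

/-- `α` is expansive: some neighbourhood `U` of `0` satisfies `⋂ n, α ^ n (U) = {0}`. -/
def IsExpansive (α : X ≃ₜ+ X) : Prop :=
  ∃ U ∈ 𝓝 (0 : X), ⋂ n : ℤ, iter α n '' U = {0}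

/-- `α` is ergodic, i.e. topologically transitive. -/
def IsErgodic (α : X ≃ₜ+ X) : Prop :=
  ∀ U V : Set X, IsOpen U → IsOpen V → U.Nonempty → V.Nonempty →
    ∃ n : ℤ, (iter α n '' U ∩ V).Nonempty

/-- A bijection `f` of `X` (a power of an automorphism) is irreducible: every closed
`f`-invariant proper subgroup is finite. -/
def IsIrreducible (f : Equiv.Perm X) : Prop :=
  ∀ Y : AddSubgroup X, IsClosed (Y : Set X) → f '' (Y : Set X) = Y → Y ≠ ⊤ →
    (Y : Set X).Finite

/-- `α` is totally irreducible: every nonzero power of `α` is irreducible. -/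
def IsTotallyIrreducible (α : X ≃ₜ+ X) : Prop :=
  ∀ n : ℤ, n ≠ 0 → IsIrreducible (iter α n)

end Dynamics

section Solenoid

variable {K : Type*} [Field K] [NumberField K]

/-- The finite places `v` of `K` with `|θ|_v ≠ 1`. -/
abbrev BadPlace (θ : K) : Type _ :=
  {v : HeightOneSpectrum (𝓞 K) // v.valuation K θ ≠ 1}

/-- `W = ∏_{v ∈ S} K_v`, where `S` consists of all infinite places of `K` and of the finite places
`v` with `|θ|_v ≠ 1`. -/
def W (θ : K) : Type _ :=
  (∀ v : InfinitePlace K, v.Completion) × (∀ v : BadPlace θ, v.1.adicCompletion K)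

variable (θ : K)

instance : CommRing (W θ) :=
  inferInstanceAs (CommRing
    ((∀ v : InfinitePlace K, v.Completion) × (∀ v : BadPlace θ, v.1.adicCompletion K)))

instance : TopologicalSpace (W θ) :=
  inferInstanceAs (TopologicalSpace
    ((∀ v : InfinitePlace K, v.Completion) × (∀ v : BadPlace θ, v.1.adicCompletion K)))

instance : IsTopologicalRing (W θ) :=
  inferInstanceAs (IsTopologicalRing
    ((∀ v : InfinitePlace K, v.Completion) × (∀ v : BadPlace θ, v.1.adicCompletion K)))

instance : MeasurableSpace (W θ) := borel (W θ)

instance : BorelSpace (W θ) := ⟨rfl⟩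

/-- The diagonal embedding `ι : K → W`. -/
def diag : K →+* W θ :=
  RingHom.prod (RingHom.pi fun v : InfinitePlace K => algebraMap K v.Completion)
    (RingHom.pi fun v : BadPlace θ => algebraMap K (v.1.adicCompletion K))

/-- The automorphism `β̄` of `W`: multiplication by `θ` in every coordinate. -/
def mulTheta (w : W θ) : W θ := diag θ θ * w

/-- The image `ι(L) ⊆ W` of a `ℤ[θ, θ⁻¹]`-submodule `L` of `K`. -/
def lattice (L : Submodule (Algebra.adjoin ℤ ({θ, θ⁻¹} : Set K)) K) : AddSubgroup (W θ) :=
  L.toAddSubgroup.map (diag θ).toAddMonoidHom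

/-- `Λ = q⁻¹ L ⊆ K`. -/
def scaled (L : Submodule (Algebra.adjoin ℤ ({θ, θ⁻¹} : Set K)) K) (q : ℕ) : Set K :=
  {a | (q : K) * a ∈ L}

/-- `W⁰ ⊆ W`: the elements that vanish at all places `v ∈ S` with `|θ|_v ≠ 1`. -/
def W0 : AddSubgroup (W θ) where
  carrier := {w | (∀ v : InfinitePlace K, v θ ≠ 1 → w.1 v = 0) ∧ ∀ v : BadPlace θ, w.2 v = 0}
  zero_mem' := ⟨fun _ _ => rfl, fun _ => rfl⟩
  add_mem' := by
    rintro a b ⟨ha, ha'⟩ ⟨hb, hb'⟩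
    refine ⟨fun v hv => ?_, fun v => ?_⟩
    · change a.1 v + b.1 v = 0
      rw [ha v hv, hb v hv, add_zero]
    · change a.2 v + b.2 v = 0
      rw [ha' v, hb' v, add_zero]
  neg_mem' := by
    rintro a ⟨ha, ha'⟩
    refine ⟨fun v hv => ?_, fun v => ?_⟩
    · change -a.1 v = 0
      rw [ha v hv, neg_zero]
    · change -a.2 v = 0
      rw [ha' v, neg_zero]

/-- The ball of radius `r` around `0` in `W⁰` for the norm `max_v |w_v|`. -/
def ball0 (r : ℝ) : Set (W0 θ) :=
  {w | ‖(w : W θ).1‖ < r}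

/-- `W' = ∏ K_v` over the places `v ∈ S` with `|θ|_v ≠ 1`, so that `W = W⁰ × W'`. -/
def WTrans : Type _ :=
  (∀ v : {v : InfinitePlace K // v θ ≠ 1}, v.1.Completion) ×
    (∀ v : BadPlace θ, v.1.adicCompletion K)

instance : TopologicalSpace (WTrans θ) :=
  inferInstanceAs (TopologicalSpace
    ((∀ v : {v : InfinitePlace K // v θ ≠ 1}, v.1.Completion) ×
      (∀ v : BadPlace θ, v.1.adicCompletion K)))

instance : MeasurableSpace (WTrans θ) := borel (WTrans θ)

/-- The coordinate projection `κ : W → W'`. -/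
def transProj (w : W θ) : WTrans θ :=
  (fun v => w.1 v.1, w.2)

end Solenoid

section Conditional

/-- `ν = (ν_x)` is a decomposition of `μ` with respect to the sigma-algebra `𝒜`: a system of
conditional probability measures, constant on the atoms of `𝒜` and carried by them. -/
structure IsDecomposition {X : Type*} (𝒜 : MeasurableSpace X) [mX : MeasurableSpace X]
    (μ : Measure X) (ν : X → Measure X) : Prop where
  isProbability : ∀ x, IsProbabilityMeasure (ν x)
  congr_atom : ∀ x y, @measurableAtom X 𝒜 x = @measurableAtom X 𝒜 y → ν x = ν y
  carried_by_atom : ∀ᵐ x ∂μ, ν x (@measurableAtom X 𝒜 x) = 1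
  borel : ∀ B : Set X, MeasurableSet[mX] B → Measurable fun x => ν x B
  condExp : ∀ f : X → ℝ, Measurable[mX] f → (∃ C : ℝ, ∀ x, |f x| ≤ C) →
    (fun x => ∫ y, f y ∂(ν x)) =ᵐ[μ] μ[f|𝒜]

end Conditional

section Leaves

variable {K : Type*} [Field K] [NumberField K] {θ : K}
variable {X : Type*} [AddCommGroup X] [TopologicalSpace X] [MeasurableSpace X]

/-- The quotient map `π : W → W / ι(L) ≅ X`. -/
def proj {L : Submodule (Algebra.adjoin ℤ ({θ, θ⁻¹} : Set K)) K}
    (φ : (W θ ⧸ lattice θ L) ≃ₜ+ X) (w : W θ) : X :=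
  φ (QuotientAddGroup.mk w)

/-- The map `T_x ∘ π : W⁰ → X`, `w ↦ x + π(w)`, that parametrizes the central leaf through `x`. -/
def leafMap (p : W θ → X) (x : X) (w : W0 θ) : X := x + p (w : W θ)

/-- The ball of radius `r` around `x` in the central leaf through `x`. -/
def leafBall (p : W θ → X) (x : X) (r : ℝ) : Set X := leafMap p x '' ball0 θ r

/-- The translate `Δ + ι(a)`. -/
def translate (Δ : Set (W θ)) (a : K) : Set (W θ) := (fun d => d + diag θ a) '' Δ

/-- `Δ` is a relatively compact Borel fundamental domain for `ι(Λ)` in `W`. -/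
structure IsFundamentalDomain (Λ : Set K) (Δ : Set (W θ)) : Prop where
  borel : MeasurableSet Δ
  compact_closure : IsCompact (closure Δ)
  disjoint : ∀ a ∈ Λ, a ≠ 0 → Disjoint Δ (translate Δ a)
  cover : ⋃ a ∈ Λ, translate Δ a = Set.univ

/-- The partition `{π(Δ + ι(a)) : a ∈ Λ}` of `X`. -/
def cells (p : W θ → X) (Λ : Set K) (Δ : Set (W θ)) : Set (Set X) :=
  (fun a => p '' translate Δ a) '' Λ

/-- The intersection of the leaf `W⁰ + w` of `W` with `Δ + ι(a)`, translated back to `W⁰`. -/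
def slice (Δ : Set (W θ)) (a : K) (w : W θ) : Set (W0 θ) :=
  {u | (u : W θ) + w ∈ translate Δ a}

/-- The sigma-algebra on `X` generated by the sets `π(κ⁻¹(B) ∩ (Δ + ι(a)))`, `B ⊆ W'` Borel,
`a ∈ Λ`; its atoms are the sets `π((W⁰ + w) ∩ (Δ + ι(a)))`, `w ∈ Δ + ι(a)`. -/
abbrev leafAlgebra (p : W θ → X) (Λ : Set K) (Δ : Set (W θ)) : MeasurableSpace X :=
  MeasurableSpace.generateFrom
    {E | ∃ a ∈ Λ, ∃ B : Set (WTrans θ), MeasurableSet B ∧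
      E = p '' (transProj θ ⁻¹' B ∩ translate Δ a)}

/-- `Δ^(n)`, `n ≥ 1`, is a sequence of fundamental domains for `ι(Λ)`, `Λ = q⁻¹ L`, whose
associated partitions of `X` have `μ`-null boundaries, meet every leaf in pieces with disjoint
compact closures, and are asymptotically invariant along the leaves. -/
structure IsFolnerSequence (p : W θ → X) (L : Submodule (Algebra.adjoin ℤ ({θ, θ⁻¹} : Set K)) K)
    (q : ℕ) (μ : Measure X) (Δ : ℕ → Set (W θ)) : Prop where
  fundamental : ∀ n, 1 ≤ n → IsFundamentalDomain (scaled θ L q) (Δ n)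
  null_boundary : ∀ n, 1 ≤ n → ∀ Q ∈ cells p (scaled θ L q) (Δ n), μ (frontier Q) = 0
  compact_pieces : ∀ n, 1 ≤ n → ∀ a ∈ scaled θ L q, ∀ w : W θ,
    IsCompact (closure (slice (Δ n) a w))
  disjoint_pieces : ∀ n, 1 ≤ n → ∀ a ∈ scaled θ L q, ∀ b ∈ scaled θ L q, a - b ∈ L → a ≠ b →
    ∀ w : W θ, Disjoint (closure (slice (Δ n) a w)) (closure (slice (Δ n) b w))
  almost_invariant : ∀ n, 1 ≤ n →
    ∑' Q : cells p (scaled θ L q) (Δ n),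
      μ (symmDiff ((Q : Set X) + (fun w : W0 θ => p (w : W θ)) '' ball0 θ n) (Q : Set X)) ≤
        (2 : ℝ≥0∞)⁻¹ ^ n

/-- `ρ` is the conditional measure on the central leaf through `x`, viewed as a measure on `W⁰`:
`ρ(B) = lim_k ν^(k)_x (T_x π(B)) / ν^(k)_x (B_F(x, r₀))` for every Borel set `B ⊆ W⁰`. -/
def IsLeafMeasure (p : W θ → X) (ν : ℕ → X → Measure X) (r₀ : ℝ) (x : X)
    (ρ : Measure (W0 θ)) : Prop :=
  ∀ B : Set (W0 θ), MeasurableSet B →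
    Tendsto (fun k => ν k x (leafMap p x '' B) / ν k x (leafBall p x r₀)) atTop (𝓝 (ρ B))

end Leaves

end CentralFoliation

end

noncomputable section

namespace CentralFoliation


/-! ### Polish topology on `W` and its factors -/

section SolenoidTopology

variable {K : Type*} [Field K] [NumberField K]

/-! Existence of the leaf measures is a gluing argument. Two leaf algebras have the same trace on
the intersection of a cell of one with a cell of the other, so their conditional measures are
proportional there (`IsDecomposition.ae_forall_mul_eq_mul`,
`IsFundamentalDomain.comap_leafAlgebra`). By Borel–Cantelli the atom of almost every point
eventually contains the leaf ball of radius n, so the normalized conditional measures fit together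
to one measure on the leaf that is finite on balls (`ae_exists_leafMeasure`).

Finiteness comes from characters. Ergodicity makes θ not a root of unity, so leaves are injectively
immersed complex coordinate spaces on which `α` acts by a rotation g. Let χ be a nontrivial
character of `X` that on the leaf through 0 is the exponential of i times a real linear form. Total
irreducibility forces g to be generic and the form to involve every coordinate. The closed group
generated by g then contains a one-parameter group with generic frequencies, and integration by
parts along it shows that Birkhoff averages of χ are eventually small at leaf points far from 0
(`IsLeafChar.exists_forall_eventually_norm_average_le`).

By the mean ergodic theorem the averages of χ converge almost everywhere along a subsequence to some
F. The values of χ at two points of one leaf correlate through the leaf point that is their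
difference. A large-sieve inequality therefore allows |F| > ε only on a bounded subset of each leaf
(`IsLeafChar.exists_bound_of_tendsto`). On the other hand, almost every point of A = {|F| > ε} sees
A with conditional probability that does not tend to 0 (`ae_not_tendsto_zero`), whereas a bounded
set loses all its conditional mass if the leaf measure is infinite. Hence the leaf measure is finite
almost everywhere on {F ≠ 0}.

So every such F vanishes almost everywhere on the bad set. Let m be the restriction of `μ` to the
union of the preimages of a measurable hull of that set. It is invariant, and all nontrivial leaf
characters integrate to 0 against it. An explicit character built from the trace of K, together with
total irreducibility, shows that the common kernel of the leaf characters is finite. Modulo this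
kernel m is a multiple of Haar measure. Since m is singular to Haar measure, it vanishes
(`measure_eq_zero_of_forall_integral_eq_zero`). -/

instance countable_of_numberField : Countable K := by
  have b := Module.finBasis ℚ K
  exact b.equivFun.toEquiv.countable_iff.2 inferInstance

instance countable_heightOneSpectrum : Countable (HeightOneSpectrum (𝓞 K)) := by
  have : Countable (𝓞 K) := RingOfIntegers.coe_injective.countable (β := K)
  have hs : Function.Surjective fun s : Finset (𝓞 K) => Ideal.span (s : Set (𝓞 K)) := fun I =>
    (IsNoetherian.noetherian I).imp fun _ h => h
  have : Countable (Ideal (𝓞 K)) := hs.countable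
  exact Function.Injective.countable (f := HeightOneSpectrum.asIdeal)
    fun _ _ h => HeightOneSpectrum.ext h

/-- A place with |θ|_v ≠ 1 is a pole of θ or of its inverse. Finiteness is what makes the subgroup
`integralAtBad` open. -/
theorem finite_badPlace {θ : K} (hθ : θ ≠ 0) : Finite (BadPlace θ) := by
  have h : {v : HeightOneSpectrum (𝓞 K) | v.valuation K θ ≠ 1}.Finite := by
    refine ((HeightOneSpectrum.Support.finite (𝓞 K) θ).union
      (HeightOneSpectrum.Support.finite (𝓞 K) θ⁻¹)).subset fun v hv => ?_
    rcases lt_or_gt_of_ne hv with h | h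
    · right
      change 1 < v.valuation K θ⁻¹
      rw [map_inv₀]
      exact (one_lt_inv₀ (zero_lt_iff.2 ((Valuation.ne_zero_iff _).2 hθ))).2 h
    · exact Or.inl h
  exact h.to_subtype

/-- Completions of the countable field K are Polish. This is needed so that injective continuous
images of Borel sets are Borel, which makes cells and pieces of leaves measurable. -/
theorem polishSpace_of_denseRange {F : Type*} [MetricSpace F] [CompleteSpace F] {ι : Type*}
    [Countable ι] (f : ι → F) (hf : DenseRange f) : PolishSpace F := by
  have : TopologicalSpace.SeparableSpace F := ⟨⟨Set.range f, Set.countable_range f, hf⟩⟩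
  have : SecondCountableTopology F := UniformSpace.secondCountable_of_separable F
  infer_instance

instance polishSpace_completion (v : InfinitePlace K) : PolishSpace v.Completion := by
  have : Countable (WithAbs v.1) := (WithAbs.equiv v.1).toEquiv.countable_iff.2 inferInstance
  exact polishSpace_of_denseRange _ (InfinitePlace.Completion.denseRange_coe v)

instance polishSpace_adicCompletion (v : HeightOneSpectrum (𝓞 K)) :
    PolishSpace (v.adicCompletion K) := by
  have : Countable (WithVal (v.valuation K)) :=
    (WithVal.equiv (v.valuation K)).toEquiv.countable_iff.2 inferInstance
  refine polishSpace_of_denseRange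
    (fun x : WithVal (v.valuation K) => (x : v.adicCompletion K)) ?_
  exact (HeightOneSpectrum.adicCompletion.uniformEquiv K
    v).symm.toHomeomorph.surjective.denseRange.comp UniformSpace.Completion.denseRange_coe
    (HeightOneSpectrum.adicCompletion.uniformEquiv K v).symm.continuous

instance polishSpace_W (θ : K) : PolishSpace (W θ) :=
  inferInstanceAs (PolishSpace
    ((∀ v : InfinitePlace K, v.Completion) × (∀ v : BadPlace θ, v.1.adicCompletion K)))

instance t1Space_WTrans (θ : K) : T1Space (WTrans θ) :=
  inferInstanceAs (T1Space ((∀ v : {v : InfinitePlace K // v θ ≠ 1}, v.1.Completion) ×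
    (∀ v : BadPlace θ, v.1.adicCompletion K)))

instance borelSpace_WTrans (θ : K) : BorelSpace (WTrans θ) := ⟨rfl⟩

theorem diag_injective (θ : K) : Function.Injective (diag θ) := by
  intro a b h
  obtain ⟨v⟩ : Nonempty (InfinitePlace K) := inferInstance
  have h1 : algebraMap K v.Completion a = algebraMap K v.Completion b :=
    congrFun (congrArg Prod.fst h) v
  exact (algebraMap K v.Completion).injective h1

theorem continuous_transProj (θ : K) : Continuous (transProj θ) := by
  refine Continuous.prodMk (continuous_pi fun v => ?_) continuous_snd
  exact (continuous_apply v.1).comp continuous_fst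

theorem mem_W0_iff {θ : K} {w : W θ} : w ∈ W0 θ ↔ transProj θ w = transProj θ 0 := by
  constructor
  · rintro ⟨h1, h2⟩
    exact Prod.ext (funext fun v => h1 v.1 v.2) (funext h2)
  · intro h
    exact ⟨fun v hv => congrFun (congrArg Prod.fst h) ⟨v, hv⟩,
      fun v => congrFun (congrArg Prod.snd h) v⟩

theorem sub_mem_W0_iff {θ : K} {w w' : W θ} :
    w - w' ∈ W0 θ ↔ transProj θ w = transProj θ w' := by
  constructor
  · rintro ⟨h1, h2⟩
    exact Prod.ext (funext fun v => sub_eq_zero.1 (h1 v.1 v.2))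
      (funext fun v => sub_eq_zero.1 (h2 v))
  · intro h
    exact ⟨fun v hv => sub_eq_zero.2 (congrFun (congrArg Prod.fst h) ⟨v, hv⟩),
      fun v => sub_eq_zero.2 (congrFun (congrArg Prod.snd h) v)⟩

theorem isClosed_W0 (θ : K) : IsClosed (W0 θ : Set (W θ)) := by
  have h : (W0 θ : Set (W θ)) = transProj θ ⁻¹' {transProj θ 0} := by
    ext w
    exact mem_W0_iff
  rw [h]
  exact isClosed_singleton.preimage (continuous_transProj θ)

instance polishSpace_W0 (θ : K) : PolishSpace (W0 θ) := (isClosed_W0 θ).polishSpace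

end SolenoidTopology

/-! ### The lattice, the quotient map and fundamental domains -/

section Projection

variable {K : Type*} [Field K] [NumberField K] {θ : K}
variable {X : Type*} [AddCommGroup X] [TopologicalSpace X]
variable {L : Submodule (Algebra.adjoin ℤ ({θ, θ⁻¹} : Set K)) K}
variable (φ : (W θ ⧸ lattice θ L) ≃ₜ+ X)

theorem proj_add (w w' : W θ) : proj φ (w + w') = proj φ w + proj φ w' :=
  map_add φ.toAddEquiv (QuotientAddGroup.mk w) (QuotientAddGroup.mk w')

theorem proj_zero : proj φ 0 = 0 := map_zero φ.toAddEquiv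

theorem proj_neg (w : W θ) : proj φ (-w) = -proj φ w :=
  map_neg φ.toAddEquiv (QuotientAddGroup.mk w)

theorem proj_sub (w w' : W θ) : proj φ (w - w') = proj φ w - proj φ w' :=
  map_sub φ.toAddEquiv (QuotientAddGroup.mk w) (QuotientAddGroup.mk w')

theorem continuous_proj : Continuous (proj φ) :=
  φ.continuous_toFun.comp continuous_quot_mk

theorem isOpenMap_proj : IsOpenMap (proj φ) :=
  φ.toHomeomorph.isOpenMap.comp QuotientAddGroup.isOpenMap_coe

theorem proj_surjective : Function.Surjective (proj φ) :=
  φ.surjective.comp (QuotientAddGroup.mk_surjective)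

theorem proj_eq_zero_iff {w : W θ} : proj φ w = 0 ↔ ∃ l ∈ L, diag θ l = w := by
  rw [← map_zero φ]
  change φ _ = φ _ ↔ _
  rw [φ.injective.eq_iff, QuotientAddGroup.eq_zero_iff]
  rfl

theorem proj_eq_iff {w w' : W θ} : proj φ w = proj φ w' ↔ ∃ l ∈ L, w = w' + diag θ l := by
  rw [← sub_eq_zero, ← proj_sub, proj_eq_zero_iff]
  simp only [sub_eq_iff_eq_add', @eq_comm _ (diag θ _)]

theorem proj_add_diag {l : K} (hl : l ∈ L) (w : W θ) : proj φ (w + diag θ l) = proj φ w :=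
  (proj_eq_iff φ).2 ⟨l, hl, rfl⟩

include φ in
theorem isClosed_lattice [T1Space X] : IsClosed (lattice θ L : Set (W θ)) := by
  have h : (lattice θ L : Set (W θ)) = proj φ ⁻¹' {0} := by
    ext w
    rw [Set.mem_preimage, Set.mem_singleton_iff, proj_eq_zero_iff]
    rfl
  rw [h]
  exact isClosed_singleton.preimage (continuous_proj φ)

include φ in
-- Baire category: the lattice is a countable closed subgroup of a Polish group, so some singleton
-- has interior, and translation makes {0} open.
theorem discreteTopology_lattice [T1Space X] : DiscreteTopology (lattice θ L) := by
  have hcl := isClosed_lattice φ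
  have : PolishSpace (lattice θ L) := hcl.polishSpace
  have hc : Countable (lattice θ L) := by
    have : Function.Surjective fun l : L => (⟨diag θ l.1, l.1, l.2, rfl⟩ : lattice θ L) := by
      rintro ⟨w, l, hl, rfl⟩
      exact ⟨⟨l, hl⟩, rfl⟩
    have : Countable L := Subtype.countable
    exact Function.Surjective.countable ‹_›
  obtain ⟨x, hx⟩ := nonempty_interior_of_iUnion_of_closed
    (f := fun x : lattice θ L => {x}) (fun _ => isClosed_singleton)
    (Set.iUnion_of_singleton _)
  have hxo : IsOpen ({x} : Set (lattice θ L)) := by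
    obtain ⟨y, hy⟩ := hx
    have h1 := interior_subset hy
    rw [Set.mem_singleton_iff] at h1
    subst h1
    rw [isOpen_iff_mem_nhds]
    rintro z rfl
    exact mem_interior_iff_mem_nhds.1 hy
  refine discreteTopology_of_isOpen_singleton_zero ?_
  have := hxo.preimage (continuous_add_const x)
  convert this
  ext y
  simp

include φ in
theorem finite_lattice_inter [T1Space X] {C : Set (W θ)} (hC : IsCompact C) :
    {l : K | l ∈ L ∧ diag θ l ∈ C}.Finite := by
  have hd := discreteTopology_lattice φ
  have hcl := isClosed_lattice φ
  have h1 : (C ∩ (lattice θ L : Set (W θ))).Finite := by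
    have h2 : IsCompact (Subtype.val ⁻¹' C : Set (lattice θ L)) :=
      hcl.isClosedEmbedding_subtypeVal.isCompact_preimage hC
    have h3 := (isCompact_iff_finite.1 h2).image Subtype.val
    refine h3.subset ?_
    rintro w ⟨hw, hw'⟩
    exact ⟨⟨w, hw'⟩, hw, rfl⟩
  refine Set.Finite.of_finite_image (f := diag θ) (h1.subset ?_) (diag_injective θ).injOn
  rintro _ ⟨l, ⟨hl, hl'⟩, rfl⟩
  exact ⟨hl', l, hl, rfl⟩

include φ in
theorem secondCountableTopology_of_proj : SecondCountableTopology X :=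
  ((isOpenMap_proj φ).isQuotientMap (continuous_proj φ)
    (proj_surjective φ)).secondCountableTopology (isOpenMap_proj φ)

theorem leafMap_apply (x : X) (w : W0 θ) : leafMap (proj φ) x w = x + proj φ (w : W θ) := rfl

theorem leafMap_proj (w₀ : W θ) (w : W0 θ) :
    leafMap (proj φ) (proj φ w₀) w = proj φ (w₀ + w) := (proj_add φ _ _).symm

theorem continuous_leafMap [ContinuousAdd X] (x : X) : Continuous (leafMap (proj φ) x) :=
  continuous_const.add ((continuous_proj φ).comp continuous_subtype_val)

theorem mem_translate {Δ : Set (W θ)} {a : K} {w : W θ} :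
    w ∈ translate Δ a ↔ w - diag θ a ∈ Δ := by
  constructor
  · rintro ⟨d, hd, rfl⟩
    simpa using hd
  · intro h
    exact ⟨_, h, by simp⟩

theorem measurableSet_translate {Δ : Set (W θ)} (hΔ : MeasurableSet Δ) (a : K) :
    MeasurableSet (translate Δ a) := by
  have h : translate Δ a = (fun w => w - diag θ a) ⁻¹' Δ := by
    ext w
    exact mem_translate
  rw [h]
  exact hΔ.preimage (continuous_id.sub continuous_const).measurable

omit [NumberField K] in
theorem mem_scaled_add {q : ℕ} {a b : K} (ha : a ∈ scaled θ L q) (hb : b ∈ scaled θ L q) :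
    a + b ∈ scaled θ L q := by
  simp only [scaled, Set.mem_ofPred_eq, mul_add] at *
  exact L.add_mem ha hb

omit [NumberField K] in
theorem mem_scaled_sub {q : ℕ} {a b : K} (ha : a ∈ scaled θ L q) (hb : b ∈ scaled θ L q) :
    a - b ∈ scaled θ L q := by
  simp only [scaled, Set.mem_ofPred_eq, mul_sub] at *
  exact L.sub_mem ha hb

omit [NumberField K] in
theorem mem_scaled_of_mem {q : ℕ} {a : K} (ha : a ∈ L) : a ∈ scaled θ L q := by
  simp only [scaled, Set.mem_ofPred_eq]
  rw [← nsmul_eq_mul]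
  exact L.nsmul_mem ha q

section FundamentalDomain

variable {q : ℕ} {Δ : Set (W θ)} (hΔ : IsFundamentalDomain (scaled θ L q) Δ)
include hΔ

theorem IsFundamentalDomain.eq_of_mem {a b : K} (ha : a ∈ scaled θ L q) (hb : b ∈ scaled θ L q)
    {w : W θ} (hwa : w ∈ translate Δ a) (hwb : w ∈ translate Δ b) : a = b := by
  by_contra hab
  have h1 := hΔ.disjoint (b - a) (mem_scaled_sub hb ha) (sub_ne_zero.2 (Ne.symm hab))
  rw [mem_translate] at hwa hwb
  refine Set.disjoint_left.1 h1 hwa (mem_translate.2 ?_)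
  simpa [map_sub] using hwb

theorem IsFundamentalDomain.exists_mem (w : W θ) : ∃ a ∈ scaled θ L q, w ∈ translate Δ a := by
  have h : w ∈ ⋃ a ∈ scaled θ L q, translate Δ a := hΔ.cover ▸ Set.mem_univ w
  simpa using h

/-- The lattice of the quotient is L, contained in Λ, so two points of one cell that differ by an
element of L would lie in two Λ-translates. -/
theorem IsFundamentalDomain.injOn_proj {a : K} (ha : a ∈ scaled θ L q) :
    Set.InjOn (proj φ) (translate Δ a) := by
  intro w hw w' hw' h
  obtain ⟨l, hl, rfl⟩ := (proj_eq_iff φ).1 h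
  have h1 : w' + diag θ l ∈ translate Δ (a + l) := by
    rw [mem_translate] at hw' ⊢
    simpa [map_add] using hw'
  have h2 := hΔ.eq_of_mem ha (mem_scaled_add ha (mem_scaled_of_mem hl)) hw h1
  have h3 : l = 0 := by simpa using h2.symm
  simp [h3]

theorem IsFundamentalDomain.measurableSet_image [T2Space X] [MeasurableSpace X] [BorelSpace X]
    {a : K} (ha : a ∈ scaled θ L q) {s : Set (W θ)} (hs : MeasurableSet s)
    (hsa : s ⊆ translate Δ a) : MeasurableSet (proj φ '' s) :=
  hs.image_of_continuousOn_injOn (continuous_proj φ).continuousOn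
    ((hΔ.injOn_proj φ ha).mono hsa)

end FundamentalDomain

end Projection


/-! ### Conditional measures: proportionality and recurrence -/

section Decomposition

variable {X : Type*} {𝒜 ℬ : MeasurableSpace X} [mX : MeasurableSpace X]
  {μ : Measure X} [IsProbabilityMeasure μ] {ν ξ : X → Measure X}

/-- Otherwise the conditional expectation is 0 by convention, while the constant function 1
integrates to 1 against every conditional measure. -/
theorem IsDecomposition.le (h : @IsDecomposition X 𝒜 mX μ ν) : 𝒜 ≤ mX := by
  by_contra hle
  have h1 := h.condExp (fun _ => 1) measurable_const ⟨1, by simp⟩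
  rw [condExp_of_not_le hle] at h1
  obtain ⟨x, hx⟩ := h1.exists
  have := h.isProbability x
  simp at hx

/-- A conditional probability agrees almost everywhere with an `𝒜`-measurable function clamped to
[0, 1]. Boundedness everywhere lets products of such versions serve as test functions. -/
theorem IsDecomposition.exists_version (h : @IsDecomposition X 𝒜 mX μ ν) {F : Set X}
    (hF : MeasurableSet[mX] F) :
    ∃ a : X → ℝ, Measurable[𝒜] a ∧ (∀ x, 0 ≤ a x ∧ a x ≤ 1) ∧
      (fun x => (ν x).real F) =ᵐ[μ] a ∧
      ∀ g : X → ℝ, Measurable[𝒜] g → (∃ C : ℝ, ∀ x, |g x| ≤ C) →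
        ∫ x in F, g x ∂μ = ∫ x, a x * g x ∂μ := by
  have hle := h.le
  have hint : Integrable (F.indicator fun _ => (1 : ℝ)) μ := (integrable_const 1).indicator hF
  have h1 : (fun x => (ν x).real F) =ᵐ[μ] μ[F.indicator fun _ => (1 : ℝ)|𝒜] := by
    refine EventuallyEq.trans ?_ (h.condExp (F.indicator fun _ => 1)
      (measurable_const.indicator hF) ⟨1, fun x => ?_⟩)
    · refine Eventually.of_forall fun x => ?_
      change _ = ∫ y, F.indicator (fun _ => (1 : ℝ)) y ∂(ν x)
      rw [integral_indicator_const (μ := ν x) (1 : ℝ) hF]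
      simp
    · by_cases hx : x ∈ F <;> simp [hx]
  set c := μ[F.indicator fun _ => (1 : ℝ)|𝒜] with hc
  have hcm : Measurable[𝒜] c := stronglyMeasurable_condExp.measurable
  have h2 : (fun x => max 0 (min 1 (c x))) =ᵐ[μ] c := by
    filter_upwards [h1] with x hx
    have := h.isProbability x
    rw [← hx, min_eq_right measureReal_le_one, max_eq_right measureReal_nonneg]
  refine ⟨fun x => max 0 (min 1 (c x)), measurable_const.max (measurable_const.min hcm),
    fun x => ⟨le_max_left _ _, max_le zero_le_one (min_le_left _ _)⟩, h1.trans h2.symm, ?_⟩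
  rintro g hg ⟨C, hC⟩
  have hgm : Measurable[mX] g := hg.mono hle le_rfl
  have hgi : Integrable (fun x => F.indicator (fun _ => (1 : ℝ)) x * g x) μ :=
    hint.mul_bdd hgm.aestronglyMeasurable (Eventually.of_forall hC)
  have h3 : μ[(F.indicator fun _ => (1 : ℝ)) * g|𝒜] =ᵐ[μ] c * g :=
    condExp_mul_of_stronglyMeasurable_right hg.stronglyMeasurable hgi hint
  calc ∫ x in F, g x ∂μ = ∫ x, ((F.indicator fun _ => (1 : ℝ)) * g) x ∂μ := by
        rw [← integral_indicator hF]
        refine integral_congr_ae (Eventually.of_forall fun x => ?_)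
        by_cases hx : x ∈ F <;> simp [hx]
    _ = ∫ x, (μ[(F.indicator fun _ => (1 : ℝ)) * g|𝒜]) x ∂μ := (integral_condExp hle).symm
    _ = ∫ x, (max 0 (min 1 (c x))) * g x ∂μ := by
        refine integral_congr_ae (h3.trans ?_)
        filter_upwards [h2] with x hx
        simp [hx]

/-- Testing the version of the conditional probability of `D` on its own zero set shows that this
zero set meets `D` in a null set. -/
theorem IsDecomposition.ae_ne_zero (h : @IsDecomposition X 𝒜 mX μ ν) {D : Set X}
    (hD : MeasurableSet[mX] D) : ∀ᵐ x ∂μ, x ∈ D → ν x D ≠ 0 := by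
  obtain ⟨a, ham, ha01, hae, hai⟩ := h.exists_version hD
  have hle := h.le
  set Z : Set X := {x | a x = 0} with hZ
  have hZm : MeasurableSet[𝒜] Z := ham (measurableSet_singleton 0)
  have h1 := hai (Z.indicator fun _ => 1) ((@measurable_const _ _ _ 𝒜 _).indicator hZm) ⟨1, fun x => by
    by_cases hx : x ∈ Z <;> simp [hx]⟩
  have h2 : ∀ x, a x * Z.indicator (fun _ => (1 : ℝ)) x = 0 := fun x => by
    by_cases hx : x ∈ Z
    · have : a x = 0 := hx
      simp [this]
    · simp [hx]
  simp only [h2, integral_zero] at h1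
  rw [integral_indicator (hle _ hZm), setIntegral_const, smul_eq_mul, mul_one,
    measureReal_restrict_apply (hle _ hZm), measureReal_eq_zero_iff] at h1
  filter_upwards [measure_eq_zero_iff_ae_notMem.1 h1, hae] with x hx hx' hxD h0
  exact hx ⟨by rw [hZ, Set.mem_ofPred_eq, ← hx', measureReal_def, h0]; rfl, hxD⟩

omit mX in
theorem exists_measurable_extension {D : Set X}
    (hD : MeasurableSpace.comap (Subtype.val : D → X) 𝒜 =
      MeasurableSpace.comap (Subtype.val : D → X) ℬ) {f : X → ℝ} (hf : Measurable[ℬ] f)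
    (hf1 : ∀ x, 0 ≤ f x ∧ f x ≤ 1) :
    ∃ g : X → ℝ, Measurable[𝒜] g ∧ (∀ x, 0 ≤ g x ∧ g x ≤ 1) ∧ ∀ x ∈ D, g x = f x := by
  have h1 : Measurable[MeasurableSpace.comap (Subtype.val : D → X) 𝒜] (f ∘ (Subtype.val : D → X)) := by
    rw [hD]
    exact hf.comp (@comap_measurable _ _ ℬ _)
  obtain ⟨g, hg, hfg⟩ := @Measurable.exists_eq_measurable_comp D X ℝ 𝒜 _ _ _ _ _ h1
  refine ⟨fun x => max 0 (min 1 (g x)), measurable_const.max (measurable_const.min hg),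
    fun x => ⟨le_max_left _ _, max_le zero_le_one (min_le_left _ _)⟩, fun x hx => ?_⟩
  have h2 : f x = g x := congrFun hfg ⟨x, hx⟩
  simp only
  rw [← h2, min_eq_right (hf1 x).2, max_eq_right (hf1 x).1]

/-- Conditional measures for sigma-algebras with the same trace on `D` are proportional on `D`. -/
theorem IsDecomposition.ae_mul_eq_mul (h : @IsDecomposition X 𝒜 mX μ ν)
    (h' : @IsDecomposition X ℬ mX μ ξ) {D : Set X} (hD : MeasurableSet[mX] D)
    (hcomap : MeasurableSpace.comap (Subtype.val : D → X) 𝒜 =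
      MeasurableSpace.comap (Subtype.val : D → X) ℬ) {E : Set X} (hE : MeasurableSet[mX] E) :
    ∀ᵐ x ∂μ, x ∈ D → ν x (E ∩ D) * ξ x D = ξ x (E ∩ D) * ν x D := by
  obtain ⟨a, ham, ha01, hae, hai⟩ := h.exists_version hD
  obtain ⟨e, hem, he01, hee, hei⟩ := h.exists_version (hE.inter hD)
  obtain ⟨b, hbm, hb01, hbe, hbi⟩ := h'.exists_version hD
  obtain ⟨d, hdm, hd01, hde, hdi⟩ := h'.exists_version (hE.inter hD)
  obtain ⟨a', ham', ha01', haD⟩ := exists_measurable_extension hcomap.symm ham ha01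
  obtain ⟨e', hem', he01', heD⟩ := exists_measurable_extension hcomap.symm hem he01
  obtain ⟨b', hbm', hb01', hbD⟩ := exists_measurable_extension hcomap hbm hb01
  obtain ⟨d', hdm', hd01', hdD⟩ := exists_measurable_extension hcomap hdm hd01
  have hle := h.le
  have hle' := h'.le
  have bd : ∀ {u v : ℝ}, 0 ≤ u ∧ u ≤ 1 → 0 ≤ v ∧ v ≤ 1 → 0 ≤ u * v ∧ u * v ≤ 1 := fun hu hv =>
    ⟨mul_nonneg hu.1 hv.1, mul_le_one₀ hu.2 hv.1 hv.2⟩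
  have bd1 : ∀ {u v : ℝ}, 0 ≤ u ∧ u ≤ 1 → 0 ≤ v ∧ v ≤ 1 → |u - v| ≤ 1 := fun hu hv =>
    abs_sub_le_iff.2 ⟨by linarith [hu.2, hv.1], by linarith [hu.1, hv.2]⟩
  have bd2 : ∀ {u v : ℝ}, 0 ≤ u ∧ u ≤ 1 → |v| ≤ 1 → |u * v| ≤ 1 := fun hu hv => by
    rw [abs_mul, abs_of_nonneg hu.1]
    exact mul_le_one₀ hu.2 (abs_nonneg _) hv
  -- On `D` both `p` and `r` are the difference of the two sides of the claim. The first is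
  -- `𝒜`-measurable and the second `ℬ`-measurable, so each may be used as a test function for its
  -- own decomposition.
  set p : X → ℝ := fun x => e x * b' x - d' x * a x with hp
  set r : X → ℝ := fun x => e' x * b x - d x * a' x with hr
  have hpm : Measurable[𝒜] p := (hem.mul hbm').sub (hdm'.mul ham)
  have hrm : Measurable[ℬ] r := (hem'.mul hbm).sub (hdm.mul ham')
  have hp1 : ∀ x, |p x| ≤ 1 := fun x => bd1 (bd (he01 x) (hb01' x)) (bd (hd01' x) (ha01 x))
  have hr1 : ∀ x, |r x| ≤ 1 := fun x => bd1 (bd (he01' x) (hb01 x)) (bd (hd01 x) (ha01' x))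
  have hpr : ∀ x ∈ D, r x = p x := fun x hx => by
    simp only [hp, hr, haD x hx, heD x hx, hbD x hx, hdD x hx]
  have k1 := hai (fun x => (e x * b' x) * p x) ((hem.mul hbm').mul hpm)
    ⟨1, fun x => bd2 (bd (he01 x) (hb01' x)) (hp1 x)⟩
  have k2 := hei (fun x => (a x * b' x) * p x) ((ham.mul hbm').mul hpm)
    ⟨1, fun x => bd2 (bd (ha01 x) (hb01' x)) (hp1 x)⟩
  have k3 := hbi (fun x => (d x * a' x) * r x) ((hdm.mul ham').mul hrm)
    ⟨1, fun x => bd2 (bd (hd01 x) (ha01' x)) (hr1 x)⟩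
  have k4 := hdi (fun x => (b x * a' x) * r x) ((hbm.mul ham').mul hrm)
    ⟨1, fun x => bd2 (bd (hb01 x) (ha01' x)) (hr1 x)⟩
  -- The integral over `E ∩ D` can be computed through either decomposition. Comparing the two
  -- results identifies the two halves of the integral of `p ^ 2` over `D`, which is therefore 0.
  have k5 : ∫ x in E ∩ D, (a x * b' x) * p x ∂μ = ∫ x in E ∩ D, (b x * a' x) * r x ∂μ := by
    refine setIntegral_congr_fun (hE.inter hD) fun x hx => ?_
    simp only [hpr x hx.2, haD x hx.2, hbD x hx.2]
    ring
  have k6 : ∫ x in D, (e x * b' x) * p x ∂μ = ∫ x in D, (d x * a' x) * r x ∂μ := by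
    rw [k1, k3]
    calc _ = ∫ x, e x * ((a x * b' x) * p x) ∂μ := by congr 1; ext x; ring
      _ = ∫ x, d x * ((b x * a' x) * r x) ∂μ := by rw [← k2, k5, k4]
      _ = _ := by congr 1; ext x; ring
  have hint : ∀ u : X → ℝ, Measurable[mX] u → (∀ x, |u x| ≤ 1) → Integrable u (μ.restrict D) :=
    fun u hu hu1 => (integrable_const (1 : ℝ)).mono' hu.aestronglyMeasurable
      (Eventually.of_forall hu1)
  have hpm' : Measurable[mX] p := hpm.mono hle le_rfl
  have k7 : ∫ x in D, p x ^ 2 ∂μ = 0 := by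
    have : ∫ x in D, p x ^ 2 ∂μ = ∫ x in D, ((e x * b' x) * p x - (d x * a' x) * r x) ∂μ := by
      refine setIntegral_congr_fun hD fun x hx => ?_
      simp only [hpr x hx, haD x hx]
      simp only [hp, hdD x hx]
      ring
    rw [this, integral_sub, k6, sub_self]
    · exact hint _ (((hem.mul hbm').mul hpm).mono hle le_rfl)
        fun x => bd2 (bd (he01 x) (hb01' x)) (hp1 x)
    · exact hint _ (((hdm.mul ham').mul hrm).mono hle' le_rfl)
        fun x => bd2 (bd (hd01 x) (ha01' x)) (hr1 x)
  rw [integral_eq_zero_iff_of_nonneg (fun x => sq_nonneg _) (hint _ (hpm'.pow_const 2) fun x => by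
    rw [abs_pow]; exact pow_le_one₀ (abs_nonneg _) (hp1 x))] at k7
  rw [EventuallyEq, ae_restrict_iff' hD] at k7
  filter_upwards [k7, hae, hee, hbe, hde] with x hx h1 h2 h3 h4 hxD
  have h5 : p x = 0 := by simpa using hx hxD
  simp only [hp, hbD x hxD, hdD x hxD, ← h1, ← h2, ← h3, ← h4, sub_eq_zero] at h5
  have := h.isProbability x
  have := h'.isProbability x
  rw [measureReal_def, measureReal_def, measureReal_def, measureReal_def, ← ENNReal.toReal_mul,
    ← ENNReal.toReal_mul, ENNReal.toReal_eq_toReal_iff' (ENNReal.mul_ne_top (measure_ne_top _ _)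
    (measure_ne_top _ _)) (ENNReal.mul_ne_top (measure_ne_top _ _) (measure_ne_top _ _))] at h5
  exact h5

/-- A countable generating algebra gives one null set for all `E`: two finite measures that agree on
a generating π-system are equal. -/
theorem IsDecomposition.ae_forall_mul_eq_mul [hcg : @MeasurableSpace.CountablyGenerated X mX]
    (h : @IsDecomposition X 𝒜 mX μ ν)
    (h' : @IsDecomposition X ℬ mX μ ξ) {D : Set X} (hD : MeasurableSet[mX] D)
    (hcomap : MeasurableSpace.comap (Subtype.val : D → X) 𝒜 =
      MeasurableSpace.comap (Subtype.val : D → X) ℬ) :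
    ∀ᵐ x ∂μ, x ∈ D → ∀ E : Set X, MeasurableSet[mX] E →
      ν x (E ∩ D) * ξ x D = ξ x (E ∩ D) * ν x D := by
  set C := generateSetAlgebra (@MeasurableSpace.countableGeneratingSet X mX hcg) with hC
  have hCc : C.Countable :=
    countable_generateSetAlgebra (@MeasurableSpace.countable_countableGeneratingSet X mX hcg)
  have hgen : mX = MeasurableSpace.generateFrom C := by
    rw [hC, generateFrom_generateSetAlgebra_eq,
      @MeasurableSpace.generateFrom_countableGeneratingSet X mX hcg]
  have hpi : IsPiSystem C := fun s hs t ht _ =>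
    isSetAlgebra_generateSetAlgebra.inter_mem hs ht
  have h1 : ∀ᵐ x ∂μ, ∀ E ∈ C, x ∈ D → ν x (E ∩ D) * ξ x D = ξ x (E ∩ D) * ν x D := by
    rw [ae_ball_iff hCc]
    intro E hE
    refine h.ae_mul_eq_mul h' hD hcomap ?_
    rw [hgen]
    exact MeasurableSpace.measurableSet_generateFrom hE
  filter_upwards [h1] with x hx hxD E hE
  have := h.isProbability x
  have := h'.isProbability x
  have : IsFiniteMeasure (ξ x D • (ν x).restrict D) :=
    Measure.smul_finite _ (measure_ne_top _ _)
  have key : ξ x D • (ν x).restrict D = ν x D • (ξ x).restrict D := by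
    refine ext_of_generate_finite C hgen hpi (fun s hs => ?_) ?_
    · have hsm : MeasurableSet[mX] s := by
        rw [hgen]
        exact MeasurableSpace.measurableSet_generateFrom hs
      simp only [Measure.smul_apply, Measure.restrict_apply hsm, smul_eq_mul]
      rw [mul_comm, hx s hs hxD, mul_comm]
    · simp [mul_comm]
  have := congrArg (fun m => m E) key
  simp only [Measure.smul_apply, Measure.restrict_apply hE, smul_eq_mul] at this
  rw [mul_comm, this, mul_comm]

/-- Recurrence: for a sequence of decompositions, almost every point `x` of `A` sees `A` with
conditional probability that does not tend to zero. -/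
theorem ae_not_tendsto_zero {𝒜 : ℕ → MeasurableSpace X} {ν : ℕ → X → Measure X}
    (h : ∀ k, 1 ≤ k → @IsDecomposition X (𝒜 k) mX μ (ν k)) {A : Set X}
    (hA : MeasurableSet[mX] A) :
    ∀ᵐ x ∂μ, x ∈ A → ¬ Tendsto (fun k => ν k x A) atTop (𝓝 0) := by
  have hm : ∀ k, Measurable[mX] fun x => ν (k + 1) x A := fun k => (h (k + 1) (by omega)).borel A hA
  set E : Set X := A ∩ {x | Tendsto (fun k => ν (k + 1) x A) atTop (𝓝 0)} with hE
  have hEm : MeasurableSet[mX] E := hA.inter (measurableSet_tendsto _ hm)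
  -- If e is the conditional probability of `E`, then ∫_E e = ∫ e² ≥ (∫ e)² = μ(E)², and e is at
  -- most the conditional probability of `A`. The right-hand side tends to 0 by the choice of `E`,
  -- so `E` is null.
  have hk : ∀ k, μ.real E ^ 2 ≤ ∫ x in E, (ν (k + 1) x).real A ∂μ := by
    intro k
    have hd := h (k + 1) (by omega)
    obtain ⟨e, hem, he01, hee, hei⟩ := hd.exists_version hEm
    have h1 := hei e hem ⟨1, fun x => by rw [abs_of_nonneg (he01 x).1]; exact (he01 x).2⟩
    have h0 := hei (fun _ => 1) measurable_const ⟨1, by simp⟩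
    have hei1 : Integrable e μ := (integrable_const (1 : ℝ)).mono'
      (hem.mono hd.le le_rfl).aestronglyMeasurable (Eventually.of_forall fun x => by
        rw [Real.norm_of_nonneg (he01 x).1]; exact (he01 x).2)
    have hei2 : Integrable (fun x => e x * e x) μ := (integrable_const (1 : ℝ)).mono'
      ((hem.mul hem).mono hd.le le_rfl).aestronglyMeasurable (Eventually.of_forall fun x => by
        rw [Real.norm_of_nonneg (mul_nonneg (he01 x).1 (he01 x).1)]
        exact mul_le_one₀ (he01 x).2 (he01 x).1 (he01 x).2)
    simp only [mul_one, setIntegral_const, smul_eq_mul] at h0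
    have h2 : μ.real E ^ 2 ≤ ∫ x in E, e x ∂μ := by
      rw [h1, h0]
      have h3 : 0 ≤ ∫ x, (e x - ∫ y, e y ∂μ) ^ 2 ∂μ := integral_nonneg fun x => sq_nonneg _
      have h4 : ∀ x, (e x - ∫ y, e y ∂μ) ^ 2 =
          e x * e x - 2 * (∫ y, e y ∂μ) * e x + (∫ y, e y ∂μ) ^ 2 := fun x => by ring
      simp only [h4] at h3
      have h5 : ∫ x, (e x * e x - 2 * (∫ y, e y ∂μ) * e x + (∫ y, e y ∂μ) ^ 2) ∂μ =
          ∫ x, (e x * e x - 2 * (∫ y, e y ∂μ) * e x) ∂μ + ∫ _, (∫ y, e y ∂μ) ^ 2 ∂μ :=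
        integral_add (hei2.sub (hei1.const_mul _)) (integrable_const _)
      rw [h5, integral_sub hei2 (hei1.const_mul _), integral_const_mul, integral_const] at h3
      simp only [probReal_univ, smul_eq_mul, one_mul] at h3
      nlinarith
    refine h2.trans ?_
    rw [← setIntegral_congr_ae hEm (hee.mono fun x hx _ => hx)]
    have hbE : Measurable[mX] fun x => (ν (k + 1) x).real E := (hd.borel E hEm).ennreal_toReal
    have hbA : Measurable[mX] fun x => (ν (k + 1) x).real A := (hd.borel A hA).ennreal_toReal
    have hb : ∀ (s : Set X) (x : X), ‖(ν (k + 1) x).real s‖ ≤ 1 := fun s x => by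
      have := hd.isProbability x
      rw [Real.norm_of_nonneg measureReal_nonneg]
      exact measureReal_le_one
    refine integral_mono ((integrable_const (1 : ℝ)).mono' hbE.aestronglyMeasurable
      (Eventually.of_forall (hb E))) ((integrable_const (1 : ℝ)).mono' hbA.aestronglyMeasurable
      (Eventually.of_forall (hb A))) fun x => ?_
    have := hd.isProbability x
    exact measureReal_mono Set.inter_subset_left
  have hlim : Tendsto (fun k => ∫ x in E, (ν (k + 1) x).real A ∂μ) atTop (𝓝 0) := by
    have : (0 : ℝ) = ∫ x in E, (0 : ℝ) ∂μ := by simp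
    rw [this]
    refine tendsto_integral_of_dominated_convergence (fun _ => 1)
      (fun k => (hm k).ennreal_toReal.aestronglyMeasurable) (integrable_const _)
      (fun k => Eventually.of_forall fun x => ?_) ?_
    · have := (h (k + 1) (by omega)).isProbability x
      rw [Real.norm_of_nonneg measureReal_nonneg]
      exact measureReal_le_one
    · rw [ae_restrict_iff' hEm]
      refine Eventually.of_forall fun x hx => ?_
      exact (ENNReal.tendsto_toReal ENNReal.zero_ne_top).comp hx.2
  have hz : μ.real E = 0 := by
    have := ge_of_tendsto' hlim hk
    nlinarith [sq_nonneg (μ.real E)]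
  rw [measureReal_eq_zero_iff] at hz
  filter_upwards [measure_eq_zero_iff_ae_notMem.1 hz] with x hx hxA ht
  exact hx ⟨hxA, ht.comp (tendsto_add_atTop_nat 1)⟩

end Decomposition


/-! ### Traces and atoms of the leaf algebras -/

section LeafAlgebra

variable {K : Type*} [Field K] [NumberField K] {θ : K}
variable {X : Type*} [AddCommGroup X] [TopologicalSpace X]
variable {L : Submodule (Algebra.adjoin ℤ ({θ, θ⁻¹} : Set K)) K}
variable (φ : (W θ ⧸ lattice θ L) ≃ₜ+ X)

/-- Translation by `-κ(ι(l))` on `W'`. -/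
def transShift (l : K) (t : WTrans θ) : WTrans θ :=
  (fun v => t.1 v - algebraMap K v.1.Completion l,
    fun v => t.2 v - algebraMap K (v.1.adicCompletion K) l)

theorem measurable_transShift (l : K) : Measurable (transShift (θ := θ) l) := by
  refine Continuous.measurable ?_
  refine Continuous.prodMk (continuous_pi fun v => ?_) (continuous_pi fun v => ?_)
  · exact ((continuous_apply v).comp continuous_fst).sub continuous_const
  · exact ((continuous_apply v).comp continuous_snd).sub continuous_const

theorem transProj_sub_diag (w : W θ) (l : K) :
    transProj θ (w - diag θ l) = transShift l (transProj θ w) := rfl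

variable {q : ℕ} {Δ : Set (W θ)} (hΔ : IsFundamentalDomain (scaled θ L q) Δ)
include hΔ

/-- In the coordinates of the cell at `a`, a generator carried by the cell at `b` is empty unless
the cells have the same image, and is then a transversal set moved by a translation. Traces and
atoms are read off from this. -/
theorem IsFundamentalDomain.mem_image_iff {a b : K} (ha : a ∈ scaled θ L q)
    (hb : b ∈ scaled θ L q) {w : W θ} (hw : w ∈ translate Δ a) (B : Set (WTrans θ)) :
    proj φ w ∈ proj φ '' (transProj θ ⁻¹' B ∩ translate Δ b) ↔
      a - b ∈ L ∧ transShift (a - b) (transProj θ w) ∈ B := by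
  constructor
  · rintro ⟨u, ⟨huB, hu⟩, huw⟩
    obtain ⟨l, hl, rfl⟩ := (proj_eq_iff φ).1 huw
    have h1 : w ∈ translate Δ (b - l) := by
      rw [mem_translate] at hu ⊢
      have : w - diag θ (b - l) = w + diag θ l - diag θ b := by rw [map_sub]; abel
      rwa [this]
    have h2 := hΔ.eq_of_mem ha (mem_scaled_sub hb (mem_scaled_of_mem hl)) hw h1
    have h3 : a - b = -l := by rw [h2]; ring
    rw [h3]
    refine ⟨L.neg_mem hl, ?_⟩
    rw [← transProj_sub_diag, map_neg, sub_neg_eq_add]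
    exact huB
  · rintro ⟨hl, hB⟩
    refine ⟨w - diag θ (a - b), ⟨by rwa [Set.mem_preimage, transProj_sub_diag], ?_⟩, ?_⟩
    · rw [mem_translate] at hw ⊢
      have : w - diag θ (a - b) - diag θ b = w - diag θ a := by rw [map_sub]; abel
      rwa [this]
    · rw [sub_eq_add_neg, ← map_neg]
      exact proj_add_diag φ (L.neg_mem hl) w

/-- The right-hand side does not involve `Δ` or `a`. Two leaf algebras therefore have the same trace
on the image of any set contained in a cell of each. -/
theorem IsFundamentalDomain.comap_leafAlgebra {a : K} (ha : a ∈ scaled θ L q) {T : Set (W θ)}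
    (hT : T ⊆ translate Δ a) :
    MeasurableSpace.comap (Subtype.val : (proj φ '' T : Set X) → X)
        (leafAlgebra (proj φ) (scaled θ L q) Δ) =
      MeasurableSpace.generateFrom {S | ∃ B : Set (WTrans θ), MeasurableSet B ∧
        S = Subtype.val ⁻¹' (proj φ '' (transProj θ ⁻¹' B ∩ T))} := by
  rw [leafAlgebra, MeasurableSpace.comap_generateFrom]
  apply le_antisymm
  · refine MeasurableSpace.generateFrom_le ?_
    rintro _ ⟨_, ⟨b, hb, B, hB, rfl⟩, rfl⟩
    by_cases hab : a - b ∈ L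
    · refine MeasurableSpace.measurableSet_generateFrom
        ⟨transShift (a - b) ⁻¹' B, measurable_transShift (a - b) hB, ?_⟩
      ext ⟨_, w, hw, rfl⟩
      simp only [Set.mem_preimage]
      rw [hΔ.mem_image_iff φ ha hb (hT hw)]
      constructor
      · rintro ⟨-, h⟩
        exact ⟨w, ⟨h, hw⟩, rfl⟩
      · rintro ⟨u, ⟨hu, huT⟩, huw⟩
        have := hΔ.injOn_proj φ ha (hT huT) (hT hw) huw
        subst this
        exact ⟨hab, hu⟩
    · have : (Subtype.val : (proj φ '' T : Set X) → X) ⁻¹'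
          (proj φ '' (transProj θ ⁻¹' B ∩ translate Δ b)) = ∅ := by
        ext ⟨_, w, hw, rfl⟩
        simp only [Set.mem_preimage]
        rw [hΔ.mem_image_iff φ ha hb (hT hw)]
        simp [hab]
      rw [this]
      exact @MeasurableSet.empty _ (_)
  · refine MeasurableSpace.generateFrom_le ?_
    rintro _ ⟨B, hB, rfl⟩
    refine MeasurableSpace.measurableSet_generateFrom ⟨_, ⟨a, ha, B, hB, rfl⟩, ?_⟩
    ext ⟨_, w, hw, rfl⟩
    simp only [Set.mem_preimage]
    constructor
    · rintro ⟨u, ⟨hu, hua⟩, huw⟩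
      have := hΔ.injOn_proj φ ha hua (hT hw) huw
      subst this
      exact ⟨u, ⟨hu, hw⟩, rfl⟩
    · rintro ⟨u, ⟨hu, huT⟩, huw⟩
      exact ⟨u, ⟨hu, hT huT⟩, huw⟩

theorem IsFundamentalDomain.measurableAtom_eq {a : K} (ha : a ∈ scaled θ L q) {w : W θ}
    (hw : w ∈ translate Δ a) :
    @measurableAtom X (leafAlgebra (proj φ) (scaled θ L q) Δ) (proj φ w) =
      leafMap (proj φ) (proj φ w) '' slice Δ a w := by
  apply Set.Subset.antisymm
  · have hm : MeasurableSet[leafAlgebra (proj φ) (scaled θ L q) Δ]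
        (proj φ '' (transProj θ ⁻¹' {transProj θ w} ∩ translate Δ a)) :=
      MeasurableSpace.measurableSet_generateFrom
        ⟨a, ha, _, measurableSet_singleton _, rfl⟩
    refine (@measurableAtom_subset X (leafAlgebra (proj φ) (scaled θ L q) Δ) _ _ hm
      ⟨w, ⟨rfl, hw⟩, rfl⟩).trans ?_
    rintro _ ⟨u, ⟨hu, hua⟩, rfl⟩
    refine ⟨⟨u - w, sub_mem_W0_iff.2 hu⟩, ?_, ?_⟩
    · simpa [slice] using hua
    · rw [leafMap_proj]
      simp
  · rintro _ ⟨u, hu, rfl⟩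
    rw [leafMap_proj]
    have hu' : w + u ∈ translate Δ a := by
      rw [add_comm]
      exact hu
    have hκ : transProj θ (w + u) = transProj θ w := by
      rw [← sub_mem_W0_iff]
      simp
    have key : ∀ S, MeasurableSet[leafAlgebra (proj φ) (scaled θ L q) Δ] S →
        (proj φ w ∈ S ↔ proj φ (w + u) ∈ S) := by
      intro S hS
      induction S, hS using MeasurableSpace.generateFrom_induction with
      | hC S hS _ =>
        obtain ⟨b, hb, B, hB, rfl⟩ := hS
        rw [hΔ.mem_image_iff φ ha hb hw, hΔ.mem_image_iff φ ha hb hu', hκ]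
      | empty => simp
      | compl S _ h => simp [h]
      | iUnion f _ h => simp [h]
    simp only [measurableAtom, Set.mem_iInter]
    exact fun S hxS hS => (key S hS).1 hxS

end LeafAlgebra

/-! ### Gluing proportional measures along one leaf -/

section LeafMeasure

variable {K : Type*} [Field K] [NumberField K] {θ : K}
variable {X : Type*} [AddCommGroup X] [TopologicalSpace X] [IsTopologicalAddGroup X]
  [T2Space X] [MeasurableSpace X] [BorelSpace X]
variable {L : Submodule (Algebra.adjoin ℤ ({θ, θ⁻¹} : Set K)) K}
variable (φ : (W θ ⧸ lattice θ L) ≃ₜ+ X)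

omit [IsTopologicalAddGroup X] [T2Space X] [MeasurableSpace X] [BorelSpace X] in
theorem leafMap_injective (hinj : ∀ w ∈ W0 θ, proj φ w = 0 → w = 0) (x : X) :
    Function.Injective (leafMap (proj φ) x) := by
  intro u u' h
  have h1 : proj φ ((u : W θ) - u') = 0 := by
    rw [proj_sub, sub_eq_zero]
    exact add_left_cancel h
  exact Subtype.ext (sub_eq_zero.1 (hinj _ ((W0 θ).sub_mem u.2 u'.2) h1))

theorem measurableEmbedding_leafMap (hinj : ∀ w ∈ W0 θ, proj φ w = 0 → w = 0) (x : X) :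
    MeasurableEmbedding (leafMap (proj φ) x) := by
  have := secondCountableTopology_of_proj φ
  exact (continuous_leafMap φ x).measurableEmbedding (leafMap_injective φ hinj x)

omit [TopologicalSpace X] [IsTopologicalAddGroup X] [T2Space X] [MeasurableSpace X] [BorelSpace X]
  [AddCommGroup X] in
theorem isOpen_ball0 (r : ℝ) : IsOpen (ball0 θ r) := by
  have h : Continuous fun w : W0 θ => (w : W θ).1 :=
    (continuous_fst (X := ∀ v : InfinitePlace K, v.Completion)
      (Y := ∀ v : BadPlace θ, v.1.adicCompletion K)).comp continuous_subtype_val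
  exact isOpen_lt h.norm continuous_const

omit [TopologicalSpace X] [IsTopologicalAddGroup X] [T2Space X] [MeasurableSpace X] [BorelSpace X]
  [AddCommGroup X] in
theorem ball0_mono {r s : ℝ} (h : r ≤ s) : ball0 θ r ⊆ ball0 θ s := fun _ hw => lt_of_lt_of_le hw h

/-- The data at a point needed to glue the conditional measures along its leaf. -/
theorem exists_leafMeasure_of_consistent (hinj : ∀ w ∈ W0 θ, proj φ w = 0 → w = 0) {x : X}
    {ν : ℕ → X → Measure X} (hprob : ∀ k, 1 ≤ k → IsProbabilityMeasure (ν k x)) {r₀ : ℝ}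
    {C : ℕ → Set (W0 θ)} (hCm : ∀ k, 1 ≤ k → MeasurableSet (C k))
    (hC : ∀ k, 1 ≤ k → ν k x (leafMap (proj φ) x '' C k) = 1)
    {n₀ : ℕ} (hn₀ : ∀ k, n₀ ≤ k → ball0 θ k ⊆ C k)
    (hC1 : C 1 ⊆ ball0 θ r₀)
    (hpos : ∀ k l, 1 ≤ k → 1 ≤ l → ν k x (leafMap (proj φ) x '' (C k ∩ C l)) ≠ 0)
    (hcons : ∀ k l, 1 ≤ k → 1 ≤ l → ∀ B : Set (W0 θ), MeasurableSet B →
      ν k x (leafMap (proj φ) x '' (B ∩ (C k ∩ C l))) *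
          ν l x (leafMap (proj φ) x '' (C k ∩ C l)) =
        ν l x (leafMap (proj φ) x '' (B ∩ (C k ∩ C l))) *
          ν k x (leafMap (proj φ) x '' (C k ∩ C l))) :
    ∃ ρ : Measure (W0 θ), IsLeafMeasure (proj φ) ν r₀ x ρ ∧ ∀ r : ℝ, ρ (ball0 θ r) < ∞ := by
  have hf := measurableEmbedding_leafMap φ hinj x
  set f := leafMap (proj φ) x with hfdef
  set m : ℕ → Measure (W0 θ) := fun k => (ν k x).comap f with hmdef
  have hm : ∀ k B, m k B = ν k x (f '' B) := fun k B => hf.comap_apply _ _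
  simp only [← hm] at hC hpos hcons
  have hm1 : ∀ k, 1 ≤ k → ∀ B, m k B ≤ 1 := fun k hk B => by
    have := hprob k hk
    rw [hm]
    exact prob_le_one
  have hmfin : ∀ k, 1 ≤ k → ∀ B, m k B ≠ ∞ := fun k hk B =>
    ne_top_of_le_ne_top ENNReal.one_ne_top (hm1 k hk B)
  have hCc : ∀ k, 1 ≤ k → ∀ B, MeasurableSet B → m k (B ∩ C k) = m k B := by
    intro k hk B hB
    have h1 : m k (C k)ᶜ = 0 := by
      have h2 := measure_add_measure_compl (μ := m k) (hCm k hk)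
      rw [hC k hk] at h2
      have h3 : 1 + m k (C k)ᶜ ≤ 1 + 0 := by
        rw [h2, add_zero]
        exact hm1 k hk _
      simpa using (ENNReal.add_le_add_iff_left ENNReal.one_ne_top).1 h3
    exact measure_inter_conull h1
  set N : ℕ := max n₀ (max 1 ⌈r₀⌉₊) with hN
  have hN1 : ∀ k, N ≤ k → 1 ≤ k := fun k hk => le_trans (by simp [hN]) hk
  have hNn : ∀ k, N ≤ k → ball0 θ k ⊆ C k := fun k hk => hn₀ k (le_trans (by simp [hN]) hk)
  have hNr : ∀ k, N ≤ k → ball0 θ r₀ ⊆ C k := fun k hk => by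
    refine (ball0_mono ?_).trans (hNn k hk)
    have : ⌈r₀⌉₊ ≤ k := le_trans (by simp [hN]) hk
    exact (Nat.le_ceil r₀).trans (by exact_mod_cast this)
  set s : ℕ → ℝ≥0∞ := fun k => m k (ball0 θ r₀) with hs
  -- The first piece lies in the ball of radius `r₀`, so positivity on `C k ∩ C 1` makes the
  -- normalizing denominator nonzero.
  have hs0 : ∀ k, N ≤ k → s k ≠ 0 := fun k hk h0 => by
    refine hpos k 1 (hN1 k hk) le_rfl (measure_mono_null ?_ h0)
    exact Set.inter_subset_right.trans hC1
  set ρ : ℕ → Measure (W0 θ) := fun k => (s k)⁻¹ • m k with hρ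
  have hρa : ∀ k B, ρ k B = m k B / s k := fun k B => by
    simp [hρ, div_eq_mul_inv, mul_comm]
  -- Proportional measures with the same value on the ball of radius `r₀`, which lies in both
  -- pieces, are equal on the overlap.
  have hloc : ∀ k l, N ≤ k → N ≤ l → ∀ B, MeasurableSet B →
      ρ k (B ∩ (C k ∩ C l)) = ρ l (B ∩ (C k ∩ C l)) := by
    intro k l hk hl B hB
    have h1 := hcons k l (hN1 k hk) (hN1 l hl) B hB
    have h2 := hcons k l (hN1 k hk) (hN1 l hl) _ (isOpen_ball0 r₀).measurableSet
    have h3 : ball0 θ r₀ ∩ (C k ∩ C l) = ball0 θ r₀ :=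
      Set.inter_eq_left.2 (Set.subset_inter (hNr k hk) (hNr l hl))
    rw [h3] at h2
    have hc0 := hpos k l (hN1 k hk) (hN1 l hl)
    have hd0 : m l (C k ∩ C l) ≠ 0 := by
      rw [Set.inter_comm]
      exact hpos l k (hN1 l hl) (hN1 k hk)
    rw [hρa, hρa, ← ENNReal.mul_div_mul_right _ _ hd0 (hmfin l (hN1 l hl) _), h1]
    change _ / (m k (ball0 θ r₀) * _) = _
    rw [h2, ENNReal.mul_div_mul_right _ _ hc0 (hmfin k (hN1 k hk) _)]
  set D : ℕ → Set (W0 θ) := disjointed fun j => ball0 θ ((N + j : ℕ) : ℝ) with hD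
  have hballU : ⋃ j : ℕ, ball0 θ ((N + j : ℕ) : ℝ) = Set.univ := by
    refine Set.eq_univ_of_forall fun w => Set.mem_iUnion.2 ?_
    obtain ⟨j, hj⟩ := exists_nat_gt ‖(w : W θ).1‖
    refine ⟨j, hj.trans_le ?_⟩
    push_cast
    linarith [(Nat.cast_nonneg N : (0 : ℝ) ≤ N)]
  have hDm : ∀ j, MeasurableSet (D j) := fun j =>
    MeasurableSet.disjointed (fun j => (isOpen_ball0 _).measurableSet) j
  have hDU : ⋃ j, D j = Set.univ := by rw [hD, iUnion_disjointed, hballU]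
  have hDd : Pairwise (Function.onFun Disjoint D) := disjoint_disjointed _
  have hDC : ∀ j, D j ⊆ C (N + j) := fun j =>
    (disjointed_subset _ j).trans (hNn _ (by omega))
  -- On each shell any sufficiently late normalized measure may be used. On `C k` the glued measure
  -- is then `ρ k`, which squeezes `ρ k B` between `R (B ∩ ball0 θ k)` and `R B`.
  set R : Measure (W0 θ) := Measure.sum fun j => (ρ (N + j)).restrict (D j) with hR
  have hRC : ∀ k, N ≤ k → ∀ B, MeasurableSet B → R (B ∩ C k) = ρ k B := by
    intro k hk B hB
    have hBC := hB.inter (hCm k (hN1 k hk))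
    rw [hR, Measure.sum_apply _ hBC]
    have h1 : ∀ j, (ρ (N + j)).restrict (D j) (B ∩ C k) = ρ k (B ∩ C k ∩ D j) := by
      intro j
      rw [Measure.restrict_apply hBC]
      have h2 : B ∩ C k ∩ D j = (B ∩ D j) ∩ (C (N + j) ∩ C k) := by
        ext w
        constructor
        · rintro ⟨⟨h1, h2⟩, h3⟩
          exact ⟨⟨h1, h3⟩, hDC j h3, h2⟩
        · rintro ⟨⟨h1, h3⟩, -, h2⟩
          exact ⟨⟨h1, h2⟩, h3⟩
      rw [h2]
      exact hloc _ _ (by omega) hk _ (hB.inter (hDm j))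
    simp only [h1]
    rw [← measure_iUnion (fun i j hij => (hDd hij).mono Set.inter_subset_right
      Set.inter_subset_right) fun j => hBC.inter (hDm j), ← Set.inter_iUnion, hDU, Set.inter_univ,
      hρa, hρa, hCc k (hN1 k hk) B hB]
  refine ⟨R, fun B hB => ?_, fun r => ?_⟩
  · have h1 : Tendsto (fun k : ℕ => R (B ∩ ball0 θ (k : ℝ))) atTop (𝓝 (R B)) := by
      have h2 : B = ⋃ k : ℕ, B ∩ ball0 θ (k : ℝ) := by
        rw [← Set.inter_iUnion]
        refine (Set.inter_eq_left.2 fun w _ => Set.mem_iUnion.2 ?_).symm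
        exact exists_nat_gt ‖(w : W θ).1‖
      conv => rhs; rw [h2]
      exact tendsto_measure_iUnion_atTop fun i j hij =>
        Set.inter_subset_inter_right _ (ball0_mono (by exact_mod_cast hij))
    refine tendsto_of_tendsto_of_tendsto_of_le_of_le' h1 tendsto_const_nhds
      (eventually_atTop.2 ⟨N, fun k hk => ?_⟩) (eventually_atTop.2 ⟨N, fun k hk => ?_⟩)
    · change _ ≤ ν k x (f '' B) / ν k x (f '' ball0 θ r₀)
      rw [← hm, ← hm]
      refine le_of_le_of_eq ?_ ((hRC k hk B hB).trans (hρa k B))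
      exact measure_mono (Set.inter_subset_inter_right _ (hNn k hk))
    · change ν k x (f '' B) / ν k x (f '' ball0 θ r₀) ≤ _
      rw [← hm, ← hm]
      refine le_of_eq_of_le ((hRC k hk B hB).trans (hρa k B)).symm ?_
      exact measure_mono Set.inter_subset_left
  · set k := max N ⌈r⌉₊ with hk
    have hkN : N ≤ k := le_max_left _ _
    have h1 : ball0 θ r ⊆ C k := by
      refine (ball0_mono ?_).trans (hNn k hkN)
      exact (Nat.le_ceil r).trans (by exact_mod_cast le_max_right N ⌈r⌉₊)
    rw [← Set.inter_eq_left.2 h1, hRC k hkN _ (isOpen_ball0 r).measurableSet, hρa]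
    exact ENNReal.div_lt_top (hmfin k (hN1 k hkN) _) (hs0 k hkN)

end LeafMeasure


/-! ### Almost sure existence of leaf measures and a criterion for finiteness -/

section Gluing

variable {K : Type*} [Field K] [NumberField K] {θ : K}
variable {X : Type*} [AddCommGroup X] [TopologicalSpace X] [IsTopologicalAddGroup X]
  [T2Space X] [MeasurableSpace X] [BorelSpace X]
variable {L : Submodule (Algebra.adjoin ℤ ({θ, θ⁻¹} : Set K)) K}
variable (φ : (W θ ⧸ lattice θ L) ≃ₜ+ X)
variable {μ : Measure X} {q : ℕ} {Δ : ℕ → Set (W θ)}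

omit [IsTopologicalAddGroup X] [MeasurableSpace X] [BorelSpace X] in
/-- A connected bounded piece of a leaf that lies in a single cell lies in a single slice. -/
theorem ball0_subset_slice {D : Set (W θ)} (hD : IsFundamentalDomain (scaled θ L q) D)
    (hdisj : ∀ a ∈ scaled θ L q, ∀ b ∈ scaled θ L q, a - b ∈ L → a ≠ b →
      ∀ w : W θ, Disjoint (closure (slice D a w)) (closure (slice D b w)))
    {r : ℝ} (hr : 0 < r) (hconn : IsPreconnected (ball0 θ r))
    (hcomp : ∃ C : Set (W θ), IsCompact C ∧ ∀ u ∈ ball0 θ r, (u : W θ) ∈ C)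
    {a : K} (ha : a ∈ scaled θ L q) {w : W θ} (hw : w ∈ translate D a)
    (hcell : ∀ u ∈ ball0 θ r, proj φ (w + (u : W θ)) ∈ proj φ '' translate D a) :
    ball0 θ r ⊆ slice D a w := by
  obtain ⟨C, hC, hrC⟩ := hcomp
  -- This compact set contains every lattice vector l for which the piece `a + l` meets the ball
  -- around `w`, so only finitely many pieces compete.
  set C' : Set (W θ) := (C + {w - diag θ a}) + -closure D with hC'
  have hC'c : IsCompact C' := (hC.add isCompact_singleton).add hD.compact_closure.neg
  have hfin := finite_lattice_inter φ hC'c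
  have hl : ∀ u ∈ ball0 θ r, ∃ l ∈ L, diag θ l ∈ C' ∧ u ∈ slice D (a + l) w := by
    intro u hu
    obtain ⟨t, ht, htu⟩ := hcell u hu
    obtain ⟨l, hl, h⟩ := (proj_eq_iff φ).1 htu.symm
    have h1 : t - diag θ a ∈ D := mem_translate.1 ht
    refine ⟨l, hl, ?_, ?_⟩
    · refine ⟨u + (w - diag θ a), ⟨u, hrC u hu, _, rfl, rfl⟩, -(t - diag θ a),
        Set.neg_mem_neg.2 (subset_closure h1), ?_⟩
      have h2 : t = w + u - diag θ l := by rw [h]; abel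
      simp only [h2]
      abel
    · change (u : W θ) + w ∈ translate D (a + l)
      rw [mem_translate, add_comm, h, map_add]
      convert h1 using 1
      abel
  set B : Set (W0 θ) :=
    ⋃ l ∈ {l : K | (l ∈ L ∧ diag θ l ∈ C') ∧ l ≠ 0}, closure (slice D (a + l) w) with hB
  have hBc : IsClosed B :=
    Set.Finite.isClosed_biUnion (hfin.subset fun l hl => hl.1) fun _ _ => isClosed_closure
  have hdis : ∀ u, u ∈ closure (slice D a w) → u ∉ B := by
    intro u hu huB
    simp only [hB, Set.mem_iUnion] at huB
    obtain ⟨l, ⟨⟨hl, -⟩, hl0⟩, hul⟩ := huB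
    refine Set.disjoint_left.1 (hdisj a ha (a + l) (mem_scaled_add ha (mem_scaled_of_mem hl)) ?_ ?_ w)
      hu hul
    · simpa using L.neg_mem hl
    · simpa using hl0
  have hcov : ∀ u ∈ ball0 θ r, u ∈ slice D a w ∨ u ∈ B := by
    intro u hu
    obtain ⟨l, hl, hlC, hul⟩ := hl u hu
    by_cases h0 : l = 0
    · left
      rwa [h0, add_zero] at hul
    · right
      simp only [hB, Set.mem_iUnion]
      exact ⟨l, ⟨⟨hl, hlC⟩, h0⟩, subset_closure hul⟩
  intro u hu
  refine (hcov u hu).resolve_right fun huB => ?_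
  have h0 : (0 : W0 θ) ∈ ball0 θ r := by
    change ‖(0 : ∀ v : InfinitePlace K, v.Completion)‖ < r
    rwa [norm_zero]
  have h0' : (0 : W0 θ) ∈ slice D a w := by
    change ((0 : W0 θ) : W θ) + w ∈ translate D a
    simpa using hw
  -- The ball is covered by two disjoint closed sets, one of which contains its centre. By
  -- connectedness the other does not meet it.
  obtain ⟨z, -, hz1, hz2⟩ := isPreconnected_closed_iff.1 hconn (closure (slice D a w)) B
    isClosed_closure hBc (fun u hu => (hcov u hu).imp_left fun h => subset_closure h)
    ⟨0, h0, subset_closure h0'⟩ ⟨u, hu, huB⟩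
  exact hdis z hz1 hz2

omit [IsTopologicalAddGroup X] [BorelSpace X] in
-- Borel–Cantelli: the exceptional sets have measures bounded by a geometric series. Outside them
-- the whole ball around `x` projects into one cell, and connectedness then puts it in one piece.
theorem IsFolnerSequence.ae_eventually_ball0_subset
    (hF : IsFolnerSequence (proj φ) L q μ Δ)
    (hconn : ∀ r, IsPreconnected (ball0 θ r))
    (hcomp : ∀ r, ∃ C : Set (W θ), IsCompact C ∧ ∀ u ∈ ball0 θ r, (u : W θ) ∈ C) :
    ∀ᵐ x ∂μ, ∃ n₀ : ℕ, ∀ n, n₀ ≤ n → ∀ a ∈ scaled θ L q, ∀ w ∈ translate (Δ n) a,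
      proj φ w = x → ball0 θ n ⊆ slice (Δ n) a w := by
  set Z : ℕ → Set X := fun n => ⋃ Q ∈ cells (proj φ) (scaled θ L q) (Δ (n + 1)),
    symmDiff (Q + (fun w : W0 θ => proj φ (w : W θ)) '' ball0 θ ((n + 1 : ℕ) : ℝ)) Q with hZ
  have hZm : ∀ n, μ (Z n) ≤ (2 : ℝ≥0∞)⁻¹ ^ (n + 1) := by
    intro n
    have hc : (cells (proj φ) (scaled θ L q) (Δ (n + 1))).Countable :=
      (Set.to_countable (scaled θ L q)).image _
    exact (measure_biUnion_le μ hc _).trans (hF.almost_invariant (n + 1) (by omega))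
  have hsum : ∑' n, μ (Z n) ≠ ∞ := by
    refine ne_top_of_le_ne_top ?_ (ENNReal.tsum_le_tsum hZm)
    rw [ENNReal.tsum_geometric_add_one]
    simp [ENNReal.mul_eq_top]
  filter_upwards [ae_eventually_notMem hsum] with x hx
  obtain ⟨n₀, hn₀⟩ := eventually_atTop.1 hx
  refine ⟨n₀ + 1, fun n hn a ha w hw hwx => ?_⟩
  obtain ⟨n, rfl⟩ : ∃ k, n = k + 1 := ⟨n - 1, by omega⟩
  have hFD := hF.fundamental (n + 1) (by omega)
  refine ball0_subset_slice φ hFD (hF.disjoint_pieces (n + 1) (by omega)) (by positivity)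
    (hconn _) (hcomp _) ha hw fun u hu => ?_
  obtain ⟨b, hb, hub⟩ := hFD.exists_mem (w + (u : W θ))
  have hxQ : proj φ w ∈ proj φ '' translate (Δ (n + 1)) b := by
    by_contra hnot
    refine hn₀ n (by omega) ?_
    simp only [hZ, Set.mem_iUnion]
    refine ⟨_, ⟨b, hb, rfl⟩, Or.inl ⟨?_, hwx ▸ hnot⟩⟩
    -- Moving back by `-u` shows that `x` lies in the thickening of the cell containing `x + π(u)`.
    -- As `x` avoids the symmetric difference, it belongs to that cell itself.
    refine ⟨proj φ (w + u), ⟨_, hub, rfl⟩, proj φ ((-u : W0 θ) : W θ), ⟨-u, ?_, rfl⟩, ?_⟩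
    · change ‖-(u : W θ).1‖ < _
      rw [norm_neg]
      exact hu
    · simp only [proj_add, NegMemClass.coe_neg, proj_neg, hwx]
      abel
  obtain ⟨t, ht, htw⟩ := hxQ
  have h1 : proj φ '' translate (Δ (n + 1)) b = proj φ '' translate (Δ (n + 1)) a := by
    obtain ⟨l, hl, rfl⟩ := (proj_eq_iff φ).1 htw
    have h2 : w ∈ translate (Δ (n + 1)) (b - l) := by
      rw [mem_translate] at ht ⊢
      convert ht using 1
      rw [map_sub]
      abel
    have h3 := hFD.eq_of_mem ha (mem_scaled_sub hb (mem_scaled_of_mem hl)) hw h2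
    ext y
    constructor
    · rintro ⟨s, hs, rfl⟩
      refine ⟨s - diag θ l, ?_, ?_⟩
      · rw [mem_translate] at hs ⊢
        convert hs using 1
        rw [h3, map_sub]
        abel
      · rw [sub_eq_add_neg, ← map_neg, proj_add_diag φ (L.neg_mem hl)]
    · rintro ⟨s, hs, rfl⟩
      refine ⟨s + diag θ l, ?_, proj_add_diag φ hl s⟩
      rw [mem_translate] at hs ⊢
      convert hs using 1
      rw [h3, map_sub]
      abel
  rw [← h1]
  exact ⟨_, hub, rfl⟩

variable [IsProbabilityMeasure μ]

theorem ae_exists_leafMeasure (hinj : ∀ w ∈ W0 θ, proj φ w = 0 → w = 0)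
    (hF : IsFolnerSequence (proj φ) L q μ Δ)
    (hconn : ∀ r, IsPreconnected (ball0 θ r))
    (hcomp : ∀ r, ∃ C : Set (W θ), IsCompact C ∧ ∀ u ∈ ball0 θ r, (u : W θ) ∈ C)
    {ν : ℕ → X → Measure X}
    (hν : ∀ k, 1 ≤ k → IsDecomposition
      (leafAlgebra (proj φ) (scaled θ L q) (Δ k)) μ (ν k))
    {r₀ : ℝ}
    (hr₀ : ∀ x : X, @measurableAtom X (leafAlgebra (proj φ) (scaled θ L q) (Δ 1)) x ⊆
      leafBall (proj φ) x r₀) :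
    ∀ᵐ x ∂μ, (∃ ρ : Measure (W0 θ), IsLeafMeasure (proj φ) ν r₀ x ρ ∧
        ∀ r : ℝ, ρ (ball0 θ r) < ∞) ∧
      ∀ k, 1 ≤ k → ν k x (Set.range (leafMap (proj φ) x)) = 1 := by
  have := secondCountableTopology_of_proj φ
  have hcg : MeasurableSpace.CountablyGenerated X := inferInstance
  have hcar : ∀ᵐ x ∂μ, ∀ k, 1 ≤ k →
      ν k x (@measurableAtom X (leafAlgebra (proj φ) (scaled θ L q) (Δ k)) x) = 1 := by
    rw [ae_all_iff]
    intro k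
    by_cases hk : 1 ≤ k
    · filter_upwards [(hν k hk).carried_by_atom] with x hx _ using hx
    · exact Eventually.of_forall fun x h => absurd h hk
  -- There are countably many such intersections, so one null set serves for all pairs of levels and
  -- cells.
  set D : ℕ → ℕ → K → K → Set X := fun k l a b =>
    proj φ '' (translate (Δ k) a ∩ translate (Δ l) b) with hD
  have hcons : ∀ᵐ x ∂μ, ∀ (k l : ℕ) (a b : K), 1 ≤ k → 1 ≤ l → a ∈ scaled θ L q →
      b ∈ scaled θ L q → x ∈ D k l a b → ν k x (D k l a b) ≠ 0 ∧
        ∀ E : Set X, MeasurableSet E → ν k x (E ∩ D k l a b) * ν l x (D k l a b) =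
          ν l x (E ∩ D k l a b) * ν k x (D k l a b) := by
    rw [ae_all_iff]; intro k
    rw [ae_all_iff]; intro l
    rw [ae_all_iff]; intro a
    rw [ae_all_iff]; intro b
    by_cases h : 1 ≤ k ∧ 1 ≤ l ∧ a ∈ scaled θ L q ∧ b ∈ scaled θ L q
    · obtain ⟨hk, hl, ha, hb⟩ := h
      have hFk := hF.fundamental k hk
      have hFl := hF.fundamental l hl
      have hDm : MeasurableSet (D k l a b) :=
        hFk.measurableSet_image φ ha ((measurableSet_translate hFk.borel a).inter
          (measurableSet_translate hFl.borel b)) Set.inter_subset_left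
      have h1 := (hν k hk).ae_ne_zero hDm
      have h2 := (hν k hk).ae_forall_mul_eq_mul (hν l hl) hDm (by
        rw [hFk.comap_leafAlgebra φ ha Set.inter_subset_left,
          hFl.comap_leafAlgebra φ hb Set.inter_subset_right])
      filter_upwards [h1, h2] with x hx1 hx2 _ _ _ _ hx using ⟨hx1 hx, hx2 hx⟩
    · exact Eventually.of_forall fun x h1 h2 h3 h4 => absurd ⟨h1, h2, h3, h4⟩ h
  filter_upwards [hcar, hcons, hF.ae_eventually_ball0_subset φ hconn hcomp] with x hx1 hx2 hx3
  obtain ⟨w, rfl⟩ := proj_surjective φ x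
  have hch : ∀ k, ∃ a ∈ scaled θ L q, 1 ≤ k → w ∈ translate (Δ k) a := by
    intro k
    by_cases hk : 1 ≤ k
    · obtain ⟨a, ha, h⟩ := (hF.fundamental k hk).exists_mem w
      exact ⟨a, ha, fun _ => h⟩
    · exact ⟨0, mem_scaled_of_mem L.zero_mem, fun h => absurd h hk⟩
  choose a ha haw using hch
  obtain ⟨n₀, hn₀⟩ := hx3
  set f := leafMap (proj φ) (proj φ w) with hf
  have hfe : MeasurableEmbedding f := measurableEmbedding_leafMap φ hinj _
  set C : ℕ → Set (W0 θ) := fun k => slice (Δ k) (a k) w with hC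
  have hatom : ∀ k, 1 ≤ k →
      @measurableAtom X (leafAlgebra (proj φ) (scaled θ L q) (Δ k)) (proj φ w) = f '' C k :=
    fun k hk => (hF.fundamental k hk).measurableAtom_eq φ (ha k) (haw k hk)
  have hCm : ∀ k, 1 ≤ k → MeasurableSet (C k) := fun k hk =>
    (measurableSet_translate (hF.fundamental k hk).borel (a k)).preimage
      (continuous_subtype_val.add continuous_const).measurable
  have hprob : ∀ k, 1 ≤ k → IsProbabilityMeasure (ν k (proj φ w)) := fun k hk =>
    (hν k hk).isProbability _
  have hC1 : ∀ k, 1 ≤ k → ν k (proj φ w) (f '' C k) = 1 := fun k hk => by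
    rw [← hatom k hk]
    exact hx1 k hk
  have hmem : ∀ k, 1 ≤ k → ∀ u : W0 θ, u ∈ C k ↔ w + (u : W θ) ∈ translate (Δ k) (a k) :=
    fun k hk u => by rw [add_comm]; rfl
  have hset : ∀ k l, 1 ≤ k → 1 ≤ l → ∀ B : Set (W0 θ),
      f '' B ∩ D k l (a k) (a l) ∩ f '' C k = f '' (B ∩ (C k ∩ C l)) := by
    intro k l hk hl B
    ext y
    constructor
    · rintro ⟨⟨⟨u, huB, rfl⟩, t, ⟨htk, htl⟩, htu⟩, u', hu', huu'⟩
      have := hfe.injective huu'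
      subst this
      refine ⟨u', ⟨huB, hu', ?_⟩, rfl⟩
      have h1 := (hmem k hk u').1 hu'
      rw [hf, leafMap_proj] at htu
      have h2 := (hF.fundamental k hk).injOn_proj φ (ha k) htk h1 htu
      rw [hmem l hl, ← h2]
      exact htl
    · rintro ⟨u, ⟨huB, huk, hul⟩, rfl⟩
      refine ⟨⟨⟨u, huB, rfl⟩, w + u, ⟨(hmem k hk u).1 huk, (hmem l hl u).1 hul⟩, ?_⟩, u, huk, rfl⟩
      rw [hf, leafMap_proj]
  have hDsymm : ∀ k l a b, D k l a b = D l k b a := fun k l a b => by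
    simp only [hD, Set.inter_comm]
  have hconull : ∀ k, 1 ≤ k → ∀ S : Set X,
      ν k (proj φ w) (S ∩ f '' C k) = ν k (proj φ w) S := by
    intro k hk S
    have := hprob k hk
    refine measure_inter_conull ?_
    rw [prob_compl_eq_zero_iff (hfe.measurableSet_image.2 (hCm k hk))]
    exact hC1 k hk
  have hval : ∀ k l, 1 ≤ k → 1 ≤ l → ∀ B : Set (W0 θ),
      ν k (proj φ w) (f '' B ∩ D k l (a k) (a l)) =
        ν k (proj φ w) (f '' (B ∩ (C k ∩ C l))) := fun k l hk hl B => by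
    rw [← hset k l hk hl, hconull k hk]
  have hval' : ∀ k l, 1 ≤ k → 1 ≤ l → ∀ B : Set (W0 θ),
      ν l (proj φ w) (f '' B ∩ D k l (a k) (a l)) =
        ν l (proj φ w) (f '' (B ∩ (C k ∩ C l))) := fun k l hk hl B => by
    rw [hDsymm, hval l k hl hk, Set.inter_comm (C l)]
  have hvalD : ∀ k l, 1 ≤ k → 1 ≤ l →
      ν k (proj φ w) (D k l (a k) (a l)) = ν k (proj φ w) (f '' (C k ∩ C l)) := by
    intro k l hk hl
    rw [← hconull k hk]
    congr 1
    have h1 := hset k l hk hl Set.univ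
    rw [Set.univ_inter] at h1
    rw [← h1]
    ext y
    constructor
    · rintro ⟨hy, u, hu, rfl⟩
      exact ⟨⟨⟨u, trivial, rfl⟩, hy⟩, u, hu, rfl⟩
    · rintro ⟨⟨-, hy⟩, h⟩
      exact ⟨hy, h⟩
  have hvalD' : ∀ k l, 1 ≤ k → 1 ≤ l →
      ν l (proj φ w) (D k l (a k) (a l)) = ν l (proj φ w) (f '' (C k ∩ C l)) := by
    intro k l hk hl
    rw [hDsymm, hvalD l k hl hk, Set.inter_comm (C l)]
  have hxD : ∀ k l, 1 ≤ k → 1 ≤ l → proj φ w ∈ D k l (a k) (a l) := fun k l hk hl =>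
    ⟨w, ⟨haw k hk, haw l hl⟩, rfl⟩
  refine ⟨?_, fun k hk => ?_⟩
  · refine exists_leafMeasure_of_consistent φ hinj hprob hCm hC1 (n₀ := max n₀ 1)
      (fun k hk => hn₀ k ((le_max_left _ _).trans hk) (a k) (ha k) w
        (haw k ((le_max_right _ _).trans hk)) rfl) ?_ ?_ ?_
    · intro u hu
      have h1 : f u ∈ leafBall (proj φ) (proj φ w) r₀ := by
        refine hr₀ _ ?_
        rw [hatom 1 le_rfl]
        exact ⟨u, hu, rfl⟩
      obtain ⟨u', hu', h⟩ := h1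
      rwa [← hfe.injective h]
    · intro k l hk hl
      rw [← hvalD k l hk hl]
      exact (hx2 k l _ _ hk hl (ha k) (ha l) (hxD k l hk hl)).1
    · intro k l hk hl B hB
      have h1 := (hx2 k l _ _ hk hl (ha k) (ha l) (hxD k l hk hl)).2 (f '' B)
        (hfe.measurableSet_image.2 hB)
      rwa [hval k l hk hl, hval' k l hk hl, hvalD k l hk hl, hvalD' k l hk hl] at h1
  · have := hprob k hk
    refine le_antisymm prob_le_one ?_
    rw [← hC1 k hk]
    exact measure_mono (Set.image_subset_range _ _)

omit [T2Space X] [BorelSpace X] [IsTopologicalAddGroup X] [IsProbabilityMeasure μ] in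
/-- A leaf measure is finite if a set that is bounded on the leaf keeps positive conditional
measure. -/
theorem IsLeafMeasure.lt_top_of_not_tendsto {ν : ℕ → X → Measure X} {r₀ : ℝ} {x : X}
    {ρ : Measure (W0 θ)} (hρ : IsLeafMeasure (proj φ) ν r₀ x ρ)
    (hfin : ∀ r : ℝ, ρ (ball0 θ r) < ∞) (hprob : ∀ k, 1 ≤ k → IsProbabilityMeasure (ν k x))
    (hrange : ∀ k, 1 ≤ k → ν k x (Set.range (leafMap (proj φ) x)) = 1)
    (hmeas : MeasurableSet (Set.range (leafMap (proj φ) x))) {A : Set X} {r : ℝ}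
    (hA : ∀ u : W0 θ, leafMap (proj φ) x u ∈ A → u ∈ ball0 θ r)
    (hnt : ¬ Tendsto (fun k => ν k x A) atTop (𝓝 0)) : ρ Set.univ < ∞ := by
  by_contra htop
  rw [not_lt, top_le_iff] at htop
  refine hnt ?_
  have h1 := hρ Set.univ MeasurableSet.univ
  have h2 := hρ (ball0 θ r) (isOpen_ball0 r).measurableSet
  rw [htop, Set.image_univ] at h1
  -- The numerators for the full leaf are 1, so an infinite limit forces the denominators to tend to
  -- 0. Then every ball of finite `ρ`-measure loses its conditional mass.
  have h3 : Tendsto (fun k => ν k x (leafBall (proj φ) x r₀)) atTop (𝓝 0) := by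
    have h4 := tendsto_inv_iff.2 h1
    rw [ENNReal.inv_top] at h4
    refine h4.congr' ?_
    filter_upwards [eventually_ge_atTop 1] with k hk
    rw [hrange k hk, one_div, inv_inv]
  have h5 := ENNReal.Tendsto.mul h2 (Or.inr ENNReal.zero_ne_top) h3 (Or.inr (hfin r).ne)
  rw [mul_zero] at h5
  refine tendsto_of_tendsto_of_tendsto_of_le_of_le' tendsto_const_nhds h5
    (Eventually.of_forall fun _ => zero_le) ?_
  filter_upwards [eventually_ge_atTop 1, h2.eventually (gt_mem_nhds (hfin r))] with k hk hlt
  have := hprob k hk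
  have h6 : ν k x A ≤ ν k x (leafMap (proj φ) x '' ball0 θ r) := by
    rw [← measure_inter_conull (s := A) ((prob_compl_eq_zero_iff hmeas).2 (hrange k hk))]
    refine measure_mono ?_
    rintro _ ⟨hy, u, rfl⟩
    exact ⟨u, hA u hy, rfl⟩
  refine h6.trans ?_
  -- With a zero denominator, a positive numerator would give the ratio ∞, which `hlt` excludes.
  by_cases h0 : ν k x (leafBall (proj φ) x r₀) = 0
  · by_contra hpos
    rw [h0, mul_zero, not_le] at hpos
    rw [h0, ENNReal.div_zero hpos.ne'] at hlt
    exact lt_irrefl _ hlt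
  · rw [ENNReal.div_mul_cancel h0 (measure_ne_top _ _)]

end Gluing


/-! ### Transitivity excludes finite order -/

section Transitivity

variable {X : Type*} [AddCommGroup X] [TopologicalSpace X] [T2Space X] [ConnectedSpace X]

omit [AddCommGroup X] in
theorem infinite_of_connected [Nontrivial X] : Infinite X := by
  by_contra h
  rw [not_infinite_iff_finite] at h
  exact not_subsingleton X (PreconnectedSpace.trivial_of_discrete)

/-- If `α` had finite order, the finite orbit of a point would miss some point y of the infinite
space. Small neighbourhoods of the point and of y could then never be connected by a power of `α`.
-/
theorem IsErgodic.iterate_ne_id [Nontrivial X] {α : X ≃ₜ+ X} (h : IsErgodic α) {k : ℕ}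
    (hk : 0 < k) : ¬ ∀ x, α^[k] x = x := by
  intro hid
  classical
  have hinf := infinite_of_connected (X := X)
  have hz : ∀ (n : ℤ) (x : X), ∃ i < k, iter α n x = α^[i] x := by
    intro n x
    have hpk : (α.toEquiv : Equiv.Perm X) ^ k = 1 := by
      ext y
      rw [Equiv.Perm.coe_pow]
      exact hid y
    refine ⟨(n % k).toNat, ?_, ?_⟩
    · have := Int.emod_lt_of_pos n (by exact_mod_cast hk : (0 : ℤ) < k)
      have := Int.emod_nonneg n (by exact_mod_cast hk.ne' : (k : ℤ) ≠ 0)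
      omega
    · have h1 : (α.toEquiv : Equiv.Perm X) ^ n = (α.toEquiv : Equiv.Perm X) ^ (n % k).toNat := by
        conv_lhs => rw [← Int.emod_add_mul_ediv n k]
        rw [zpow_add, zpow_mul, zpow_natCast, hpk, one_zpow, mul_one, ← zpow_natCast,
          Int.toNat_of_nonneg (Int.emod_nonneg n (by exact_mod_cast hk.ne'))]
      rw [iter, h1, Equiv.Perm.coe_pow]
      rfl
  obtain ⟨x⟩ : Nonempty X := inferInstance
  obtain ⟨y, hy⟩ : ∃ y, y ∉ (Finset.range k).image fun i => α^[i] x :=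
    Infinite.exists_notMem_finset _
  have hne : ∀ i, i < k → α^[i] x ≠ y := fun i hi h =>
    hy (Finset.mem_image.2 ⟨i, Finset.mem_range.2 hi, h⟩)
  have hsep : ∀ i, ∃ U V : Set X, IsOpen U ∧ IsOpen V ∧ α^[i] x ∈ U ∧ (y ∈ V) ∧
      (i < k → Disjoint U V) := by
    intro i
    by_cases hi : i < k
    · obtain ⟨U, V, hU, hV, hx, hy, hd⟩ := t2_separation (hne i hi)
      exact ⟨U, V, hU, hV, hx, hy, fun _ => hd⟩
    · exact ⟨Set.univ, Set.univ, isOpen_univ, isOpen_univ, trivial, trivial, fun h => absurd h hi⟩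
  choose U V hU hV hxU hyV hd using hsep
  have hc : ∀ i, Continuous (α^[i] : X → X) := fun i => α.continuous_toFun.iterate i
  obtain ⟨n, z, ⟨u, hu, rfl⟩, hz'⟩ := h (⋂ i ∈ Finset.range k, α^[i] ⁻¹' U i)
    (⋂ i ∈ Finset.range k, V i)
    (isOpen_biInter_finset fun i _ => (hU i).preimage (hc i))
    (isOpen_biInter_finset fun i _ => hV i)
    ⟨x, by simp only [Set.mem_iInter]; exact fun i _ => hxU i⟩
    ⟨y, by simp only [Set.mem_iInter]; exact fun i _ => hyV i⟩
  obtain ⟨i, hi, hiu⟩ := hz n u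
  rw [hiu] at hz'
  simp only [Set.mem_iInter] at hu hz'
  exact Set.disjoint_left.1 (hd i hi) (hu i (Finset.mem_range.2 hi))
    (hz' i (Finset.mem_range.2 hi))

end Transitivity

/-! ### Central places, Kronecker's theorem and complex coordinates on `W0` -/

section Arithmetic

variable {K : Type*} [Field K] [NumberField K] {θ : K}

/-- The infinite places where `θ` has absolute value one. -/
abbrev CentralPlace (θ : K) : Type _ := {v : InfinitePlace K // v θ = 1}

/-- The conjugates of `θ` of absolute value one. -/
def centralConj (θ : K) (v : CentralPlace θ) : ℂ := v.1.embedding θ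

omit [NumberField K] in
theorem norm_centralConj (v : CentralPlace θ) : ‖centralConj θ v‖ = 1 := by
  rw [centralConj, InfinitePlace.norm_embedding_eq, v.2]

omit [NumberField K] in
theorem centralConj_pow_ne_one (hroot : ∀ k : ℕ, 0 < k → θ ^ k ≠ 1) (v : CentralPlace θ) {k : ℕ}
    (hk : 0 < k) : centralConj θ v ^ k ≠ 1 := by
  intro h
  rw [centralConj, ← map_pow] at h
  exact hroot k hk (v.1.embedding.injective (h.trans (map_one _).symm))

omit [NumberField K] in
-- At a real place, absolute value one means θ maps to ±1, so θ² = 1.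
theorem isComplex_of_central (hroot : ∀ k : ℕ, 0 < k → θ ^ k ≠ 1) {v : InfinitePlace K}
    (hv : v θ = 1) : v.IsComplex := by
  rw [← InfinitePlace.not_isReal_iff_isComplex]
  intro hr
  have h1 := InfinitePlace.norm_embedding_of_isReal hr θ
  rw [hv, Real.norm_eq_abs] at h1
  have h2 : (InfinitePlace.embedding_of_isReal hr θ) ^ 2 = 1 := by
    rw [← sq_abs, h1, one_pow]
  rw [← map_pow] at h2
  exact hroot 2 two_pos ((InfinitePlace.embedding_of_isReal hr).injective (h2.trans (map_one _).symm))

/-- Kronecker: an element that is a unit at all finite places is integral, and an integer all of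
whose conjugates have absolute value one is a root of unity. -/
theorem exists_pow_eq_one (h : ∀ v : InfinitePlace K, v θ = 1)
    (h' : ∀ v : HeightOneSpectrum (𝓞 K), v.valuation K θ = 1) : ∃ k : ℕ, 0 < k ∧ θ ^ k = 1 := by
  obtain ⟨t, ht⟩ := HeightOneSpectrum.mem_integers_of_valuation_le_one (R := 𝓞 K) K θ
    fun v => (h' v).le
  have hint : IsIntegral ℤ θ := by
    rw [← ht]
    exact t.isIntegral_coe
  obtain ⟨k, hk, hk'⟩ := NumberField.Embeddings.pow_eq_one_of_norm_eq_one K ℂ hint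
    fun σ => (InfinitePlace.apply σ θ).symm.trans (h _)
  exact ⟨k, hk, hk'⟩

/-- A nonzero element of K vanishes at no place. Lying in `W0` would then mean that |θ|_v = 1
everywhere. This gives injectivity of the leaf maps. -/
theorem eq_zero_of_diag_mem_W0 (hroot : ∀ k : ℕ, 0 < k → θ ^ k ≠ 1) {l : K}
    (hl : diag θ l ∈ W0 θ) : l = 0 := by
  by_contra h0
  obtain ⟨k, hk, hk'⟩ := exists_pow_eq_one (θ := θ) (fun v => by
    by_contra hv
    exact h0 ((map_eq_zero (algebraMap K v.Completion)).1 (hl.1 v hv))) (fun v => by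
    by_contra hv
    exact h0 ((map_eq_zero (algebraMap K (v.adicCompletion K))).1 (hl.2 ⟨v, hv⟩)))
  exact hroot k hk hk'

variable (hcx : ∀ v : CentralPlace θ, v.1.IsComplex)

open Classical in
/-- The archimedean components of the parametrization `central` of `W⁰`. -/
def centralArch : (CentralPlace θ → ℂ) →+ ∀ v : InfinitePlace K, v.Completion where
  toFun z v := if h : v θ = 1 then
    (InfinitePlace.Completion.ringEquivComplexOfIsComplex (hcx ⟨v, h⟩)).symm (z ⟨v, h⟩) else 0
  map_zero' := by
    funext v
    by_cases h : v θ = 1 <;> simp [h]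
  map_add' z z' := by
    funext v
    by_cases h : v θ = 1 <;> simp [h]

/-- The central coordinates: `W⁰` as a complex coordinate space. -/
def central : (CentralPlace θ → ℂ) →+ W θ where
  toFun z := (centralArch hcx z, 0)
  map_zero' := Prod.ext (map_zero (centralArch hcx)) rfl
  map_add' z z' := Prod.ext (map_add (centralArch hcx) z z') (add_zero _).symm

theorem central_fst_of_eq (z : CentralPlace θ → ℂ) (v : CentralPlace θ) :
    (central hcx z).1 v.1 =
      (InfinitePlace.Completion.ringEquivComplexOfIsComplex (hcx v)).symm (z v) :=
  dif_pos v.2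

theorem central_fst_of_ne (z : CentralPlace θ → ℂ) {v : InfinitePlace K} (h : v θ ≠ 1) :
    (central hcx z).1 v = 0 :=
  dif_neg h

theorem extensionEmbedding_central (z : CentralPlace θ → ℂ) (v : CentralPlace θ) :
    InfinitePlace.Completion.extensionEmbedding v.1 ((central hcx z).1 v.1) = z v := by
  rw [central_fst_of_eq, ← InfinitePlace.Completion.ringEquivComplexOfIsComplex_apply (hcx v),
    RingEquiv.apply_symm_apply]

theorem central_mem_W0 (z : CentralPlace θ → ℂ) : central hcx z ∈ W0 θ :=
  ⟨fun _ hv => central_fst_of_ne hcx z hv, fun _ => rfl⟩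

theorem exists_central_eq {w : W θ} (hw : w ∈ W0 θ) : ∃ z, central hcx z = w := by
  refine ⟨fun v => InfinitePlace.Completion.extensionEmbedding v.1 (w.1 v.1), ?_⟩
  refine Prod.ext (funext fun v => ?_) (funext fun v => (hw.2 v).symm)
  by_cases h : v θ = 1
  · rw [central_fst_of_eq hcx _ ⟨v, h⟩,
      ← InfinitePlace.Completion.ringEquivComplexOfIsComplex_apply (hcx ⟨v, h⟩),
      RingEquiv.symm_apply_apply]
  · rw [central_fst_of_ne hcx _ h, hw.1 v h]

theorem norm_central_apply (z : CentralPlace θ → ℂ) (v : CentralPlace θ) :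
    ‖(central hcx z).1 v.1‖ = ‖z v‖ := by
  rw [← extensionEmbedding_central hcx z v]
  exact ((InfinitePlace.Completion.isometry_extensionEmbedding v.1).norm_map_of_map_zero
    (map_zero _) _).symm

theorem norm_central (z : CentralPlace θ → ℂ) : ‖(central hcx z).1‖ = ‖z‖ := by
  apply le_antisymm
  · refine (pi_norm_le_iff_of_nonneg (norm_nonneg z)).2 fun v => ?_
    by_cases h : v θ = 1
    · rw [norm_central_apply hcx z ⟨v, h⟩]
      exact norm_le_pi_norm z ⟨v, h⟩
    · rw [central_fst_of_ne hcx z h, norm_zero]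
      exact norm_nonneg z
  · refine (pi_norm_le_iff_of_nonneg (norm_nonneg _)).2 fun v => ?_
    rw [← norm_central_apply hcx z v]
    exact norm_le_pi_norm (central hcx z).1 v.1

theorem central_injective : Function.Injective (central hcx) := by
  intro z z' h
  funext v
  rw [← extensionEmbedding_central hcx z v, h, extensionEmbedding_central]

theorem continuous_central : Continuous (central hcx) := by
  refine Continuous.prodMk (continuous_pi fun v => ?_) continuous_const
  by_cases h : v θ = 1
  · simp only [centralArch, AddMonoidHom.coe_mk, ZeroHom.coe_mk, dif_pos h]
    exact (InfinitePlace.Completion.isometryEquivComplexOfIsComplex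
      (hcx ⟨v, h⟩)).symm.continuous.comp (continuous_apply _)
  · simp only [centralArch, AddMonoidHom.coe_mk, ZeroHom.coe_mk, dif_neg h]
    exact continuous_const

theorem central_mul (z : CentralPlace θ → ℂ) :
    central hcx (centralConj θ * z) = diag θ θ * central hcx z := by
  refine Prod.ext (funext fun v => ?_) (mul_zero _).symm
  change _ = (algebraMap K v.Completion θ) * (central hcx z).1 v
  by_cases h : v θ = 1
  · have := central_fst_of_eq hcx (centralConj θ * z) ⟨v, h⟩
    rw [this, central_fst_of_eq hcx z ⟨v, h⟩, RingEquiv.symm_apply_eq, map_mul,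
      RingEquiv.apply_symm_apply, Pi.mul_apply]
    congr 1
    rw [InfinitePlace.Completion.ringEquivComplexOfIsComplex_apply,
      InfinitePlace.Completion.algebraMap_apply]
    exact (InfinitePlace.Completion.extensionEmbedding_coe (v := v)
      ((WithAbs.equiv v.1).symm θ)).symm
  · rw [central_fst_of_ne hcx _ h, central_fst_of_ne hcx _ h, mul_zero]

theorem ball0_eq_image (r : ℝ) :
    ball0 θ r = (fun z => (⟨central hcx z, central_mem_W0 hcx z⟩ : W0 θ)) '' Metric.ball 0 r := by
  ext w
  constructor
  · intro hw
    obtain ⟨z, hz⟩ := exists_central_eq hcx w.2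
    refine ⟨z, ?_, Subtype.ext hz⟩
    rw [mem_ball_zero_iff, ← norm_central hcx, hz]
    exact hw
  · rintro ⟨z, hz, rfl⟩
    rw [mem_ball_zero_iff, ← norm_central hcx] at hz
    exact hz

include hcx in
theorem isPreconnected_ball0 (r : ℝ) : IsPreconnected (ball0 θ r) := by
  rw [ball0_eq_image hcx]
  exact (convex_ball _ _).isPreconnected.image _
    ((continuous_central hcx).subtype_mk _).continuousOn

include hcx in
theorem exists_isCompact_ball0 (r : ℝ) :
    ∃ C : Set (W θ), IsCompact C ∧ ∀ u ∈ ball0 θ r, (u : W θ) ∈ C := by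
  refine ⟨central hcx '' Metric.closedBall 0 r,
    (isCompact_closedBall _ _).image (continuous_central hcx), fun u hu => ?_⟩
  rw [ball0_eq_image hcx] at hu
  obtain ⟨z, hz, rfl⟩ := hu
  exact ⟨z, Metric.ball_subset_closedBall hz, rfl⟩

end Arithmetic

/-! ### Ergodicity in terms of θ -/

section Dynamics

variable {K : Type*} [Field K] [NumberField K] {θ : K}
variable {X : Type*} [AddCommGroup X] [TopologicalSpace X]
variable {L : Submodule (Algebra.adjoin ℤ ({θ, θ⁻¹} : Set K)) K}
variable (φ : (W θ ⧸ lattice θ L) ≃ₜ+ X) {α : X ≃ₜ+ X}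
variable (hφ : ∀ w : W θ, α (proj φ w) = proj φ (mulTheta θ w))

include hφ in
theorem iterate_proj (n : ℕ) (w : W θ) : α^[n] (proj φ w) = proj φ (diag θ (θ ^ n) * w) := by
  induction n with
  | zero => simp
  | succ n ih =>
    rw [Function.iterate_succ_apply', ih, hφ, mulTheta, ← mul_assoc, ← map_mul, pow_succ']

include hφ in
theorem pow_ne_one_of_isErgodic [T2Space X] [ConnectedSpace X] [Nontrivial X]
    (h : IsErgodic α) (k : ℕ) (hk : 0 < k) : θ ^ k ≠ 1 := by
  intro h1
  refine h.iterate_ne_id hk fun x => ?_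
  obtain ⟨w, rfl⟩ := proj_surjective φ x
  rw [iterate_proj φ hφ, h1, map_one, one_mul]

theorem eq_zero_of_proj_eq_zero (hroot : ∀ k : ℕ, 0 < k → θ ^ k ≠ 1) (w : W θ) (hw : w ∈ W0 θ)
    (h : proj φ w = 0) : w = 0 := by
  obtain ⟨l, hl, rfl⟩ := (proj_eq_zero_iff φ).1 h
  rw [eq_zero_of_diag_mem_W0 hroot hw, map_zero]

end Dynamics


/-! ### Oscillatory integrals with trigonometric phases -/

section OscillatoryIntegral

variable {ι : Type*} [Fintype ι]

/-- The real trigonometric polynomial `t ↦ Re ∑ v, c v * exp (i ω v t)`. -/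
def trigPoly (ω : ι → ℝ) (c : ι → ℂ) (t : ℝ) : ℝ :=
  (∑ v, c v * Complex.exp ((ω v * t : ℝ) * Complex.I)).re

/-- The coefficients of the derivative of `trigPoly ω c`. -/
def trigDeriv (ω : ι → ℝ) (c : ι → ℂ) (v : ι) : ℂ := Complex.I * ω v * c v

theorem hasDerivAt_trigPoly (ω : ι → ℝ) (c : ι → ℂ) (t : ℝ) :
    HasDerivAt (trigPoly ω c) (trigPoly ω (trigDeriv ω c) t) t := by
  have h : HasDerivAt (fun t : ℝ => ∑ v, c v * Complex.exp ((ω v * t : ℝ) * Complex.I))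
      (∑ v, trigDeriv ω c v * Complex.exp ((ω v * t : ℝ) * Complex.I)) t := by
    refine HasDerivAt.fun_sum fun v _ => ?_
    have h1 : HasDerivAt (fun t : ℝ => ((ω v * t : ℝ) : ℂ) * Complex.I) (ω v * Complex.I) t := by
      have := ((hasDerivAt_id t).const_mul (ω v)).ofReal_comp.mul_const Complex.I
      simpa using this
    have h2 := (h1.cexp).const_mul (c v)
    refine h2.congr_deriv ?_
    unfold trigDeriv
    ring
  exact (Complex.reCLM.hasFDerivAt.comp_hasDerivAt t h)

theorem continuous_trigPoly (ω : ι → ℝ) (c : ι → ℂ) : Continuous (trigPoly ω c) :=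
  continuous_iff_continuousAt.2 fun t => (hasDerivAt_trigPoly ω c t).continuousAt

theorem continuous_trigPoly_coeff (ω : ι → ℝ) (t : ℝ) : Continuous fun c => trigPoly ω c t := by
  unfold trigPoly
  fun_prop

theorem abs_trigPoly_le (ω : ι → ℝ) (c : ι → ℂ) (t : ℝ) : |trigPoly ω c t| ≤ ∑ v, ‖c v‖ := by
  refine (Complex.abs_re_le_norm _).trans ((norm_sum_le _ _).trans (Finset.sum_le_sum fun v _ => ?_))
  rw [norm_mul, Complex.norm_exp_ofReal_mul_I, mul_one]

theorem analyticAt_trigPoly (ω : ι → ℝ) (c : ι → ℂ) (t : ℝ) : AnalyticAt ℝ (trigPoly ω c) t := by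
  have h : AnalyticAt ℝ (fun t : ℝ => ∑ v, c v * Complex.exp ((ω v * t : ℝ) * Complex.I)) t := by
    refine Finset.analyticAt_fun_sum _ fun v _ => analyticAt_const.mul ?_
    have h1 : AnalyticAt ℝ (fun t : ℝ => ((ω v * t : ℝ) : ℂ) * Complex.I) t := by
      refine AnalyticAt.mul ?_ analyticAt_const
      exact (Complex.ofRealCLM.analyticAt _).comp (analyticAt_const.mul analyticAt_id)
    exact ((analyticAt_cexp (z := _)).restrictScalars (𝕜 := ℝ)).comp h1
  exact (Complex.reCLM.analyticAt _).comp h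

variable {ω : ι → ℝ} (hω : ∀ v, ω v ≠ 0) (hωs : ∀ v v', v ≠ v' → ω v ≠ ω v')
  (hωa : ∀ v v', ω v + ω v' ≠ 0)

/-- The character `t ↦ exp (i a t)` of the additive group of the reals. -/
def realChar (a : ℝ) : Multiplicative ℝ →* ℂ where
  toFun t := Complex.exp ((a * t.toAdd : ℝ) * Complex.I)
  map_one' := by simp
  map_mul' s t := by
    rw [← Complex.exp_add]
    congr 1
    simp only [toAdd_mul]
    push_cast
    ring

theorem realChar_injective : Function.Injective realChar := by
  intro a b h
  have h1 : (fun t : ℝ => Complex.exp ((a * t : ℝ) * Complex.I)) =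
      fun t : ℝ => Complex.exp ((b * t : ℝ) * Complex.I) :=
    funext fun t => DFunLike.congr_fun h (Multiplicative.ofAdd t)
  have hd : ∀ a : ℝ, HasDerivAt (fun t : ℝ => Complex.exp ((a * t : ℝ) * Complex.I))
      (a * Complex.I) 0 := by
    intro a
    have h2 : HasDerivAt (fun t : ℝ => ((a * t : ℝ) : ℂ) * Complex.I) (a * Complex.I) 0 := by
      have := ((hasDerivAt_id (0 : ℝ)).const_mul a).ofReal_comp.mul_const Complex.I
      simpa using this
    simpa using h2.cexp
  have h3 := (hd a).unique (h1 ▸ hd b)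
  exact_mod_cast mul_right_cancel₀ Complex.I_ne_zero h3

include hωs hωa in
-- The characters with frequencies ±ω_v are pairwise distinct (`hωa` with v = v' excludes the
-- frequency 0), hence linearly independent by Dedekind–Artin. The polynomial plus its conjugate is
-- a relation between them.
theorem eq_zero_of_trigPoly_eq_zero {c : ι → ℂ} (h : ∀ t, trigPoly ω c t = 0) : c = 0 := by
  set e : ι ⊕ ι → ℝ := Sum.elim ω (fun v => -ω v) with he
  have hinj : Function.Injective fun i => realChar (e i) := by
    refine realChar_injective.comp ?_
    rintro (v | v) (v' | v') hv
    · by_contra hne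
      exact hωs v v' (fun h => hne (h ▸ rfl)) hv
    · exact absurd (by simp only [he, Sum.elim_inl, Sum.elim_inr] at hv; linarith) (hωa v v')
    · exact absurd (by simp only [he, Sum.elim_inl, Sum.elim_inr] at hv; linarith) (hωa v v')
    · by_contra hne
      exact hωs v v' (fun h => hne (h ▸ rfl)) (neg_injective hv)
  have hli := (linearIndependent_monoidHom (Multiplicative ℝ) ℂ).comp _ hinj
  rw [Fintype.linearIndependent_iff] at hli
  have h0 := hli (Sum.elim c fun v => starRingEnd ℂ (c v)) (by
    funext t
    have h1 := h t.toAdd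
    have h2 : (∑ v, c v * Complex.exp ((ω v * t.toAdd : ℝ) * Complex.I)) +
        starRingEnd ℂ (∑ v, c v * Complex.exp ((ω v * t.toAdd : ℝ) * Complex.I)) = 0 := by
      rw [Complex.add_conj]
      rw [trigPoly] at h1
      rw [h1]
      simp
    rw [map_sum] at h2
    simp only [Fintype.sum_sum_type, Sum.elim_inl, Sum.elim_inr, Finset.sum_apply,
      Pi.smul_apply, smul_eq_mul, Function.comp_apply, Pi.zero_apply]
    refine Eq.trans (congrArg₂ (· + ·) rfl (Finset.sum_congr rfl fun v _ => ?_)) h2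
    rw [map_mul, ← Complex.exp_conj, map_mul, Complex.conj_ofReal, Complex.conj_I]
    congr 1
    change Complex.exp ((-ω v * t.toAdd : ℝ) * Complex.I) = _
    push_cast
    ring_nf)
  funext v
  exact h0 (Sum.inl v)

include hωs hωa in
-- A nonzero real-analytic function has isolated zeros, so its zero set is locally null.
theorem ae_trigPoly_ne_zero {c : ι → ℂ} (hc : c ≠ 0) : ∀ᵐ t : ℝ, trigPoly ω c t ≠ 0 := by
  have hz : ∀ t, ∀ᶠ s in 𝓝[≠] t, trigPoly ω c s ≠ 0 := by
    intro t
    refine (analyticAt_trigPoly ω c t).eventually_eq_zero_or_eventually_ne_zero.resolve_left ?_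
    intro h
    refine hc (eq_zero_of_trigPoly_eq_zero hωs hωa fun s => ?_)
    exact AnalyticOnNhd.eqOn_zero_of_preconnected_of_eventuallyEq_zero
      (fun s _ => analyticAt_trigPoly ω c s) isPreconnected_univ (Set.mem_univ t) h (Set.mem_univ s)
  rw [ae_iff]
  refine measure_null_of_locally_null _ fun t ht => ⟨{t}, ?_, by simp⟩
  have h1 := hz t
  rw [eventually_nhdsWithin_iff] at h1
  rw [mem_nhdsWithin_iff_eventually]
  filter_upwards [h1] with s hs hs'
  by_contra hne
  exact hs' (hs hne)

/-- The weight that regularizes `1 / g'` in the integration by parts. -/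
theorem norm_integral_exp_trigPoly_le (ω : ι → ℝ) (c : ι → ℂ) {r ε M₁ M₂ : ℝ} (hr : 0 < r)
    (hε : 0 < ε) (h₁ : ∀ t, |trigPoly ω (trigDeriv ω c) t| ≤ M₁)
    (h₂ : ∀ t, |trigPoly ω (trigDeriv ω (trigDeriv ω c)) t| ≤ M₂) :
    ‖∫ t in (0 : ℝ)..1, Complex.exp ((r * trigPoly ω c t : ℝ) * Complex.I)‖ ≤
      (2 * M₁ + M₂) / (ε * r) +
        ∫ t in (0 : ℝ)..1, ε / (trigPoly ω (trigDeriv ω c) t ^ 2 + ε) := by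
  set g := trigPoly ω c with hg
  set g1 := trigPoly ω (trigDeriv ω c) with hg1
  set g2 := trigPoly ω (trigDeriv ω (trigDeriv ω c)) with hg2
  have cg : Continuous g := continuous_trigPoly _ _
  have cg1 : Continuous g1 := continuous_trigPoly _ _
  have cg2 : Continuous g2 := continuous_trigPoly _ _
  have hpos : ∀ t, 0 < g1 t ^ 2 + ε := fun t => by positivity
  -- This replaces 1 / g', which is singular at critical points. The defect 1 - ψ g' is ε / (g'² +
  -- ε), which gives the second term of the bound; integration by parts gives the first.
  set ψ : ℝ → ℝ := fun t => g1 t / (g1 t ^ 2 + ε) with hψ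
  set ψ' : ℝ → ℝ := fun t => (g2 t * (g1 t ^ 2 + ε) - g1 t * (2 * g1 t * g2 t)) / (g1 t ^ 2 + ε) ^ 2
    with hψ'
  set u : ℝ → ℂ := fun t => Complex.exp ((r * g t : ℝ) * Complex.I) with hu
  have cu : Continuous u := by fun_prop
  have hun : ∀ t, ‖u t‖ = 1 := fun t => Complex.norm_exp_ofReal_mul_I _
  have hdψ : ∀ t, HasDerivAt ψ (ψ' t) t := by
    intro t
    have hd := hasDerivAt_trigPoly ω (trigDeriv ω c) t
    have := hd.div ((hd.pow 2).add_const ε) (hpos t).ne'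
    refine this.congr_deriv ?_
    simp [hψ', hg1, hg2]
  have hdu : ∀ t, HasDerivAt u (u t * ((r * g1 t : ℝ) * Complex.I)) t := by
    intro t
    have hd := ((hasDerivAt_trigPoly ω c t).const_mul r).ofReal_comp.mul_const Complex.I
    exact hd.cexp
  have cψ : Continuous ψ := cg1.div (by fun_prop) fun t => (hpos t).ne'
  have cψ' : Continuous ψ' := by
    refine Continuous.div (by fun_prop) (by fun_prop) fun t => (pow_pos (hpos t) 2).ne'
  have hψb : ∀ t, |ψ t| ≤ M₁ / ε := by
    intro t
    rw [hψ, abs_div, abs_of_pos (hpos t)]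
    exact div_le_div₀ ((abs_nonneg _).trans (h₁ t)) (h₁ t) hε (by nlinarith [sq_nonneg (g1 t)])
  have hψ'b : ∀ t, |ψ' t| ≤ M₂ / ε := by
    intro t
    have h3 : ψ' t = g2 t * ((ε - g1 t ^ 2) / (g1 t ^ 2 + ε) ^ 2) := by
      rw [hψ']; ring
    have h4 : |(ε - g1 t ^ 2) / (g1 t ^ 2 + ε) ^ 2| ≤ 1 / ε := by
      rw [abs_div, abs_of_pos (pow_pos (hpos t) 2), div_le_div_iff₀ (pow_pos (hpos t) 2) hε]
      have h5 : |ε - g1 t ^ 2| ≤ g1 t ^ 2 + ε := by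
        rw [abs_le]
        constructor <;> nlinarith [sq_nonneg (g1 t)]
      have h6 : ε ≤ g1 t ^ 2 + ε := by nlinarith [sq_nonneg (g1 t)]
      calc _ ≤ (g1 t ^ 2 + ε) * (g1 t ^ 2 + ε) :=
            mul_le_mul h5 h6 hε.le (hpos t).le
        _ = _ := by ring
    rw [h3, abs_mul, div_eq_mul_one_div M₂]
    exact mul_le_mul (h₂ t) h4 (abs_nonneg _) ((abs_nonneg _).trans (h₂ t))
  have hparts := intervalIntegral.integral_mul_deriv_eq_deriv_mul (a := 0) (b := 1)
    (u := fun t => ((ψ t : ℝ) : ℂ)) (v := u) (u' := fun t => ((ψ' t : ℝ) : ℂ))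
    (v' := fun t => u t * ((r * g1 t : ℝ) * Complex.I))
    (fun t _ => (hdψ t).ofReal_comp) (fun t _ => hdu t)
    (by exact (Complex.continuous_ofReal.comp cψ').intervalIntegrable _ _)
    (by apply Continuous.intervalIntegrable; fun_prop)
  have hbd : ‖∫ t in (0 : ℝ)..1, (ψ t : ℂ) * (u t * ((r * g1 t : ℝ) * Complex.I))‖ ≤
      (2 * M₁ + M₂) / ε := by
    rw [hparts]
    have k1 : ‖∫ t in (0 : ℝ)..1, (ψ' t : ℂ) * u t‖ ≤ M₂ / ε := by
      have := intervalIntegral.norm_integral_le_of_norm_le_const (a := 0) (b := 1) (C := M₂ / ε)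
        (f := fun t => (ψ' t : ℂ) * u t) fun t _ => by
          rw [norm_mul, hun, mul_one, Complex.norm_real]
          exact hψ'b t
      simpa using this
    have k2 : ∀ t, ‖(ψ t : ℂ) * u t‖ ≤ M₁ / ε := fun t => by
      rw [norm_mul, hun, mul_one, Complex.norm_real]
      exact hψb t
    calc _ ≤ ‖(ψ 1 : ℂ) * u 1‖ + ‖(ψ 0 : ℂ) * u 0‖ + ‖∫ t in (0 : ℝ)..1, (ψ' t : ℂ) * u t‖ :=
          (norm_sub_le _ _).trans (add_le_add_left (norm_sub_le _ _) _)
      _ ≤ M₁ / ε + M₁ / ε + M₂ / ε := add_le_add (add_le_add (k2 1) (k2 0)) k1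
      _ = _ := by ring
  have hsplit : ∀ t, u t = (r : ℂ)⁻¹ * Complex.I⁻¹ *
      ((ψ t : ℂ) * (u t * ((r * g1 t : ℝ) * Complex.I))) +
        ((ε / (g1 t ^ 2 + ε) : ℝ) : ℂ) * u t := by
    intro t
    have h3 : (ψ t * g1 t + ε / (g1 t ^ 2 + ε) : ℝ) = 1 := by
      rw [hψ]
      have := (hpos t).ne'
      field_simp
    have h3' : ((ψ t : ℂ) * g1 t + ((ε / (g1 t ^ 2 + ε) : ℝ) : ℂ)) = 1 := by exact_mod_cast h3
    have hr' : (r : ℂ) ≠ 0 := by exact_mod_cast hr.ne'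
    calc u t = ((ψ t : ℂ) * g1 t + ((ε / (g1 t ^ 2 + ε) : ℝ) : ℂ)) * u t := by rw [h3', one_mul]
      _ = _ := by
        push_cast
        field_simp [Complex.I_ne_zero]
  have cw : Continuous fun t => ε / (g1 t ^ 2 + ε) :=
    continuous_const.div (by fun_prop) fun t => (hpos t).ne'
  have hI : ∫ t in (0 : ℝ)..1, u t = (r : ℂ)⁻¹ * Complex.I⁻¹ *
      (∫ t in (0 : ℝ)..1, (ψ t : ℂ) * (u t * ((r * g1 t : ℝ) * Complex.I))) +
        ∫ t in (0 : ℝ)..1, ((ε / (g1 t ^ 2 + ε) : ℝ) : ℂ) * u t := by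
    rw [← intervalIntegral.integral_const_mul, ← intervalIntegral.integral_add]
    · exact intervalIntegral.integral_congr fun t _ => hsplit t
    · apply Continuous.intervalIntegrable
      fun_prop
    · exact ((Complex.continuous_ofReal.comp cw).mul cu).intervalIntegrable _ _
  rw [hI]
  refine (norm_add_le _ _).trans (add_le_add ?_ ?_)
  · rw [norm_mul, norm_mul, norm_inv, norm_inv, Complex.norm_I, inv_one, mul_one, Complex.norm_real,
      Real.norm_of_nonneg hr.le]
    calc _ ≤ r⁻¹ * ((2 * M₁ + M₂) / ε) := mul_le_mul_of_nonneg_left hbd (inv_nonneg.2 hr.le)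
      _ = _ := by field_simp
  · refine (intervalIntegral.norm_integral_le_integral_norm zero_le_one).trans (le_of_eq ?_)
    refine intervalIntegral.integral_congr fun t _ => ?_
    change ‖((ε / (g1 t ^ 2 + ε) : ℝ) : ℂ) * u t‖ = _
    rw [norm_mul, hun, mul_one, Complex.norm_real, Real.norm_of_nonneg (div_pos hε (hpos t)).le]

include hω hωs hωa in
/-- Uniform decay of oscillatory integrals with trigonometric phases. -/
theorem exists_forall_norm_integral_le {δ : ℝ} (hδ : 0 < δ) :
    ∃ R : ℝ, ∀ b : ι → ℂ, R ≤ ‖b‖ →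
      ‖∫ t in (0 : ℝ)..1, Complex.exp ((trigPoly ω b t : ℝ) * Complex.I)‖ ≤ δ := by
  by_contra hcon
  push Not at hcon
  choose b hb hbδ using fun n : ℕ => hcon (n + 1)
  have hb0 : ∀ n, 0 < ‖b n‖ := fun n => lt_of_lt_of_le (by positivity) (hb n)
  -- Compactness of the unit sphere makes the decay uniform: the directions of the counterexamples
  -- accumulate at some `a`. The regularization ε is chosen for `a` alone, and only afterwards do
  -- the norms tend to infinity.
  set u : ℕ → ι → ℂ := fun n => (‖b n‖⁻¹ : ℝ) • b n with hu
  have hu1 : ∀ n, u n ∈ Metric.sphere (0 : ι → ℂ) 1 := fun n => by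
    rw [mem_sphere_zero_iff_norm, hu, norm_smul, Real.norm_of_nonneg (inv_nonneg.2 (hb0 n).le),
      inv_mul_cancel₀ (hb0 n).ne']
  obtain ⟨a, ha, s, hs, hlim⟩ := (isCompact_sphere (0 : ι → ℂ) 1).tendsto_subseq hu1
  have ha0 : a ≠ 0 := by
    rintro rfl
    simp at ha
  have hda0 : trigDeriv ω a ≠ 0 := by
    intro h
    refine ha0 (funext fun v => ?_)
    have := congrFun h v
    simpa [trigDeriv, hω v, Complex.I_ne_zero] using this
  have hdcont : Continuous (trigDeriv ω : (ι → ℂ) → ι → ℂ) := by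
    unfold trigDeriv
    fun_prop
  -- choice of `ε`
  have hε : ∃ ε : ℝ, 0 < ε ∧
      ∫ t in (0 : ℝ)..1, ε / (trigPoly ω (trigDeriv ω a) t ^ 2 + ε) < δ / 2 := by
    have hl : Tendsto (fun n : ℕ => ∫ t in (0 : ℝ)..1, (1 / ((n : ℝ) + 1)) /
        (trigPoly ω (trigDeriv ω a) t ^ 2 + 1 / ((n : ℝ) + 1))) atTop
        (𝓝 (∫ t in (0 : ℝ)..1, (0 : ℝ))) := by
      refine intervalIntegral.tendsto_integral_filter_of_dominated_convergence (fun _ => 1)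
        (Eventually.of_forall fun n => ?_) (Eventually.of_forall fun n =>
          Eventually.of_forall fun t _ => ?_) (by simp) ?_
      · refine Continuous.aestronglyMeasurable (Continuous.div continuous_const
          (((continuous_trigPoly _ _).pow 2).add continuous_const) fun t => ?_)
        positivity
      · rw [Real.norm_of_nonneg (by positivity), div_le_one (by positivity)]
        nlinarith [sq_nonneg (trigPoly ω (trigDeriv ω a) t)]
      · filter_upwards [ae_trigPoly_ne_zero hωs hωa hda0] with t ht _
        have h0 := tendsto_one_div_add_atTop_nhds_zero_nat (𝕜 := ℝ)
        have h1 := h0.div (h0.const_add (trigPoly ω (trigDeriv ω a) t ^ 2))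
          (by simpa using ht)
        rw [add_zero, zero_div] at h1
        exact h1
    simp only [intervalIntegral.integral_zero] at hl
    obtain ⟨n, hn⟩ := (hl.eventually (gt_mem_nhds (half_pos hδ))).exists
    exact ⟨1 / ((n : ℝ) + 1), by positivity, hn⟩
  obtain ⟨ε, hε0, hε⟩ := hε
  have hl2 : Tendsto (fun n => ∫ t in (0 : ℝ)..1, ε / (trigPoly ω (trigDeriv ω (u (s n))) t ^ 2 + ε))
      atTop (𝓝 (∫ t in (0 : ℝ)..1, ε / (trigPoly ω (trigDeriv ω a) t ^ 2 + ε))) := by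
    refine intervalIntegral.tendsto_integral_filter_of_dominated_convergence (fun _ => 1)
      (Eventually.of_forall fun n => ?_) (Eventually.of_forall fun n =>
        Eventually.of_forall fun t _ => ?_) (by simp) (Eventually.of_forall fun t _ => ?_)
    · refine Continuous.aestronglyMeasurable (Continuous.div continuous_const
        (((continuous_trigPoly _ _).pow 2).add continuous_const) fun t => ?_)
      positivity
    · rw [Real.norm_of_nonneg (by positivity), div_le_one (by positivity)]
      nlinarith [sq_nonneg (trigPoly ω (trigDeriv ω (u (s n))) t)]
    · have h1 : Tendsto (fun n => trigPoly ω (trigDeriv ω (u (s n))) t) atTop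
          (𝓝 (trigPoly ω (trigDeriv ω a) t)) :=
        (((continuous_trigPoly_coeff ω t).comp hdcont).tendsto a).comp hlim
      exact tendsto_const_nhds.div ((h1.pow 2).add_const ε) (by positivity)
  set M₁ : ℝ := ∑ v, |ω v| with hM1
  set M₂ : ℝ := ∑ v, |ω v| * |ω v| with hM2
  have hun : ∀ n v, ‖u n v‖ ≤ 1 := fun n v =>
    (norm_le_pi_norm (u n) v).trans (mem_sphere_zero_iff_norm.1 (hu1 n)).le
  have h1 : ∀ n t, |trigPoly ω (trigDeriv ω (u n)) t| ≤ M₁ := fun n t => by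
    refine (abs_trigPoly_le _ _ _).trans (Finset.sum_le_sum fun v _ => ?_)
    rw [trigDeriv, norm_mul, norm_mul, Complex.norm_I, one_mul, Complex.norm_real]
    exact mul_le_of_le_one_right (abs_nonneg _) (hun n v)
  have h2 : ∀ n t, |trigPoly ω (trigDeriv ω (trigDeriv ω (u n))) t| ≤ M₂ := fun n t => by
    refine (abs_trigPoly_le _ _ _).trans (Finset.sum_le_sum fun v _ => ?_)
    rw [trigDeriv, trigDeriv, norm_mul, norm_mul, norm_mul, norm_mul, Complex.norm_I, one_mul,
      Complex.norm_real, Real.norm_eq_abs, ← mul_assoc]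
    exact mul_le_of_le_one_right (mul_nonneg (abs_nonneg _) (abs_nonneg _)) (hun n v)
  have hr : Tendsto (fun n => ‖b (s n)‖) atTop atTop :=
    tendsto_atTop_mono (fun n => (by
      have := hb (s n)
      have h3 : (n : ℝ) ≤ s n := by exact_mod_cast hs.id_le n
      linarith : (n : ℝ) ≤ ‖b (s n)‖)) tendsto_natCast_atTop_atTop
  have hl3 : Tendsto (fun n => (2 * M₁ + M₂) / (ε * ‖b (s n)‖)) atTop (𝓝 0) :=
    tendsto_const_nhds.div_atTop (hr.const_mul_atTop hε0)
  have hl4 := hl3.add hl2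
  rw [zero_add] at hl4
  obtain ⟨n, hn⟩ := (hl4.eventually (gt_mem_nhds (hε.trans (half_lt_self hδ)))).exists
  have key := norm_integral_exp_trigPoly_le ω (u (s n)) (hb0 (s n)) hε0 (h1 (s n)) (h2 (s n))
  have heq : ∀ t, ‖b (s n)‖ * trigPoly ω (u (s n)) t = trigPoly ω (b (s n)) t := by
    intro t
    simp only [trigPoly, hu, Pi.smul_apply]
    rw [← Complex.re_ofReal_mul, Finset.mul_sum]
    congr 1
    refine Finset.sum_congr rfl fun v _ => ?_
    rw [Complex.real_smul, ← mul_assoc, ← mul_assoc, ← Complex.ofReal_mul,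
      mul_inv_cancel₀ (hb0 (s n)).ne', Complex.ofReal_one, one_mul]
  simp only [heq] at key
  exact absurd (key.trans hn.le) (not_le.2 (hbδ (s n)))

end OscillatoryIntegral


/-! ### One-parameter subgroups in the closure of a cyclic subgroup of a torus -/

section TorusDirection

variable {ι : Type*}

/-- The exponential map of the torus. -/
def torusExp (x : ι → ℝ) : ι → Circle := fun v => Circle.exp (x v)

theorem torusExp_add (x y : ι → ℝ) : torusExp (x + y) = torusExp x * torusExp y :=
  funext fun v => Circle.exp_add (x v) (y v)

theorem torusExp_zero : torusExp (0 : ι → ℝ) = 1 :=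
  funext fun _ => Circle.exp_zero

theorem torusExp_neg (x : ι → ℝ) : torusExp (-x) = (torusExp x)⁻¹ :=
  funext fun v => Circle.exp_neg (x v)

theorem continuous_torusExp : Continuous (torusExp : (ι → ℝ) → ι → Circle) :=
  continuous_pi fun v => Circle.exp.continuous.comp (continuous_apply v)

theorem torusExp_zsmul (m : ℤ) (x : ι → ℝ) : torusExp ((m : ℝ) • x) = torusExp x ^ m := by
  funext v
  simp [torusExp, Circle.exp_intCast_mul]

/-- The Lie algebra of a subgroup of the torus. -/
def tangentSpace (H : Subgroup (ι → Circle)) : Submodule ℝ (ι → ℝ) where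
  carrier := {ω | ∀ t : ℝ, torusExp (t • ω) ∈ H}
  zero_mem' t := by rw [smul_zero, torusExp_zero]; exact H.one_mem
  add_mem' {a b} ha hb t := by
    rw [smul_add, torusExp_add]
    exact H.mul_mem (ha t) (hb t)
  smul_mem' c a ha t := by
    rw [smul_smul]
    exact ha _

theorem torusExp_mem_of_mem_tangentSpace {H : Subgroup (ι → Circle)} {ω : ι → ℝ}
    (hω : ω ∈ tangentSpace H) : torusExp ω ∈ H := by
  simpa using hω 1

variable [Fintype ι]

/-- A closed subgroup contains the one-parameter subgroup in a direction in which it accumulates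
at the identity. -/
theorem mem_tangentSpace_of_tendsto {H : Subgroup (ι → Circle)} (hH : IsClosed (H : Set (ι → Circle)))
    {b : ℕ → ι → ℝ} (hb : ∀ j, torusExp (b j) ∈ H) (hb0 : ∀ j, b j ≠ 0)
    (hlim : Tendsto b atTop (𝓝 0)) {u : ι → ℝ}
    (hu : Tendsto (fun j => ‖b j‖⁻¹ • b j) atTop (𝓝 u)) : u ∈ tangentSpace H := by
  intro t
  have hn : ∀ j, 0 < ‖b j‖ := fun j => norm_pos_iff.2 (hb0 j)
  have hn0 : Tendsto (fun j => ‖b j‖) atTop (𝓝 0) := by simpa using hlim.norm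
  -- Integral multiples of the small vectors `b j` approximate every point of the line through the
  -- limiting direction.
  have hm : Tendsto (fun j => (⌊t / ‖b j‖⌋ : ℝ) * ‖b j‖) atTop (𝓝 t) := by
    have h1 : Tendsto (fun j => t - ‖b j‖) atTop (𝓝 t) := by
      simpa using (tendsto_const_nhds (x := t)).sub hn0
    refine tendsto_of_tendsto_of_tendsto_of_le_of_le h1 tendsto_const_nhds (fun j => ?_) fun j => ?_
    · have := (Int.lt_floor_add_one (t / ‖b j‖)).le
      rw [div_le_iff₀ (hn j)] at this
      dsimp only
      linarith
    · have := Int.floor_le (t / ‖b j‖)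
      rwa [le_div_iff₀ (hn j)] at this
  have h2 := (continuous_torusExp.tendsto (t • u)).comp (hm.smul hu)
  refine hH.mem_of_tendsto h2 (Eventually.of_forall fun j => ?_)
  have : ((⌊t / ‖b j‖⌋ : ℝ) * ‖b j‖) • ‖b j‖⁻¹ • b j = (⌊t / ‖b j‖⌋ : ℝ) • b j := by
    rw [smul_smul, mul_assoc, mul_inv_cancel₀ (hn j).ne', mul_one]
  simp only [Function.comp_apply, this, torusExp_zsmul]
  exact H.zpow_mem (hb j) _

/-- Recurrence gives powers of `g` that tend to 1 and on which χ is not 1. If ℓ vanished on the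
tangent space, their small logarithms would have nonzero components transverse to it. The limiting
direction of these components would be tangent and transverse at once. -/
theorem exists_mem_tangentSpace_ne_zero {g : ι → Circle} (χ : (ι → Circle) →* Circle)
    (ℓ : (ι → ℝ) →ₗ[ℝ] ℝ) (hχ : ∀ x, χ (torusExp x) = Circle.exp (ℓ x))
    (hg : ∀ k, 0 < k → χ g ^ k ≠ 1) :
    ∃ ω ∈ tangentSpace (Subgroup.zpowers g).topologicalClosure, ℓ ω ≠ 0 := by
  by_contra! hcon
  set H := (Subgroup.zpowers g).topologicalClosure with hH
  have hHc : IsClosed (H : Set (ι → Circle)) := Subgroup.isClosed_topologicalClosure _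
  have hgH : g ∈ H := Subgroup.le_topologicalClosure _ (Subgroup.mem_zpowers g)
  obtain ⟨a, s, hs, hlim⟩ := CompactSpace.tendsto_subseq (fun n : ℕ => g ^ n)
  set h : ℕ → ι → Circle := fun j => g ^ s (j + 1) / g ^ s j with hh
  have hh1 : Tendsto h atTop (𝓝 1) := by
    have := ((hlim.comp (tendsto_add_atTop_nat 1))).div' hlim
    rwa [div_self'] at this
  have hhH : ∀ j, h j ∈ H := fun j => H.div_mem (H.pow_mem hgH _) (H.pow_mem hgH _)
  have hhχ : ∀ j, χ (h j) ≠ 1 := by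
    intro j
    have hlt : s j < s (j + 1) := hs (Nat.lt_succ_self j)
    have : h j = g ^ (s (j + 1) - s j) := by
      rw [hh]
      exact (div_eq_iff_eq_mul.2 (by rw [← pow_add, Nat.sub_add_cancel hlt.le]))
    rw [this, map_pow]
    exact hg _ (Nat.sub_pos_of_lt hlt)
  set x : ℕ → ι → ℝ := fun j v => Complex.arg (h j v) with hx
  have hxh : ∀ j, torusExp (x j) = h j := fun j => funext fun v => Circle.exp_arg (h j v)
  have hx0 : Tendsto x atTop (𝓝 0) := by
    refine tendsto_pi_nhds.2 fun v => ?_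
    have h1 : Tendsto (fun j => ((h j v : Circle) : ℂ)) atTop (𝓝 1) := by
      have := (tendsto_pi_nhds.1 hh1 v)
      exact ((by fun_prop : Continuous fun z : Circle => (z : ℂ)).tendsto 1).comp this
    have h2 := (Complex.continuousAt_arg Complex.one_mem_slitPlane).tendsto.comp h1
    rw [Complex.arg_one] at h2
    exact h2
  obtain ⟨Q, hQ⟩ := (tangentSpace H).subtype.exists_leftInverse_of_injective
    (Submodule.ker_subtype _)
  -- `P` is a projection whose kernel is the tangent space. Removing the tangential part keeps the
  -- exponential in `H`.
  set P : (ι → ℝ) →ₗ[ℝ] (ι → ℝ) := LinearMap.id - (tangentSpace H).subtype ∘ₗ Q with hP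
  have hQa : ∀ y : tangentSpace H, Q y = y := fun y => LinearMap.congr_fun hQ y
  have hPa : ∀ y, P y = y - Q y := fun y => rfl
  have hP0 : ∀ y ∈ tangentSpace H, P y = 0 := fun y hy => by
    rw [hPa, hQa ⟨y, hy⟩, sub_self]
  have hPP : ∀ y, P (P y) = P y := fun y => by
    rw [hPa y, map_sub, hP0 _ (Q y).2, sub_zero, hPa]
  have cP : Continuous P := P.continuous_of_finiteDimensional
  set b : ℕ → ι → ℝ := fun j => P (x j) with hb
  have hbH : ∀ j, torusExp (b j) ∈ H := fun j => by
    rw [hb]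
    simp only [hPa, sub_eq_add_neg, torusExp_add, torusExp_neg, hxh]
    exact H.mul_mem (hhH j) (H.inv_mem (torusExp_mem_of_mem_tangentSpace (Q (x j)).2))
  have hb0 : ∀ j, b j ≠ 0 := fun j hj => by
    have hxm : x j ∈ tangentSpace H := by
      have : x j = Q (x j) := sub_eq_zero.1 hj
      rw [this]
      exact (Q (x j)).2
    apply hhχ j
    rw [← hxh, hχ, hcon _ hxm, Circle.exp_zero]
  have hblim : Tendsto b atTop (𝓝 0) := by
    have := (cP.tendsto 0).comp hx0
    rwa [map_zero] at this
  have hsph : ∀ j, ‖b j‖⁻¹ • b j ∈ Metric.sphere (0 : ι → ℝ) 1 := fun j => by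
    rw [mem_sphere_zero_iff_norm, norm_smul, norm_inv, norm_norm,
      inv_mul_cancel₀ (norm_ne_zero_iff.2 (hb0 j))]
  obtain ⟨u, hu, s', hs', hlim'⟩ := (isCompact_sphere (0 : ι → ℝ) 1).tendsto_subseq hsph
  have hum : u ∈ tangentSpace H := mem_tangentSpace_of_tendsto hHc (b := b ∘ s')
    (fun j => hbH _) (fun j => hb0 _) (hblim.comp hs'.tendsto_atTop) hlim'
  have hPu : P u = u := by
    refine tendsto_nhds_unique ((cP.tendsto u).comp hlim') ?_
    refine hlim'.congr fun j => ?_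
    simp only [Function.comp_apply, map_smul, hb, hPP]
  rw [← hPu, hP0 u hum] at hu
  simp at hu

/-- Each of the finitely many conditions fails only on a proper subspace of the tangent space, and a
real vector space is not a finite union of proper subspaces. -/
theorem exists_generic_mem_tangentSpace {g : ι → Circle} (h1 : ∀ v k, 0 < k → g v ^ k ≠ 1)
    (h2 : ∀ v v', v ≠ v' → ∀ k, 0 < k → (g v / g v') ^ k ≠ 1)
    (h3 : ∀ v v', v ≠ v' → ∀ k, 0 < k → (g v * g v') ^ k ≠ 1) :
    ∃ ω ∈ tangentSpace (Subgroup.zpowers g).topologicalClosure, (∀ v, ω v ≠ 0) ∧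
      (∀ v v', v ≠ v' → ω v ≠ ω v') ∧ ∀ v v', ω v + ω v' ≠ 0 := by
  classical
  set H := (Subgroup.zpowers g).topologicalClosure
  set J := {p : ι × ι // p.1 ≠ p.2}
  set pr : ι → (ι → ℝ) →ₗ[ℝ] ℝ := fun v => LinearMap.proj v
  set ℓ : ι ⊕ J ⊕ J → (ι → ℝ) →ₗ[ℝ] ℝ := Sum.elim (fun v => pr v)
    (Sum.elim (fun p => pr p.1.1 - pr p.1.2) fun p => pr p.1.1 + pr p.1.2) with hℓ
  have key : ∀ i, ∃ ω ∈ tangentSpace H, ℓ i ω ≠ 0 := by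
    rintro (v | p | p)
    · exact exists_mem_tangentSpace_ne_zero (Pi.evalMonoidHom _ v) _ (fun x => rfl) (h1 v)
    · refine exists_mem_tangentSpace_ne_zero
        (Pi.evalMonoidHom (fun _ : ι => Circle) p.1.1 / Pi.evalMonoidHom _ p.1.2) _ (fun x => ?_)
        (h2 _ _ p.2)
      exact (Circle.exp_sub _ _).symm
    · refine exists_mem_tangentSpace_ne_zero
        (Pi.evalMonoidHom (fun _ : ι => Circle) p.1.1 * Pi.evalMonoidHom _ p.1.2) _ (fun x => ?_)
        (h3 _ _ p.2)
      exact (Circle.exp_add _ _).symm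
  set q : ι ⊕ J ⊕ J → Submodule ℝ (tangentSpace H) :=
    fun i => LinearMap.ker (ℓ i ∘ₗ (tangentSpace H).subtype) with hq
  have hU : ⋃ i, (q i : Set (tangentSpace H)) ≠ Set.univ := by
    intro h
    obtain ⟨i, hi⟩ := Subspace.exists_eq_top_of_iUnion_eq_univ h
    obtain ⟨ω, hω, hne⟩ := key i
    have : (⟨ω, hω⟩ : tangentSpace H) ∈ q i := by rw [hi]; trivial
    exact hne this
  obtain ⟨ω, hω⟩ := (Set.ne_univ_iff_exists_notMem _).1 hU
  have hω' : ∀ i, ℓ i ω ≠ 0 := fun i hi => hω (Set.mem_iUnion.2 ⟨i, hi⟩)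
  have hv : ∀ v, (ω : ι → ℝ) v ≠ 0 := fun v => hω' (Sum.inl v)
  refine ⟨ω, ω.2, hv, fun v v' hvv => ?_, fun v v' => ?_⟩
  · exact sub_ne_zero.1 (hω' (Sum.inr (Sum.inl ⟨(v, v'), hvv⟩)))
  · by_cases hvv : v = v'
    · subst hvv
      exact fun h => hv v (by linarith)
    · exact hω' (Sum.inr (Sum.inr ⟨(v, v'), hvv⟩))

end TorusDirection

/-! ### Averages along a rotation and their decay -/

section TorusAverages

variable {G : Type*} [CommGroup G] [TopologicalSpace G] [IsTopologicalGroup G] [CompactSpace G]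

/-- Birkhoff averages along a rotation are asymptotically invariant under the closed subgroup that
it generates. -/
theorem tendsto_average_sub_of_mem_closure (g : G) (F : C(G, ℂ)) {h : G}
    (hh : h ∈ (Subgroup.zpowers g).topologicalClosure) :
    Tendsto (fun N : ℕ => (N : ℂ)⁻¹ * ∑ n ∈ Finset.range N, (F (g ^ n * h) - F (g ^ n)))
      atTop (𝓝 0) := by
  have hinv : Tendsto (fun N : ℕ => ((N : ℝ))⁻¹ * (2 * ‖F‖)) atTop (𝓝 0) := by
    simpa using (tendsto_inv_atTop_nhds_zero_nat (𝕜 := ℝ)).mul_const (2 * ‖F‖)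
  have tele : ∀ h : G, Tendsto (fun N : ℕ => (N : ℂ)⁻¹ *
      ∑ n ∈ Finset.range N, (F (g ^ n * (h * g)) - F (g ^ n * h))) atTop (𝓝 0) := by
    intro h
    refine squeeze_zero_norm (fun N => ?_) hinv
    have : ∀ n, F (g ^ n * (h * g)) - F (g ^ n * h) = F (g ^ (n + 1) * h) - F (g ^ n * h) := by
      intro n
      rw [pow_succ, mul_assoc, mul_comm h g]
    simp only [this]
    rw [Finset.sum_range_sub (fun n => F (g ^ n * h)), norm_mul, norm_inv, Complex.norm_natCast]
    refine mul_le_mul_of_nonneg_left ((norm_sub_le _ _).trans ?_) (by positivity)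
    linarith [F.norm_coe_le_norm (g ^ N * h), F.norm_coe_le_norm (g ^ 0 * h)]
  set P : G → Prop := fun h => Tendsto (fun N : ℕ => (N : ℂ)⁻¹ *
    ∑ n ∈ Finset.range N, (F (g ^ n * h) - F (g ^ n))) atTop (𝓝 0) with hP
  have hmul : ∀ h, P h ↔ P (h * g) := by
    intro h
    have heq : ∀ N : ℕ, (N : ℂ)⁻¹ * ∑ n ∈ Finset.range N, (F (g ^ n * (h * g)) - F (g ^ n)) =
        (N : ℂ)⁻¹ * ∑ n ∈ Finset.range N, (F (g ^ n * h) - F (g ^ n)) + (N : ℂ)⁻¹ *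
          ∑ n ∈ Finset.range N, (F (g ^ n * (h * g)) - F (g ^ n * h)) := by
      intro N
      rw [← mul_add, ← Finset.sum_add_distrib]
      congr 1
      exact Finset.sum_congr rfl fun n _ => by ring
    simp only [hP, heq]
    constructor
    · intro h1
      simpa using h1.add (tele h)
    · intro h1
      simpa using h1.sub (tele h)
  have hP1 : P 1 := by simp [hP]
  have hz : ∀ k : ℤ, P (g ^ k) := by
    intro k
    induction k using Int.induction_on with
    | zero => simpa using hP1
    | succ i hi => rw [zpow_add_one]; exact (hmul _).1 hi
    | pred i hi => rw [hmul, ← zpow_add_one, sub_add_cancel]; exact hi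
  -- Translation acts continuously in the sup norm. This extends the asymptotic invariance from
  -- powers of `g`, where the sums telescope, to the closure.
  set Φ : C(G, C(G, ℂ)) := ContinuousMap.curry ⟨fun p : G × G => F (p.2 * p.1), by fun_prop⟩
  rw [Metric.tendsto_atTop]
  intro ε hε
  have hU : {y | dist (Φ y) (Φ h) < ε / 2} ∈ 𝓝 h :=
    (Φ.continuous.tendsto h) (Metric.ball_mem_nhds _ (half_pos hε))
  obtain ⟨y, hy, k, rfl⟩ := mem_closure_iff_nhds.1 hh _ hU
  obtain ⟨N₀, hN₀⟩ := Metric.tendsto_atTop.1 (hz k) (ε / 2) (half_pos hε)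
  refine ⟨N₀, fun N hN => ?_⟩
  have h1 := hN₀ N hN
  rw [dist_zero_right] at h1 ⊢
  have h2 : ‖(N : ℂ)⁻¹ * ∑ n ∈ Finset.range N, (F (g ^ n * h) - F (g ^ n * g ^ k))‖ ≤ ε / 2 := by
    rw [norm_mul, norm_inv, Complex.norm_natCast]
    have h3 : ‖∑ n ∈ Finset.range N, (F (g ^ n * h) - F (g ^ n * g ^ k))‖ ≤ N * (ε / 2) := by
      refine (norm_sum_le_of_le _ (f := fun n => F (g ^ n * h) - F (g ^ n * g ^ k))
        (n := fun _ => ε / 2) fun n _ => ?_).trans (by simp)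
      have h4 := ((Φ h) - Φ (g ^ k)).norm_coe_le_norm (g ^ n)
      have h5 : dist (Φ (g ^ k)) (Φ h) < ε / 2 := hy
      rw [dist_comm, dist_eq_norm] at h5
      exact h4.trans h5.le
    rcases Nat.eq_zero_or_pos N with rfl | hN0
    · simpa using (half_pos hε).le
    · have : (0 : ℝ) < N := by exact_mod_cast hN0
      rwa [inv_mul_le_iff₀ this]
  have heq : (N : ℂ)⁻¹ * ∑ n ∈ Finset.range N, (F (g ^ n * h) - F (g ^ n)) =
      (N : ℂ)⁻¹ * ∑ n ∈ Finset.range N, (F (g ^ n * g ^ k) - F (g ^ n)) + (N : ℂ)⁻¹ *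
          ∑ n ∈ Finset.range N, (F (g ^ n * h) - F (g ^ n * g ^ k)) := by
    rw [← mul_add, ← Finset.sum_add_distrib]
    congr 1
    exact Finset.sum_congr rfl fun n _ => by ring
  rw [heq]
  refine (norm_add_le _ _).trans_lt ?_
  linarith

end TorusAverages

section TorusOscillation

variable {ι : Type*} [Fintype ι]

/-- The average over the orbit of `g` is asymptotically unchanged by the one-parameter group t ↦
`torusExp (t • ω)`, so it may also be averaged over t in [0, 1]. Each term becomes an oscillatory
integral with coefficients `b v * g v ^ n`. These have the same norm as `b`, so the uniform bound
applies. -/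
theorem exists_forall_eventually_norm_average_le {g : ι → Circle}
    (h1 : ∀ v k, 0 < k → g v ^ k ≠ 1)
    (h2 : ∀ v v', v ≠ v' → ∀ k, 0 < k → (g v / g v') ^ k ≠ 1)
    (h3 : ∀ v v', v ≠ v' → ∀ k, 0 < k → (g v * g v') ^ k ≠ 1) {δ : ℝ} (hδ : 0 < δ) :
    ∃ R : ℝ, ∀ b : ι → ℂ, R ≤ ‖b‖ → ∀ᶠ N : ℕ in atTop,
      ‖(N : ℂ)⁻¹ * ∑ n ∈ Finset.range N,
        Complex.exp (((∑ v, b v * (g v : ℂ) ^ n).re : ℝ) * Complex.I)‖ ≤ δ := by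
  obtain ⟨ω, hω, hω1, hω2, hω3⟩ := exists_generic_mem_tangentSpace h1 h2 h3
  obtain ⟨R, hR⟩ := exists_forall_norm_integral_le hω1 hω2 hω3 (half_pos hδ)
  refine ⟨R, fun b hb => ?_⟩
  set F : C(ι → Circle, ℂ) :=
    ⟨fun h => Complex.exp (((∑ v, b v * (h v : ℂ)).re : ℝ) * Complex.I), by fun_prop⟩ with hF
  have hFa : ∀ h, F h = Complex.exp (((∑ v, b v * (h v : ℂ)).re : ℝ) * Complex.I) := fun h => rfl
  have hF1 : ∀ h, ‖F h‖ = 1 := fun h => Complex.norm_exp_ofReal_mul_I _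
  set c : ℕ → ι → ℂ := fun n v => b v * (g v : ℂ) ^ n with hc
  have hcn : ∀ n, ‖c n‖ = ‖b‖ := by
    intro n
    have : ∀ v, ‖c n v‖ = ‖b v‖ := fun v => by
      rw [hc, norm_mul, norm_pow, Circle.norm_coe, one_pow, mul_one]
    refine le_antisymm ((pi_norm_le_iff_of_nonneg (norm_nonneg _)).2 fun v => ?_)
      ((pi_norm_le_iff_of_nonneg (norm_nonneg _)).2 fun v => ?_)
    · rw [this]
      exact norm_le_pi_norm b v
    · rw [← this]
      exact norm_le_pi_norm (c n) v
  have hFt : ∀ n (t : ℝ), F (g ^ n * torusExp (t • ω)) =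
      Complex.exp ((trigPoly ω (c n) t : ℝ) * Complex.I) := by
    intro n t
    rw [hFa, trigPoly]
    congr 4
    refine Finset.sum_congr rfl fun v _ => ?_
    simp only [hc, torusExp, Pi.mul_apply, Pi.pow_apply, Pi.smul_apply, smul_eq_mul, Circle.coe_mul,
      Circle.coe_pow, Circle.coe_exp]
    rw [mul_assoc, mul_comm t]
  have ct : ∀ n, Continuous fun t : ℝ => F (g ^ n * torusExp (t • ω)) := fun n =>
    F.continuous.comp (continuous_const.mul
      (continuous_torusExp.comp (continuous_id.smul continuous_const)))
  have hlim : Tendsto (fun N : ℕ => ∫ t in (0 : ℝ)..1, (N : ℂ)⁻¹ * ∑ n ∈ Finset.range N,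
      (F (g ^ n * torusExp (t • ω)) - F (g ^ n))) atTop (𝓝 (∫ _ in (0 : ℝ)..1, (0 : ℂ))) := by
    refine intervalIntegral.tendsto_integral_filter_of_dominated_convergence (fun _ => 2)
      (Eventually.of_forall fun N => ?_) (Eventually.of_forall fun N => ?_) ?_ ?_
    · refine Continuous.aestronglyMeasurable ?_
      exact continuous_const.mul (continuous_finsetSum _ fun n _ => (ct n).sub continuous_const)
    · refine Eventually.of_forall fun t _ => ?_
      rw [norm_mul, norm_inv, Complex.norm_natCast]
      have h4 : ‖∑ n ∈ Finset.range N, (F (g ^ n * torusExp (t • ω)) - F (g ^ n))‖ ≤ N * 2 := by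
        refine (norm_sum_le_of_le _ (n := fun _ => (2 : ℝ)) fun n _ => ?_).trans (by simp)
        refine (norm_sub_le _ _).trans ?_
        rw [hF1, hF1]
        norm_num
      rcases Nat.eq_zero_or_pos N with rfl | hN0
      · simp
      · have : (0 : ℝ) < N := by exact_mod_cast hN0
        rwa [inv_mul_le_iff₀ this]
    · exact intervalIntegrable_const
    · exact Eventually.of_forall fun t _ => tendsto_average_sub_of_mem_closure g F (hω t)
  rw [intervalIntegral.integral_zero] at hlim
  obtain ⟨N₀, hN₀⟩ := Metric.tendsto_atTop.1 hlim (δ / 2) (half_pos hδ)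
  refine eventually_atTop.2 ⟨N₀, fun N hN => ?_⟩
  have h5 := hN₀ N hN
  rw [dist_zero_right, intervalIntegral.integral_const_mul, intervalIntegral.integral_finsetSum
    (f := fun n t => F (g ^ n * torusExp (t • ω)) - F (g ^ n))
    (fun n _ => ((ct n).sub continuous_const).intervalIntegrable _ _)] at h5
  have h6 : ∀ n, (∫ t in (0 : ℝ)..1, (F (g ^ n * torusExp (t • ω)) - F (g ^ n))) =
      (∫ t in (0 : ℝ)..1, Complex.exp ((trigPoly ω (c n) t : ℝ) * Complex.I)) - F (g ^ n) := by
    intro n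
    rw [intervalIntegral.integral_sub ((ct n).intervalIntegrable _ _)
      intervalIntegrable_const]
    simp [hFt]
  simp only [h6] at h5
  rw [Finset.sum_sub_distrib, mul_sub] at h5
  have h7 : ‖(N : ℂ)⁻¹ * ∑ n ∈ Finset.range N,
      ∫ t in (0 : ℝ)..1, Complex.exp ((trigPoly ω (c n) t : ℝ) * Complex.I)‖ ≤ δ / 2 := by
    rw [norm_mul, norm_inv, Complex.norm_natCast]
    have h4 : ‖∑ n ∈ Finset.range N,
        ∫ t in (0 : ℝ)..1, Complex.exp ((trigPoly ω (c n) t : ℝ) * Complex.I)‖ ≤ N * (δ / 2) := by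
      refine (norm_sum_le_of_le _ (n := fun _ => δ / 2) fun n _ => ?_).trans (by simp)
      exact hR _ (by rw [hcn]; exact hb)
    rcases Nat.eq_zero_or_pos N with rfl | hN0
    · simpa using (half_pos hδ).le
    · have : (0 : ℝ) < N := by exact_mod_cast hN0
      rwa [inv_mul_le_iff₀ this]
  have h8 : ∀ n, F (g ^ n) =
      Complex.exp (((∑ v, b v * (g v : ℂ) ^ n).re : ℝ) * Complex.I) := by
    intro n
    rw [hFa]
    simp
  simp only [h8] at h5
  rw [norm_sub_rev] at h5
  have h9 := (norm_le_norm_sub_add _ _).trans (add_le_add h5.le h7)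
  linarith

end TorusOscillation


/-! ### Characters that are exponentials of linear forms along the leaves -/

section LeafCharacters

variable {X : Type*} [AddCommGroup X] [TopologicalSpace X]
variable {E : Type*} [NormedAddCommGroup E] [NormedSpace ℝ E]

/-- A continuous character of `X` whose restriction along `j` is the exponential of a linear
form. -/
structure IsLeafChar (j : E →+ X) (χ : C(X, ℂ)) : Prop where
  map_add : ∀ x y, χ (x + y) = χ x * χ y
  norm_eq_one : ∀ x, ‖χ x‖ = 1
  exists_linear : ∃ ℓ : E →L[ℝ] ℝ, ∀ z, χ (j z) = Complex.exp ((ℓ z : ℝ) * Complex.I)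

namespace IsLeafChar

variable {j : E →+ X} {χ χ' : C(X, ℂ)}

theorem ne_zero (h : IsLeafChar j χ) (x : X) : χ x ≠ 0 := by
  rw [← norm_ne_zero_iff, h.norm_eq_one]
  exact one_ne_zero

theorem map_zero (h : IsLeafChar j χ) : χ 0 = 1 := by
  have := h.map_add 0 0
  rw [add_zero] at this
  exact (mul_eq_left₀ (h.ne_zero 0)).1 this.symm

theorem map_neg (h : IsLeafChar j χ) (x : X) : χ (-x) = (χ x)⁻¹ := by
  refine eq_inv_of_mul_eq_one_left ?_
  rw [← h.map_add, neg_add_cancel, h.map_zero]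

theorem one : IsLeafChar j 1 :=
  ⟨fun _ _ => by simp, fun _ => by simp, 0, fun _ => by simp⟩

theorem mul (h : IsLeafChar j χ) (h' : IsLeafChar j χ') : IsLeafChar j (χ * χ') := by
  refine ⟨fun x y => ?_, fun x => ?_, ?_⟩
  · simp only [ContinuousMap.mul_apply, h.map_add, h'.map_add]
    ring
  · rw [ContinuousMap.mul_apply, norm_mul, h.norm_eq_one, h'.norm_eq_one, one_mul]
  · obtain ⟨ℓ, hℓ⟩ := h.exists_linear
    obtain ⟨ℓ', hℓ'⟩ := h'.exists_linear
    refine ⟨ℓ + ℓ', fun z => ?_⟩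
    rw [ContinuousMap.mul_apply, hℓ, hℓ', ← Complex.exp_add]
    congr 1
    simp
    ring

theorem star (h : IsLeafChar j χ) : IsLeafChar j (star χ) := by
  refine ⟨fun x y => ?_, fun x => ?_, ?_⟩
  · simp only [ContinuousMap.star_apply, h.map_add, star_mul']
  · rw [ContinuousMap.star_apply, norm_star, h.norm_eq_one]
  · obtain ⟨ℓ, hℓ⟩ := h.exists_linear
    refine ⟨-ℓ, fun z => ?_⟩
    rw [ContinuousMap.star_apply, hℓ, Complex.star_def, ← Complex.exp_conj]
    congr 1
    simp

theorem comp (h : IsLeafChar j χ) (f : C(X, X)) (hf : ∀ x y, f (x + y) = f x + f y)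
    (T : E →L[ℝ] E) (hT : ∀ z, f (j z) = j (T z)) : IsLeafChar j (χ.comp f) := by
  refine ⟨fun x y => ?_, fun x => ?_, ?_⟩
  · simp only [ContinuousMap.comp_apply, hf, h.map_add]
  · rw [ContinuousMap.comp_apply, h.norm_eq_one]
  · obtain ⟨ℓ, hℓ⟩ := h.exists_linear
    exact ⟨ℓ.comp T, fun z => by rw [ContinuousMap.comp_apply, hT, hℓ]; rfl⟩

/-- The kernel of a character. -/
def ker (h : IsLeafChar j χ) : AddSubgroup X where
  carrier := {x | χ x = 1}
  zero_mem' := h.map_zero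
  add_mem' {a b} ha hb := by
    change χ (a + b) = 1
    rw [h.map_add, ha, hb, one_mul]
  neg_mem' {a} ha := by
    change χ (-a) = 1
    rw [h.map_neg, ha, inv_one]

theorem mem_ker (h : IsLeafChar j χ) {x : X} : x ∈ h.ker ↔ χ x = 1 := Iff.rfl

theorem isClosed_ker (h : IsLeafChar j χ) : IsClosed (h.ker : Set X) :=
  isClosed_eq χ.continuous continuous_const

theorem ker_ne_top (h : IsLeafChar j χ) (hχ : χ ≠ 1) : h.ker ≠ ⊤ := by
  intro ht
  refine hχ (ContinuousMap.ext fun x => ?_)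
  have : x ∈ h.ker := by rw [ht]; trivial
  exact this

/-- Invariance under translation by a point a with χ(a) ≠ 1 multiplies the integral by χ(a). -/
theorem integral_eq_zero [MeasurableSpace X] [BorelSpace X] [IsTopologicalAddGroup X]
    (h : IsLeafChar j χ) (hχ : χ ≠ 1)
    (m : Measure X) [m.IsAddLeftInvariant] : ∫ x, χ x ∂m = 0 := by
  obtain ⟨a, ha⟩ : ∃ a, χ a ≠ 1 := by
    by_contra! hc
    exact hχ (ContinuousMap.ext hc)
  have h1 : ∫ x, χ (a + x) ∂m = ∫ x, χ x ∂m := integral_add_left_eq_self _ a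
  simp only [h.map_add] at h1
  rw [integral_const_mul] at h1
  by_contra h0
  exact ha ((mul_eq_right₀ h0).1 h1)

end IsLeafChar

theorem iter_natCast (α : X ≃ₜ+ X) (k : ℕ) : (iter α k : X → X) = α^[k] := by
  rw [iter, zpow_natCast, Equiv.Perm.coe_pow]
  rfl

/-- Total irreducibility: a nontrivial character does not vanish on an infinite invariant
subgroup. -/
theorem IsLeafChar.eq_one_of_invariant {j : E →+ X} {χ : C(X, ℂ)} (h : IsLeafChar j χ)
    [IsTopologicalAddGroup X] {α : X ≃ₜ+ X} (hα : IsTotallyIrreducible α) {k : ℕ} (hk : 0 < k)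
    {V : AddSubgroup X} (hV : (V : Set X).Infinite) (hVk : α^[k] '' (V : Set X) = V)
    (hχ : ∀ x ∈ V, χ x = 1) : χ = 1 := by
  by_contra hne
  have hle : V.topologicalClosure ≤ h.ker := V.topologicalClosure_minimal hχ h.isClosed_ker
  have himg : iter α k '' (V.topologicalClosure : Set X) = V.topologicalClosure := by
    have hhom : IsHomeomorph (α^[k]) := by
      clear hVk hk
      induction k with
      | zero => exact IsHomeomorph.id
      | succ k ih => exact ih.comp α.toHomeomorph.isHomeomorph
    rw [iter_natCast, AddSubgroup.topologicalClosure_coe]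
    rw [← hhom.isClosedMap.closure_image_eq_of_continuous hhom.continuous, hVk]
  have hfin := hα k (by exact_mod_cast hk.ne') V.topologicalClosure
    V.isClosed_topologicalClosure himg
    (fun ht => h.ker_ne_top hne (top_le_iff.1 (ht ▸ hle)))
  exact hV (hfin.subset V.le_topologicalClosure)

end LeafCharacters

/-! ### Genericity of the leaf rotation from total irreducibility -/

section Coefficients

variable {ι : Type*}
variable {X : Type*} [AddCommGroup X] [TopologicalSpace X]
variable {j : (ι → ℂ) →+ X} {α : X ≃ₜ+ X}
variable {g : ι → Circle} (hg : ∀ z, α (j z) = j fun v => g v * z v)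

include hg in
theorem iterate_leaf (k : ℕ) (z : ι → ℂ) : α^[k] (j z) = j fun v => (g v : ℂ) ^ k * z v := by
  induction k with
  | zero => simp
  | succ k ih =>
    rw [Function.iterate_succ_apply', ih, hg]
    congr 1
    funext v
    rw [pow_succ', mul_assoc]

variable [Fintype ι]

theorem exists_coefficients (ℓ : (ι → ℂ) →L[ℝ] ℝ) :
    ∃ c : ι → ℂ, ∀ z, ℓ z = (∑ v, c v * z v).re := by
  classical
  refine ⟨fun v => ℓ (Pi.single v 1) - ℓ (Pi.single v Complex.I) * Complex.I, fun z => ?_⟩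
  have hz : z = ∑ v, ((z v).re • (Pi.single v (1 : ℂ) : ι → ℂ) +
      (z v).im • (Pi.single v Complex.I : ι → ℂ)) := by
    funext w
    rw [Finset.sum_apply, Finset.sum_eq_single w]
    · simp [Complex.re_add_im]
    · intro v _ hv
      simp [hv.symm]
    · simp
  conv_lhs => rw [hz]
  rw [map_sum, Complex.re_sum]
  refine Finset.sum_congr rfl fun v _ => ?_
  simp [mul_comm]

variable [IsTopologicalAddGroup X] (hj : Function.Injective j)
variable (hα : IsTotallyIrreducible α)

include hg hj hα in
-- The real plane parametrized by `f` projects to an infinite subgroup invariant under the k-th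
-- iterate. Total irreducibility allows no nontrivial character to vanish on it.
theorem IsLeafChar.eq_one_of_line {χ : C(X, ℂ)} (h : IsLeafChar j χ) {k : ℕ} (hk : 0 < k)
    (f : ℂ →+ (ι → ℂ)) (hf : Function.Injective f) {u : ℂ} (hu : u ≠ 0)
    (hfu : ∀ ζ, (fun v => (g v : ℂ) ^ k * f ζ v) = f (u * ζ))
    (hχ : ∀ ζ, χ (j (f ζ)) = 1) : χ = 1 := by
  refine h.eq_one_of_invariant hα hk (V := (j.comp f).range) ?_ ?_ ?_
  · rw [AddMonoidHom.coe_range]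
    exact Set.infinite_range_of_injective (hj.comp hf)
  · rw [AddMonoidHom.coe_range, ← Set.range_comp]
    have : (α^[k] ∘ (j.comp f)) = (j.comp f) ∘ fun ζ => u * ζ := by
      funext ζ
      simp only [Function.comp_apply, AddMonoidHom.coe_comp]
      rw [iterate_leaf hg, hfu]
    rw [this, Set.range_comp, (mul_left_surjective₀ hu).range_eq, Set.image_univ]
  · rintro x ⟨ζ, rfl⟩
    exact hχ ζ

include hg hj hα in
/-- The rotation by which `α` acts along the leaves is generic, and nontrivial characters depend on
all the leaf coordinates. -/
theorem IsLeafChar.exists_generic {χ : C(X, ℂ)} (h : IsLeafChar j χ) (hχ : χ ≠ 1) :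
    ∃ c : ι → ℂ, (∀ v, c v ≠ 0) ∧
      (∀ z, χ (j z) = Complex.exp (((∑ v, c v * z v).re : ℝ) * Complex.I)) ∧
      (∀ v v', v ≠ v' → ∀ k, 0 < k → (g v / g v') ^ k ≠ 1) ∧
      (∀ v v', v ≠ v' → ∀ k, 0 < k → (g v * g v') ^ k ≠ 1) := by
  classical
  obtain ⟨ℓ, hℓ⟩ := h.exists_linear
  obtain ⟨c, hc⟩ := exists_coefficients ℓ
  have hℓc : ∀ z, χ (j z) = Complex.exp (((∑ v, c v * z v).re : ℝ) * Complex.I) := fun z => by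
    rw [hℓ, hc]
  have hc0 : ∀ v, c v ≠ 0 := by
    intro v hv
    refine hχ (h.eq_one_of_line hg hj hα one_pos (AddMonoidHom.single (fun _ : ι => ℂ) v)
      (Pi.single_injective (M := fun _ => ℂ) v) (Circle.coe_ne_zero (g v)) (fun ζ => ?_) fun ζ => ?_)
    · funext w
      by_cases hw : w = v
      · subst hw
        simp
      · simp [hw]
    · rw [hℓc, Finset.sum_eq_zero]
      · simp
      · intro w _
        by_cases hw : w = v
        · rw [hw, hv, zero_mul]
        · simp [hw]
  -- A resonance between two coordinates makes the graph of some additive τ invariant under the k-th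
  -- iterate, and τ can be chosen with the graph in the kernel of the linear form. For g_v^k =
  -- g_{v'}^k it is complex linear; for g_v^k g_{v'}^k = 1 it is conjugate linear.
  have key : ∀ v v', v ≠ v' → ∀ k, 0 < k → ∀ τ : ℂ →+ ℂ,
      (∀ ζ, τ ((g v : ℂ) ^ k * ζ) = (g v' : ℂ) ^ k * τ ζ) →
      (∀ ζ, (c v * ζ + c v' * τ ζ).re = 0) → False := by
    intro v v' hvv k hk τ hτ hre
    refine hχ (h.eq_one_of_line hg hj hα hk (AddMonoidHom.single (fun _ : ι => ℂ) v +
      (AddMonoidHom.single (fun _ : ι => ℂ) v').comp τ) ?_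
      (pow_ne_zero k (Circle.coe_ne_zero (g v))) (fun ζ => ?_) fun ζ => ?_)
    · intro ζ ζ' he
      have := congrFun he v
      simpa [hvv] using this
    · funext w
      by_cases hw : w = v
      · subst hw
        simp [hvv]
      · by_cases hw' : w = v'
        · subst hw'
          simp [hw, hτ]
        · simp [hw, hw']
    · rw [hℓc]
      have : ∑ w, c w * (AddMonoidHom.single (fun _ : ι => ℂ) v +
          (AddMonoidHom.single (fun _ : ι => ℂ) v').comp τ) ζ w = c v * ζ + c v' * τ ζ := by
        simp [mul_add, Finset.sum_add_distrib, Pi.single_apply]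
      rw [this, hre]
      simp
  refine ⟨c, hc0, hℓc, fun v v' hvv k hk he => ?_, fun v v' hvv k hk he => ?_⟩
  · have he' : (g v : ℂ) ^ k = (g v' : ℂ) ^ k := by
      rw [div_pow, div_eq_one] at he
      exact_mod_cast congrArg (fun z : Circle => (z : ℂ)) he
    refine key v v' hvv k hk (AddMonoidHom.mulLeft (-c v / c v')) (fun ζ => ?_) fun ζ => ?_
    · simp only [AddMonoidHom.coe_mulLeft, he']
      ring
    · simp only [AddMonoidHom.coe_mulLeft]
      have : c v * ζ + c v' * (-c v / c v' * ζ) = 0 := by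
        field_simp [hc0 v']
        ring
      rw [this, Complex.zero_re]
  · have he' : (starRingEnd ℂ) ((g v : ℂ) ^ k) = (g v' : ℂ) ^ k := by
      rw [mul_pow, mul_eq_one_iff_inv_eq] at he
      rw [← Circle.coe_pow, ← Circle.coe_inv_eq_conj, he, Circle.coe_pow]
    refine key v v' hvv k hk ((AddMonoidHom.mulLeft (-(starRingEnd ℂ) (c v) / c v')).comp
      (starRingEnd ℂ).toAddMonoidHom) (fun ζ => ?_) fun ζ => ?_
    · simp only [AddMonoidHom.coe_comp, Function.comp_apply, AddMonoidHom.coe_mulLeft,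
        RingHom.toAddMonoidHom_eq_coe, AddMonoidHom.coe_coe, map_mul, he']
      ring
    · simp only [AddMonoidHom.coe_comp, Function.comp_apply, AddMonoidHom.coe_mulLeft,
        RingHom.toAddMonoidHom_eq_coe, AddMonoidHom.coe_coe]
      have : c v * ζ + c v' * (-(starRingEnd ℂ) (c v) / c v' * (starRingEnd ℂ) ζ) =
          c v * ζ - (starRingEnd ℂ) (c v * ζ) := by
        rw [map_mul]
        field_simp [hc0 v']
        ring
      rw [this, Complex.sub_re, Complex.conj_re, sub_self]

include hg hj hα in
/-- Birkhoff averages of a nontrivial character tend to be small at leaf points far from `0`. -/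
theorem IsLeafChar.exists_forall_eventually_norm_average_le {χ : C(X, ℂ)} (h : IsLeafChar j χ)
    (hχ : χ ≠ 1) (hg1 : ∀ v k, 0 < k → g v ^ k ≠ 1) {δ : ℝ} (hδ : 0 < δ) :
    ∃ R : ℝ, ∀ z, R ≤ ‖z‖ → ∀ᶠ N : ℕ in atTop,
      ‖(N : ℂ)⁻¹ * ∑ n ∈ Finset.range N, χ (α^[n] (j z))‖ ≤ δ := by
  obtain ⟨c, hc0, hc, hg2, hg3⟩ := h.exists_generic hg hj hα hχ
  obtain ⟨R, hR⟩ := CentralFoliation.exists_forall_eventually_norm_average_le hg1 hg2 hg3 hδ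
  obtain ⟨M, hM⟩ : ∃ M : ℝ, ∀ v, ‖c v‖⁻¹ ≤ M :=
    (Set.finite_range fun v => ‖c v‖⁻¹).bddAbove.imp fun M hM v => hM ⟨v, rfl⟩
  -- All coefficients are nonzero, so a large `z` makes the vector with entries `c v * z v` large.
  refine ⟨|M| * |R| + 1, fun z hz => ?_⟩
  have hb : R ≤ ‖fun v => c v * z v‖ := by
    by_contra! hlt
    have : ‖z‖ ≤ |M| * |R| := by
      refine (pi_norm_le_iff_of_nonneg (by positivity)).2 fun v => ?_
      have h1 : ‖z v‖ = ‖c v‖⁻¹ * ‖c v * z v‖ := by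
        rw [norm_mul, inv_mul_cancel_left₀ (norm_ne_zero_iff.2 (hc0 v))]
      rw [h1]
      refine mul_le_mul ((hM v).trans (le_abs_self M)) ?_ (norm_nonneg _) (abs_nonneg _)
      exact ((norm_le_pi_norm (fun v => c v * z v) v).trans hlt.le).trans (le_abs_self R)
    linarith
  filter_upwards [hR _ hb] with N hN
  refine le_of_eq_of_le ?_ hN
  congr 2
  refine Finset.sum_congr rfl fun n _ => ?_
  rw [iterate_leaf hg, hc]
  congr 4
  refine Finset.sum_congr rfl fun v _ => ?_
  ring

end Coefficients


/-! ### The archimedean trace and a common denominator -/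

section ArchimedeanTrace

variable {K : Type*} [Field K] [NumberField K]

/-- The real part of the trace form on the archimedean components of `W`. -/
def archTrace (θ : K) : W θ →+ ℝ where
  toFun w := ∑ σ : K →+* ℂ, (InfinitePlace.Completion.extensionEmbedding (InfinitePlace.mk σ)
    (w.1 (InfinitePlace.mk σ))).re
  map_zero' := Finset.sum_eq_zero fun σ _ => by
    change (InfinitePlace.Completion.extensionEmbedding (InfinitePlace.mk σ) 0).re = 0
    rw [map_zero, Complex.zero_re]
  map_add' w w' := by
    rw [← Finset.sum_add_distrib]
    refine Finset.sum_congr rfl fun σ _ => ?_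
    change (InfinitePlace.Completion.extensionEmbedding (InfinitePlace.mk σ)
      (w.1 (InfinitePlace.mk σ) + w'.1 (InfinitePlace.mk σ))).re = _
    rw [map_add, Complex.add_re]

variable {θ : K}

theorem archTrace_apply (w : W θ) : archTrace θ w = ∑ σ : K →+* ℂ,
    (InfinitePlace.Completion.extensionEmbedding (InfinitePlace.mk σ)
      (w.1 (InfinitePlace.mk σ))).re := rfl

theorem continuous_archTrace : Continuous (archTrace θ) := by
  refine continuous_finsetSum _ fun σ _ => Complex.continuous_re.comp ?_
  exact (InfinitePlace.Completion.isometry_extensionEmbedding _).continuous.comp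
    ((continuous_apply _).comp continuous_fst)

theorem archTrace_of_fst_eq {w : W θ} {k : K} (h : w.1 = (diag θ k).1) :
    archTrace θ w = Algebra.trace ℚ K k := by
  have h1 : ((Algebra.trace ℚ K k : ℚ) : ℂ) = ∑ σ : K →+* ℂ, σ k := by
    have := trace_eq_sum_embeddings (K := ℚ) (L := K) ℂ (x := k)
    rw [eq_ratCast] at this
    rw [this]
    exact Fintype.sum_equiv (RingHom.equivRatAlgHom K ℂ).symm _ _ fun σ => rfl
  have h2 : ((Algebra.trace ℚ K k : ℚ) : ℝ) = ((Algebra.trace ℚ K k : ℚ) : ℂ).re := by simp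
  rw [h2, h1, Complex.re_sum, archTrace_apply, h]
  refine Finset.sum_congr rfl fun σ _ => ?_
  have h3 : InfinitePlace.Completion.extensionEmbedding (InfinitePlace.mk σ)
      ((diag θ k).1 (InfinitePlace.mk σ)) = (InfinitePlace.mk σ).embedding k := by
    change InfinitePlace.Completion.extensionEmbedding (InfinitePlace.mk σ)
      (algebraMap K (InfinitePlace.mk σ).Completion k) = _
    rw [InfinitePlace.Completion.algebraMap_apply]
    exact (InfinitePlace.Completion.extensionEmbedding_coe (v := InfinitePlace.mk σ)
      ((WithAbs.equiv (InfinitePlace.mk σ).1).symm k))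
  rw [h3]
  -- The embedding chosen for the place of σ may be the conjugate of σ; real parts do not see the
  -- difference.
  rcases InfinitePlace.embedding_mk_eq σ with h4 | h4 <;> rw [h4]
  rw [ComplexEmbedding.conjugate_coe_eq, Complex.conj_re]

theorem exists_int_trace_eq {k : K} (hk : IsIntegral ℤ k) : ∃ n : ℤ, Algebra.trace ℚ K k = n := by
  obtain ⟨n, hn⟩ := IsIntegrallyClosed.isIntegral_iff.1 (Algebra.isIntegral_trace (L := ℚ) hk)
  exact ⟨n, by rw [← hn]; simp⟩

/-- The elements of `W` that are integral at the finite places. -/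
def integralAtBad (θ : K) : AddSubgroup (W θ) where
  carrier := {w | ∀ v : BadPlace θ, Valued.v (w.2 v) ≤ 1}
  zero_mem' v := by
    change Valued.v (0 : v.1.adicCompletion K) ≤ 1
    simp
  add_mem' {a b} ha hb v := by
    change Valued.v (a.2 v + b.2 v) ≤ 1
    exact (Valuation.map_add_le _ (ha v) (hb v))
  neg_mem' {a} ha v := by
    change Valued.v (-a.2 v) ≤ 1
    rw [Valuation.map_neg]
    exact ha v

theorem isOpen_integralAtBad (hθ : θ ≠ 0) : IsOpen (integralAtBad θ : Set (W θ)) := by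
  have := finite_badPlace hθ
  have h : (integralAtBad θ : Set (W θ)) =
      ⋂ v : BadPlace θ, (fun w : W θ => w.2 v) ⁻¹' (Valued.integer (v.1.adicCompletion K)) := by
    ext w
    simp only [Set.mem_iInter]
    rfl
  rw [h]
  exact isOpen_iInter_of_finite fun v => (Valued.isOpen_integer _).preimage
    ((continuous_apply v).comp continuous_snd)

theorem valuation_le_one_of_mem_adjoin (v : HeightOneSpectrum (𝓞 K)) (hv : v.valuation K θ = 1)
    {a : K} (ha : a ∈ Algebra.adjoin ℤ ({θ, θ⁻¹} : Set K)) : v.valuation K a ≤ 1 := by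
  induction ha using Algebra.adjoin_induction with
  | mem x hx =>
    rcases hx with rfl | rfl
    · exact hv.le
    · rw [map_inv₀, hv, inv_one]
  | algebraMap n =>
    have := v.valuation_le_one (K := K) (n : 𝓞 K)
    simpa using this
  | add x y _ _ hx hy => exact Valuation.map_add_le _ hx hy
  | mul x y _ _ hx hy =>
    rw [map_mul]
    exact mul_le_one' hx hy

/-- A common denominator of the elements of `L` that are integral at the finite places of `S`. -/
theorem exists_common_denominator
    {L : Submodule (Algebra.adjoin ℤ ({θ, θ⁻¹} : Set K)) K} (hL : L.FG) :
    ∃ N : ℕ, 0 < N ∧ ∀ l ∈ L, diag θ l ∈ integralAtBad θ → IsIntegral ℤ ((N : K) * l) := by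
  obtain ⟨s, rfl⟩ := hL
  obtain ⟨y, hy, hs⟩ := exists_integral_multiples ℤ ℚ s
  have hN : ∀ x ∈ s, IsIntegral ℤ ((y.natAbs : K) * x) := by
    intro x hx
    have h1 := hs x hx
    rw [zsmul_eq_mul] at h1
    rcases Int.natAbs_eq y with h | h
    · rw [h, Int.cast_natCast] at h1
      exact h1
    · rw [h, Int.cast_neg, Int.cast_natCast, neg_mul] at h1
      simpa using h1.neg
  refine ⟨y.natAbs, Int.natAbs_pos.2 hy, fun l hl hU => ?_⟩
  have hval : ∀ v : HeightOneSpectrum (𝓞 K), v.valuation K ((y.natAbs : K) * l) ≤ 1 := by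
    intro v
    have hN1 : v.valuation K (y.natAbs : K) ≤ 1 := by
      have := v.valuation_le_one (K := K) (y.natAbs : 𝓞 K)
      simpa using this
    -- Where θ is a unit, so that the ring ℤ[θ, θ⁻¹] is v-integral, clearing denominators of the
    -- generators suffices. At the other finite places `l` itself is integral by assumption.
    by_cases hv : v.valuation K θ = 1
    · clear hU
      induction hl using Submodule.span_induction with
      | mem x hx =>
        have := v.valuation_le_one (K := K) (⟨_, hN x hx⟩ : 𝓞 K)
        exact this
      | zero => simp
      | add x z _ _ hx hz =>
        rw [mul_add]
        exact Valuation.map_add_le _ hx hz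
      | smul a x _ hx =>
        have : (y.natAbs : K) * (a • x) = (a : K) * ((y.natAbs : K) * x) := by
          rw [Algebra.smul_def]
          change _ * ((a : K) * x) = _
          ring
        rw [this, map_mul]
        exact mul_le_one' (valuation_le_one_of_mem_adjoin v hv a.2) hx
    · rw [map_mul]
      refine mul_le_one' hN1 ?_
      have := hU ⟨v, hv⟩
      change Valued.v ((algebraMap K (v.adicCompletion K)) l) ≤ 1 at this
      rw [← HeightOneSpectrum.valuedAdicCompletion_eq_valuation' v l]
      exact this
  obtain ⟨t, ht⟩ := HeightOneSpectrum.mem_integers_of_valuation_le_one (R := 𝓞 K) K _ hval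
  rw [← ht]
  exact t.isIntegral_coe

end ArchimedeanTrace

/-! ### A nontrivial character of `X` from the trace -/

section TraceCharacter

variable {K : Type*} [Field K] [NumberField K] {θ : K}
variable {X : Type*} [AddCommGroup X] [TopologicalSpace X] [IsTopologicalAddGroup X]
  [ConnectedSpace X]
variable {L : Submodule (Algebra.adjoin ℤ ({θ, θ⁻¹} : Set K)) K}
variable (φ : (W θ ⧸ lattice θ L) ≃ₜ+ X)

/-- The image of an open subgroup under an open homomorphism is open and closed, hence all of the
connected group `X`. -/
theorem exists_integralAtBad_proj_eq (hθ : θ ≠ 0) (x : X) :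
    ∃ u ∈ integralAtBad θ, proj φ u = x := by
  set f : W θ →+ X := ⟨⟨proj φ, proj_zero φ⟩, proj_add φ⟩
  set V : AddSubgroup X := (integralAtBad θ).map f with hV
  have hVo : IsOpen (V : Set X) := isOpenMap_proj φ _ (isOpen_integralAtBad hθ)
  have h : (V : Set X) = Set.univ :=
    IsClopen.eq_univ ⟨V.isClosed_of_isOpen hVo, hVo⟩ ⟨0, V.zero_mem⟩
  have hx : x ∈ (V : Set X) := h ▸ Set.mem_univ x
  exact hx

/-- On the open subgroup U = `integralAtBad θ` the map w ↦ exp(2πi N Tr(w)), with Tr the archimedean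
trace, is a character. It is trivial on lattice points in U, because N l is an algebraic integer and
has integral trace. As U maps onto `X`, it descends. -/
theorem exists_isLeafChar_ne_one (hθ : θ ≠ 0) (hL : L.FG) {E : Type*} [NormedAddCommGroup E]
    [NormedSpace ℝ E] (j : E →+ W θ) (hjc : Continuous j) (hj : ∀ z, j z ∈ integralAtBad θ) :
    ∃ χ : C(X, ℂ), χ ≠ 1 ∧ ∃ j' : E →+ X, (∀ z, j' z = proj φ (j z)) ∧ IsLeafChar j' χ := by
  obtain ⟨N, hN, hNl⟩ := exists_common_denominator hL
  choose u hu hux using exists_integralAtBad_proj_eq φ hθ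
  set e : W θ → ℂ := fun w => Complex.exp ((2 * Real.pi * N * archTrace θ w : ℝ) * Complex.I)
    with he
  have he_add : ∀ w w', e (w + w') = e w * e w' := fun w w' => by
    rw [he]
    simp only
    rw [← Complex.exp_add, map_add]
    congr 1
    push_cast
    ring
  have he_lattice : ∀ l ∈ L, diag θ l ∈ integralAtBad θ → e (diag θ l) = 1 := by
    intro l hl hU
    obtain ⟨n, hn⟩ := exists_int_trace_eq (hNl l hl hU)
    have h1 : (N : ℝ) * archTrace θ (diag θ l) = n := by
      rw [archTrace_of_fst_eq rfl]
      rw [← nsmul_eq_mul, map_nsmul, nsmul_eq_mul] at hn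
      exact_mod_cast hn
    rw [he]
    simp only
    rw [mul_assoc, h1]
    rw [Complex.exp_eq_one_iff]
    exact ⟨n, by push_cast; ring⟩
  have key : ∀ w ∈ integralAtBad θ, e (u (proj φ w)) = e w := by
    intro w hw
    obtain ⟨l, hl, hlw⟩ := (proj_eq_iff φ).1 (hux (proj φ w))
    have hlU : diag θ l ∈ integralAtBad θ := by
      have : diag θ l = u (proj φ w) - w := by rw [hlw, add_sub_cancel_left]
      rw [this]
      exact (integralAtBad θ).sub_mem (hu _) hw
    rw [hlw, he_add, he_lattice l hl hlU, mul_one]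
  have cont_e : Continuous e := by
    have := continuous_archTrace (θ := θ)
    fun_prop
  have hUo := isOpen_integralAtBad hθ
  set p : integralAtBad θ → X := fun w => proj φ w with hp
  have hpq : IsQuotientMap p := by
    refine IsOpenMap.isQuotientMap ?_ ((continuous_proj φ).comp continuous_subtype_val) fun x =>
      ⟨⟨u x, hu x⟩, hux x⟩
    exact (isOpenMap_proj φ).comp hUo.isOpenEmbedding_subtypeVal.isOpenMap
  have hcont : Continuous fun x => e (u x) := by
    rw [hpq.continuous_iff]
    refine (cont_e.comp continuous_subtype_val).congr fun w => (key w w.2).symm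
  refine ⟨⟨fun x => e (u x), hcont⟩, fun h => ?_, (⟨⟨proj φ, proj_zero φ⟩, proj_add φ⟩ :
    W θ →+ X).comp j, fun z => rfl, ?_, ?_, ?_⟩
  · set d := Module.finrank ℚ K with hd
    have hd0 : 0 < d := Module.finrank_pos
    -- The archimedean image of 1/(2Nd), with zero finite components, has trace 1/(2N), so the
    -- character takes the value exp(πi) = -1.
    set w : W θ := ((diag θ ((((2 * N * d : ℕ) : ℚ)⁻¹ : ℚ) : K)).1, 0) with hw
    have hwU : w ∈ integralAtBad θ := (integralAtBad θ).zero_mem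
    have h1 : e w = 1 := by
      rw [← key w hwU]
      exact ContinuousMap.congr_fun h _
    have h2 : archTrace θ w = (2 * N : ℝ)⁻¹ := by
      rw [archTrace_of_fst_eq (w := w) rfl, ← eq_ratCast (algebraMap ℚ K), Algebra.trace_algebraMap]
      have h3 : (d : ℝ) ≠ 0 := by exact_mod_cast hd0.ne'
      rw [← hd, nsmul_eq_mul]
      push_cast
      rw [mul_inv, mul_left_comm, mul_inv_cancel₀ h3, mul_one]
    rw [he] at h1
    simp only [h2] at h1
    have h3 : (2 * Real.pi * N * (2 * N : ℝ)⁻¹ : ℝ) = Real.pi := by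
      have : (N : ℝ) ≠ 0 := by exact_mod_cast hN.ne'
      field_simp
    rw [h3, Complex.exp_pi_mul_I] at h1
    norm_num at h1
  · intro x y
    change e (u (x + y)) = e (u x) * e (u y)
    rw [← he_add, ← key (u x + u y) ((integralAtBad θ).add_mem (hu x) (hu y)), proj_add, hux, hux]
  · exact fun x => Complex.norm_exp_ofReal_mul_I _
  · set ℓ : E →+ ℝ := (AddMonoidHom.mulLeft (2 * Real.pi * N)).comp ((archTrace θ).comp j)
    have hℓ : Continuous ℓ := continuous_const.mul (continuous_archTrace.comp hjc)
    exact ⟨ℓ.toRealLinearMap hℓ, fun z => key (j z) (hj z)⟩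

end TraceCharacter


/-! ### The common kernel of the leaf characters -/

section CommonKernel

variable {X : Type*} [AddCommGroup X] [TopologicalSpace X]
variable {E : Type*} [NormedAddCommGroup E] [NormedSpace ℝ E]

/-- The intersection of the kernels of all leaf characters. -/
def commonKer (j : E →+ X) : AddSubgroup X :=
  ⨅ χ : {χ : C(X, ℂ) // IsLeafChar j χ}, χ.2.ker

variable {j : E →+ X}

theorem mem_commonKer {x : X} : x ∈ commonKer j ↔ ∀ χ : C(X, ℂ), IsLeafChar j χ → χ x = 1 := by
  simp [commonKer, AddSubgroup.mem_iInf, IsLeafChar.mem_ker]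

theorem isClosed_commonKer : IsClosed (commonKer j : Set X) := by
  rw [commonKer, AddSubgroup.coe_iInf]
  exact isClosed_iInter fun χ => χ.2.isClosed_ker

/-- Leaf characters are stable under composition with `α` and its inverse, so the common kernel is a
closed invariant subgroup. One nontrivial character makes it proper, and irreducibility makes it
finite. -/
theorem finite_commonKer {α : X ≃ₜ+ X} (hα : IsTotallyIrreducible α) (T T' : E →L[ℝ] E)
    (hT : ∀ z, α (j z) = j (T z)) (hT' : ∀ z, α.symm (j z) = j (T' z)) {χ : C(X, ℂ)} (hχ : IsLeafChar j χ) (hχ1 : χ ≠ 1) :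
    (commonKer j : Set X).Finite := by
  have h1 : ∀ x, x ∈ commonKer j → α x ∈ commonKer j := fun x hx => by
    rw [mem_commonKer] at hx ⊢
    exact fun χ hχ => hx _ (hχ.comp (α : C(X, X)) (map_add α) T hT)
  have h2 : ∀ x, x ∈ commonKer j → α.symm x ∈ commonKer j := fun x hx => by
    rw [mem_commonKer] at hx ⊢
    exact fun χ hχ => hx _ (hχ.comp (α.symm : C(X, X)) (map_add α.symm) T' hT')
  refine hα 1 one_ne_zero (commonKer j) isClosed_commonKer ?_ fun ht => ?_
  · change (α : X → X) '' _ = _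
    refine Set.Subset.antisymm ?_ fun x hx => ⟨α.symm x, h2 x hx, α.apply_symm_apply x⟩
    rintro _ ⟨x, hx, rfl⟩
    exact h1 x hx
  · refine hχ.ker_ne_top hχ1 (top_le_iff.1 (ht ▸ ?_))
    exact iInf_le (fun χ : {χ : C(X, ℂ) // IsLeafChar j χ} => χ.2.ker) ⟨χ, hχ⟩

/-- The linear combinations of leaf characters. -/
def leafCharSpan (j : E →+ X) : Submodule ℂ C(X, ℂ) := Submodule.span ℂ {χ : C(X, ℂ) | IsLeafChar j χ}

theorem IsLeafChar.mem_span {χ : C(X, ℂ)} (h : IsLeafChar j χ) : χ ∈ leafCharSpan j :=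
  Submodule.subset_span h

end CommonKernel

/-! ### Leaf characters determine measures modulo the common kernel -/

section Uniqueness

variable {X : Type*} [AddCommGroup X] [TopologicalSpace X] [IsTopologicalAddGroup X]
  [CompactSpace X] [T2Space X] [SecondCountableTopology X] [MeasurableSpace X] [BorelSpace X]
variable {E : Type*} [NormedAddCommGroup E] [NormedSpace ℝ E] (j : E →+ X)

/-- The quotient map by the common kernel of the leaf characters. -/
def commonKerMk : C(X, X ⧸ commonKer j) := ⟨QuotientAddGroup.mk, continuous_quot_mk⟩

/-- The linear combinations of leaf characters, on the quotient by their common kernel. -/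
def leafCharAlgebra : StarSubalgebra ℂ (BoundedContinuousFunction (X ⧸ commonKer j) ℂ) where
  carrier := {F | F.toContinuousMap.comp (commonKerMk j) ∈ leafCharSpan j}
  mul_mem' {F G} hF hG := by
    rw [Set.mem_ofPred_eq] at *
    have h := Submodule.mul_mem_mul hF hG
    rw [leafCharSpan, Submodule.span_mul_span] at h
    refine Submodule.span_mono ?_ h
    rintro _ ⟨χ, hχ, χ', hχ', rfl⟩
    exact IsLeafChar.mul hχ hχ'
  add_mem' {F G} hF hG := by
    rw [Set.mem_ofPred_eq] at *
    exact Submodule.add_mem _ hF hG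
  algebraMap_mem' r := by
    have : ((algebraMap ℂ (BoundedContinuousFunction (X ⧸ commonKer j) ℂ) r).toContinuousMap.comp
        (commonKerMk j)) = r • (1 : C(X, ℂ)) := by
      ext x
      simp
    rw [Set.mem_ofPred_eq, this]
    exact Submodule.smul_mem _ _ IsLeafChar.one.mem_span
  star_mem' {F} hF := by
    change F ∈ {F | _} at hF
    change star F ∈ {F | _}
    rw [Set.mem_ofPred_eq] at *
    change star (F.toContinuousMap.comp (commonKerMk j)) ∈ _
    generalize F.toContinuousMap.comp (commonKerMk j) = f at hF
    induction hF using Submodule.span_induction with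
    | mem χ hχ => exact (IsLeafChar.star hχ).mem_span
    | zero => rw [star_zero]; exact Submodule.zero_mem _
    | add a b _ _ ha hb => rw [star_add]; exact Submodule.add_mem _ ha hb
    | smul r a _ ha => rw [star_smul]; exact Submodule.smul_mem _ _ ha

omit [IsTopologicalAddGroup X] [T2Space X] [SecondCountableTopology X] [MeasurableSpace X]
  [BorelSpace X] in
variable {j} in
theorem mem_leafCharAlgebra {F : BoundedContinuousFunction (X ⧸ commonKer j) ℂ} :
    F ∈ leafCharAlgebra j ↔ F.toContinuousMap.comp (commonKerMk j) ∈ leafCharSpan j := Iff.rfl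

theorem separatesPoints_leafCharAlgebra :
    ((leafCharAlgebra j).map
      (BoundedContinuousFunction.toContinuousMapStarₐ ℂ)).SeparatesPoints := by
  have hcl : IsClosed (commonKer j : Set X) := isClosed_commonKer
  intro x y hxy
  obtain ⟨a, rfl⟩ := QuotientAddGroup.mk_surjective x
  obtain ⟨b, rfl⟩ := QuotientAddGroup.mk_surjective y
  have hab : -a + b ∉ commonKer j := fun h => hxy (QuotientAddGroup.eq.2 h)
  rw [mem_commonKer] at hab
  push Not at hab
  obtain ⟨χ, hχ, hne⟩ := hab
  have hlift : ∀ u v : X, (QuotientAddGroup.leftRel (commonKer j)) u v → χ u = χ v := by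
    intro u v huv
    have h1 := mem_commonKer.1 (QuotientAddGroup.leftRel_apply.1 huv) χ hχ
    rw [hχ.map_add, hχ.map_neg, inv_mul_eq_one₀ (hχ.ne_zero u)] at h1
    exact h1
  let F : C(X ⧸ commonKer j, ℂ) := ⟨Quotient.lift χ hlift, χ.continuous.quotient_lift hlift⟩
  refine ⟨F, ⟨F, ⟨BoundedContinuousFunction.mkOfCompact F, ?_, ?_⟩, rfl⟩, fun h => hne ?_⟩
  · have : (BoundedContinuousFunction.mkOfCompact F).toContinuousMap.comp (commonKerMk j) = χ := by
      ext x
      rfl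
    refine mem_leafCharAlgebra.2 ?_
    rw [this]
    exact hχ.mem_span
  · ext x
    rfl
  · change χ a = χ b at h
    rw [hχ.map_add, hχ.map_neg, h, inv_mul_cancel₀ (hχ.ne_zero b)]

variable {j}

/-- On the quotient the combinations of leaf characters form a star algebra separating points, so
they determine finite measures. Both sides integrate nontrivial characters to 0 and the trivial one
to the total mass of `m`. -/
theorem map_commonKer_eq_smul_haar (m h : Measure X) [IsFiniteMeasure m] [IsProbabilityMeasure h]
    [h.IsAddLeftInvariant]
    (hm : ∀ χ : C(X, ℂ), IsLeafChar j χ → χ ≠ 1 → ∫ x, χ x ∂m = 0) :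
    m.map (commonKerMk j) = m Set.univ • h.map (commonKerMk j) := by
  have hcl : IsClosed (commonKer j : Set X) := isClosed_commonKer
  have : PolishSpace X := by
    let := TopologicalSpace.metrizableSpaceMetric X
    infer_instance
  have : T2Space (X ⧸ commonKer j) := inferInstance
  have : PolishSpace (X ⧸ commonKer j) := by
    let := TopologicalSpace.metrizableSpaceMetric (X ⧸ commonKer j)
    infer_instance
  have hmeas : Measurable (commonKerMk j) := (commonKerMk j).continuous.measurable
  have hfin : IsFiniteMeasure (m Set.univ • h.map (commonKerMk j)) :=
    Measure.smul_finite _ (measure_ne_top m _)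
  have hint : ∀ (p : Measure X) [IsFiniteMeasure p] (f : C(X, ℂ)), Integrable f p := fun p _ f =>
    f.continuous.integrable_of_hasCompactSupport (HasCompactSupport.of_compactSpace _)
  have hspan : ∀ f ∈ leafCharSpan j,
      ∫ x, f x ∂m = (m Set.univ).toReal • ∫ x, f x ∂h := by
    intro f hf
    induction hf using Submodule.span_induction with
    | mem χ hχ' =>
      have hχ : IsLeafChar j χ := hχ'
      by_cases h1 : χ = 1
      · simp [h1, Measure.real]
      · rw [hm χ hχ h1, hχ.integral_eq_zero h1, smul_zero]
    | zero => simp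
    | add a b _ _ ha hb =>
      simp only [ContinuousMap.add_apply]
      rw [integral_add (hint m a) (hint m b), integral_add (hint h a) (hint h b), ha, hb, smul_add]
    | smul r a _ ha =>
      simp only [ContinuousMap.smul_apply]
      rw [integral_smul, integral_smul, ha, smul_comm]
  refine ext_of_forall_mem_subalgebra_integral_eq_of_polish (separatesPoints_leafCharAlgebra j)
    fun F hF => ?_
  rw [integral_smul_measure, integral_map hmeas.aemeasurable
    F.continuous.aestronglyMeasurable, integral_map hmeas.aemeasurable
    F.continuous.aestronglyMeasurable]
  exact hspan _ (mem_leafCharAlgebra.1 hF)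

/-- A finite measure that is singular to Haar measure vanishes if all nontrivial leaf characters
integrate to zero. -/
theorem measure_eq_zero_of_forall_integral_eq_zero (hfin : (commonKer j : Set X).Finite)
    (m h : Measure X) [IsFiniteMeasure m] [IsProbabilityMeasure h] [h.IsAddLeftInvariant]
    (hmh : m ⟂ₘ h) (hm : ∀ χ : C(X, ℂ), IsLeafChar j χ → χ ≠ 1 → ∫ x, χ x ∂m = 0) : m = 0 := by
  obtain ⟨s, hs, hms, hhs⟩ := hmh
  have hmap := map_commonKer_eq_smul_haar m h hm
  have hmeas : Measurable (commonKerMk j) := by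
    exact measurable_quotient_mk''
  set t : Set (X ⧸ commonKer j) := commonKerMk j '' sᶜ with ht
  -- Saturating the Haar-null set carrying `m` by the finite kernel takes finitely many translates,
  -- so it stays Haar-null. Saturated sets are compared by the identity on the quotient.
  have hpre : commonKerMk j ⁻¹' t = ⋃ y ∈ (commonKer j : Set X), (fun x => y + x) ⁻¹' sᶜ := by
    ext x
    simp only [ht, Set.mem_preimage, Set.mem_image, Set.mem_iUnion, exists_prop]
    constructor
    · rintro ⟨a, ha, hax⟩
      refine ⟨-x + a, QuotientAddGroup.eq.1 hax.symm, ?_⟩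
      rw [show -x + a + x = a by abel]
      exact ha
    · rintro ⟨y, hy, hyx⟩
      refine ⟨y + x, hyx, QuotientAddGroup.eq.2 ?_⟩
      rw [show -(y + x) + x = -y by abel]
      exact (commonKer j).neg_mem hy
  have htm : MeasurableSet t := by
    change MeasurableSet (commonKerMk j ⁻¹' t)
    rw [hpre]
    exact hfin.measurableSet_biUnion fun y _ => measurable_const_add y hs.compl
  have hht : h (commonKerMk j ⁻¹' t) = 0 := by
    rw [hpre, measure_biUnion_null_iff hfin.countable]
    intro y _
    rw [measure_preimage_add, hhs]
  have hmt : m (commonKerMk j ⁻¹' t) = 0 := by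
    rw [← Measure.map_apply hmeas htm, hmap, Measure.smul_apply, Measure.map_apply hmeas htm, hht,
      smul_zero]
  rw [← Measure.measure_univ_eq_zero, ← Set.union_compl_self s]
  exact measure_union_null hms (measure_mono_null (Set.subset_preimage_image _ _) hmt)

end Uniqueness


/-- The Birkhoff averages of `f` along `T`. -/
def ergodicAverage {X : Type*} (T : X → X) (f : X → ℂ) (N : ℕ) (x : X) : ℂ :=
  (N : ℂ)⁻¹ * ∑ n ∈ Finset.range N, f (T^[n] x)

/-! ### Birkhoff averages and the mean ergodic theorem -/

section MeanErgodic

variable {X : Type*} [MeasurableSpace X] {μ : Measure X} [IsProbabilityMeasure μ] {T : X → X}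

theorem measurable_ergodicAverage (hT : Measurable T) {f : X → ℂ} (hf : Measurable f) (N : ℕ) :
    Measurable (ergodicAverage T f N) :=
  measurable_const.mul (Finset.measurable_fun_sum _ fun n _ => hf.comp (hT.iterate n))

omit [MeasurableSpace X] in
theorem norm_ergodicAverage_le {f : X → ℂ} (hf : ∀ x, ‖f x‖ ≤ 1) (N : ℕ) (x : X) :
    ‖ergodicAverage T f N x‖ ≤ 1 := by
  rw [ergodicAverage, norm_mul, norm_inv, Complex.norm_natCast]
  have h : ‖∑ n ∈ Finset.range N, f (T^[n] x)‖ ≤ N :=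
    (norm_sum_le_of_le _ (n := fun _ => (1 : ℝ)) fun n _ => hf _).trans (by simp)
  rcases Nat.eq_zero_or_pos N with rfl | hN
  · simp
  · have : (0 : ℝ) < N := by exact_mod_cast hN
    rw [inv_mul_le_iff₀ this, mul_one]
    exact h

omit [MeasurableSpace X] in
theorem tendsto_ergodicAverage_sub {f : X → ℂ} (hf : ∀ x, ‖f x‖ ≤ 1) (x : X) :
    Tendsto (fun N => ergodicAverage T f N (T x) - ergodicAverage T f N x) atTop (𝓝 0) := by
  have hinv : Tendsto (fun N : ℕ => ((N : ℝ))⁻¹ * 2) atTop (𝓝 0) := by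
    simpa using (tendsto_inv_atTop_nhds_zero_nat (𝕜 := ℝ)).mul_const 2
  refine squeeze_zero_norm (fun N => ?_) hinv
  rw [ergodicAverage, ergodicAverage, ← mul_sub, ← Finset.sum_sub_distrib]
  simp only [← Function.iterate_succ_apply]
  rw [Finset.sum_range_sub (fun n => f (T^[n] x)), norm_mul, norm_inv, Complex.norm_natCast]
  refine mul_le_mul_of_nonneg_left ((norm_sub_le _ _).trans ?_) (by positivity)
  linarith [hf (T^[N] x), hf (T^[0] x)]

/-- The mean ergodic theorem, along a subsequence on which the averages converge almost
everywhere. -/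
theorem exists_seq_tendsto_ergodicAverage (hT : MeasurePreserving T μ μ) {f : X → ℂ}
    (hf : Measurable f) (hf1 : ∀ x, ‖f x‖ ≤ 1) :
    ∃ (F : X → ℂ) (ns : ℕ → ℕ), Measurable F ∧ StrictMono ns ∧
      ∀ᵐ x ∂μ, Tendsto (fun i => ergodicAverage T f (ns i) x) atTop (𝓝 (F x)) := by
  have hmem : ∀ n, MemLp (f ∘ T^[n]) 2 μ := fun n =>
    MemLp.of_bound (hf.comp (hT.measurable.iterate n)).aestronglyMeasurable 1
      (Eventually.of_forall fun x => hf1 _)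
  set U : Lp ℂ 2 μ →ₗᵢ[ℂ] Lp ℂ 2 μ := Lp.compMeasurePreservingₗᵢ ℂ T hT with hU
  have hiter : ∀ n, U^[n] ((hmem 0).toLp _) = (hmem n).toLp _ := by
    intro n
    induction n with
    | zero => rfl
    | succ n ih =>
      rw [Function.iterate_succ_apply', ih]
      change Lp.compMeasurePreserving T hT ((hmem n).toLp _) = _
      rw [Lp.toLp_compMeasurePreserving]
      rfl
  have hsum : ∀ N : ℕ, (birkhoffAverage ℂ U _root_.id N ((hmem 0).toLp _) : Lp ℂ 2 μ) =ᵐ[μ]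
      ergodicAverage T f N := by
    intro N
    have h1 : ∀ N : ℕ, (∑ n ∈ Finset.range N, (hmem n).toLp (f ∘ T^[n]) : Lp ℂ 2 μ) =ᵐ[μ]
        fun x => ∑ n ∈ Finset.range N, f (T^[n] x) := by
      intro N
      induction N with
      | zero =>
        simp only [Finset.range_zero, Finset.sum_empty]
        exact Lp.coeFn_zero _ _ _
      | succ N ih =>
        simp only [Finset.sum_range_succ]
        filter_upwards [Lp.coeFn_add (∑ n ∈ Finset.range N, (hmem n).toLp (f ∘ T^[n]))
          ((hmem N).toLp (f ∘ T^[N])), ih, (hmem N).coeFn_toLp] with x hx1 hx2 hx3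
        rw [hx1, Pi.add_apply, hx2, hx3]
        rfl
    simp only [birkhoffAverage, birkhoffSum, hiter, _root_.id]
    filter_upwards [Lp.coeFn_smul (N : ℂ)⁻¹ (∑ n ∈ Finset.range N, (hmem n).toLp (f ∘ T^[n])),
      h1 N] with x hx1 hx2
    rw [hx1, Pi.smul_apply, hx2]
    rfl
  -- Von Neumann's theorem for the composition isometry on L². Convergence in L² gives convergence
  -- in measure, hence almost everywhere along a subsequence.
  obtain ⟨g, hconv⟩ : ∃ g : Lp ℂ 2 μ, Tendsto
      (fun N => birkhoffAverage ℂ U _root_.id N ((hmem 0).toLp _)) atTop (𝓝 g) :=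
    ⟨_, U.toContinuousLinearMap.tendsto_birkhoffAverage_orthogonalProjection
      U.norm_toContinuousLinearMap_le ((hmem 0).toLp _)⟩
  obtain ⟨ns, hns, hae⟩ := (tendstoInMeasure_of_tendsto_Lp hconv).exists_seq_tendsto_ae
  refine ⟨g, ns, (Lp.stronglyMeasurable g).measurable, hns, ?_⟩
  filter_upwards [hae, ae_all_iff.2 hsum] with x hx1 hx2
  refine hx1.congr fun i => ?_
  exact hx2 (ns i)

end MeanErgodic

/-! ### A large-sieve inequality -/

section LargeSieve

/-- If the correlations of a family of unimodular sequences are small, then few of them have large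
means. -/
theorem sum_sq_norm_average_le {κ : Type*} [Fintype κ] {N : ℕ} (hN : 0 < N) (u : κ → ℕ → ℂ)
    (hu : ∀ i n, ‖u i n‖ = 1) {δ : ℝ} (hδ : 0 ≤ δ)
    (hcorr : ∀ i k, i ≠ k →
      ‖(N : ℂ)⁻¹ * ∑ n ∈ Finset.range N, u i n * (starRingEnd ℂ) (u k n)‖ ≤ δ) :
    (∑ i, ‖(N : ℂ)⁻¹ * ∑ n ∈ Finset.range N, u i n‖ ^ 2) ^ 2 ≤
      Fintype.card κ + (Fintype.card κ : ℝ) ^ 2 * δ := by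
  classical
  have hN0 : (0 : ℝ) < N := by exact_mod_cast hN
  have hNC : (N : ℂ) ≠ 0 := by exact_mod_cast hN.ne'
  set a : κ → ℂ := fun i => (N : ℂ)⁻¹ * ∑ n ∈ Finset.range N, u i n with ha
  have ha1 : ∀ i, ‖a i‖ ≤ 1 := by
    intro i
    rw [ha, norm_mul, norm_inv, Complex.norm_natCast, inv_mul_le_iff₀ hN0, mul_one]
    exact (norm_sum_le_of_le _ (n := fun _ => (1 : ℝ)) fun n _ => (hu i n).le).trans (by simp)
  -- Duality: the sum of |a_i|² is the mean of `F`, which Cauchy–Schwarz bounds by the mean square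
  -- of `F`. Expanding that square leaves the diagonal terms and the small correlations.
  set F : ℕ → ℂ := fun n => ∑ i, (starRingEnd ℂ) (a i) * u i n with hF
  have h1 : ((∑ i, ‖a i‖ ^ 2 : ℝ) : ℂ) = (N : ℂ)⁻¹ * ∑ n ∈ Finset.range N, F n := by
    rw [hF, Finset.sum_comm, Finset.mul_sum]
    push_cast
    refine Finset.sum_congr rfl fun i _ => ?_
    rw [← Finset.mul_sum, mul_left_comm, ← Complex.conj_mul']
  have h2 : ((∑ n ∈ Finset.range N, ‖F n‖ ^ 2 : ℝ) : ℂ) = N * ∑ i, ∑ k, (starRingEnd ℂ) (a i) * a k *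
      ((N : ℂ)⁻¹ * ∑ n ∈ Finset.range N, u i n * (starRingEnd ℂ) (u k n)) := by
    rw [Finset.mul_sum]
    have h3 : ∀ i k, (N : ℂ) * ((starRingEnd ℂ) (a i) * a k *
        ((N : ℂ)⁻¹ * ∑ n ∈ Finset.range N, u i n * (starRingEnd ℂ) (u k n))) =
        ∑ n ∈ Finset.range N, ((starRingEnd ℂ) (a i) * u i n) *
          (starRingEnd ℂ) ((starRingEnd ℂ) (a k) * u k n) := by
      intro i k
      rw [mul_left_comm, mul_inv_cancel_left₀ hNC, Finset.mul_sum]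
      refine Finset.sum_congr rfl fun n _ => ?_
      rw [map_mul _ _ (u k n), Complex.conj_conj]
      ring
    simp only [Finset.mul_sum _ _ (N : ℂ), h3]
    push_cast
    simp only [← Complex.mul_conj', hF, map_sum, Finset.sum_mul_sum]
    rw [Finset.sum_comm]
    exact Finset.sum_congr rfl fun i _ => Finset.sum_comm
  have h4 : ∑ n ∈ Finset.range N, ‖F n‖ ^ 2 ≤
      N * (Fintype.card κ + (Fintype.card κ : ℝ) ^ 2 * δ) := by
    have h5 : ∑ n ∈ Finset.range N, ‖F n‖ ^ 2 = ‖((∑ n ∈ Finset.range N, ‖F n‖ ^ 2 : ℝ) : ℂ)‖ := by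
      rw [Complex.norm_real, Real.norm_of_nonneg (Finset.sum_nonneg fun _ _ => sq_nonneg _)]
    rw [h5, h2, norm_mul, Complex.norm_natCast]
    refine mul_le_mul_of_nonneg_left ?_ hN0.le
    have h6 : ∀ i k, ‖(starRingEnd ℂ) (a i) * a k *
        ((N : ℂ)⁻¹ * ∑ n ∈ Finset.range N, u i n * (starRingEnd ℂ) (u k n))‖ ≤
        (if i = k then 1 else 0) + δ := by
      intro i k
      rw [norm_mul, norm_mul, RCLike.norm_conj]
      have h7 : ‖a i‖ * ‖a k‖ ≤ 1 := mul_le_one₀ (ha1 i) (norm_nonneg _) (ha1 k)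
      refine (mul_le_of_le_one_left (norm_nonneg _) h7).trans ?_
      split_ifs with hik
      · have : ‖(N : ℂ)⁻¹ * ∑ n ∈ Finset.range N, u i n * (starRingEnd ℂ) (u k n)‖ ≤ 1 := by
          rw [norm_mul, norm_inv, Complex.norm_natCast, inv_mul_le_iff₀ hN0, mul_one]
          refine (norm_sum_le_of_le _ (n := fun _ => (1 : ℝ)) fun n _ => ?_).trans (by simp)
          rw [norm_mul, RCLike.norm_conj, hu, hu, one_mul]
        linarith
      · rw [zero_add]
        exact hcorr i k hik
    refine (norm_sum_le _ _).trans ((Finset.sum_le_sum fun i _ => (norm_sum_le _ _).trans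
      (Finset.sum_le_sum fun k _ => h6 i k)).trans (le_of_eq ?_))
    simp [Finset.sum_add_distrib]
    ring
  have h8 : ∑ i, ‖a i‖ ^ 2 ≤ (N : ℝ)⁻¹ * ∑ n ∈ Finset.range N, ‖F n‖ := by
    have h9 : ∑ i, ‖a i‖ ^ 2 = ‖((∑ i, ‖a i‖ ^ 2 : ℝ) : ℂ)‖ := by
      rw [Complex.norm_real, Real.norm_of_nonneg (Finset.sum_nonneg fun _ _ => sq_nonneg _)]
    rw [h9, h1, norm_mul, norm_inv, Complex.norm_natCast]
    exact mul_le_mul_of_nonneg_left (norm_sum_le _ _) (by positivity)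
  have h10 : (∑ n ∈ Finset.range N, ‖F n‖) ^ 2 ≤ N * ∑ n ∈ Finset.range N, ‖F n‖ ^ 2 := by
    have := sq_sum_le_card_mul_sum_sq (s := Finset.range N) (f := fun n => ‖F n‖)
    rwa [Finset.card_range] at this
  calc (∑ i, ‖a i‖ ^ 2) ^ 2 ≤ ((N : ℝ)⁻¹ * ∑ n ∈ Finset.range N, ‖F n‖) ^ 2 :=
        pow_le_pow_left₀ (Finset.sum_nonneg fun _ _ => sq_nonneg _) h8 2
    _ = ((N : ℝ)⁻¹) ^ 2 * (∑ n ∈ Finset.range N, ‖F n‖) ^ 2 := mul_pow _ _ _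
    _ ≤ ((N : ℝ)⁻¹) ^ 2 * (N * (N * (Fintype.card κ + (Fintype.card κ : ℝ) ^ 2 * δ))) :=
        mul_le_mul_of_nonneg_left (h10.trans (mul_le_mul_of_nonneg_left h4 hN0.le)) (by positivity)
    _ = _ := by field_simp

end LargeSieve

/-! ### Large limits of averages occupy bounded parts of leaves -/

section LeafConvergence

/-- An unbounded set always has a point farther than `R` from finitely many given ones. -/
theorem exists_separated_seq {E : Type*} [NormedAddCommGroup E] {S : Set E} (hS : ∀ r : ℝ, ∃ z ∈ S, r ≤ ‖z‖) (R : ℝ) :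
    ∃ z : ℕ → E, (∀ n, z n ∈ S) ∧ Pairwise fun i k => R ≤ ‖z i - z k‖ := by
  have : Std.Symm fun a b : E => R ≤ ‖a - b‖ := ⟨fun a b h => by rwa [norm_sub_rev]⟩
  refine exists_seq_of_forall_finset_exists' (fun z => z ∈ S) (fun a b => R ≤ ‖a - b‖)
    fun s _ => ?_
  obtain ⟨z, hz, hzr⟩ := hS (∑ x ∈ s, ‖x‖ + R)
  refine ⟨z, hz, fun x hx => ?_⟩
  have h1 : ‖x‖ ≤ ∑ x ∈ s, ‖x‖ := Finset.single_le_sum (fun y _ => norm_nonneg y) hx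
  have h2 := norm_sub_norm_le z x
  rw [norm_sub_rev x z]
  linarith

variable {X : Type*} [AddCommGroup X] [TopologicalSpace X]
variable {E : Type*} [NormedAddCommGroup E] [NormedSpace ℝ E] {j : E →+ X} {α : X ≃ₜ+ X}

/-- On each leaf, the points where the averages of a leaf character have a limit of absolute value
at least `ε` form a bounded set. -/
theorem IsLeafChar.exists_bound_of_tendsto {χ : C(X, ℂ)} (h : IsLeafChar j χ)
    (hsmall : ∀ δ : ℝ, 0 < δ → ∃ R : ℝ, ∀ z, R ≤ ‖z‖ → ∀ᶠ N : ℕ in atTop,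
      ‖(N : ℂ)⁻¹ * ∑ n ∈ Finset.range N, χ (α^[n] (j z))‖ ≤ δ)
    {ns : ℕ → ℕ} (hns : StrictMono ns) (F : X → ℂ) {ε : ℝ} (hε : 0 < ε) (x : X) :
    ∃ r : ℝ, ∀ z, Tendsto (fun i => ergodicAverage α χ (ns i) (x + j z)) atTop (𝓝 (F (x + j z))) →
      ε < ‖F (x + j z)‖ → ‖z‖ < r := by
  by_contra! hcon
  set S : Set E := {z | Tendsto (fun i => ergodicAverage α χ (ns i) (x + j z)) atTop
    (𝓝 (F (x + j z))) ∧ ε < ‖F (x + j z)‖} with hS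
  have hδ : 0 < ε ^ 4 / 2 := by positivity
  obtain ⟨R, hR⟩ := hsmall _ hδ
  obtain ⟨z, hzS, hzR⟩ := exists_separated_seq (S := S)
    (fun r => by obtain ⟨z, h1, h2, h3⟩ := hcon r; exact ⟨z, ⟨h1, h2⟩, h3⟩) R
  -- With m separated points and correlations at most ε⁴/2, the sieve gives (m ε²)² ≤ m + m² ε⁴/2,
  -- that is, m ≤ 2/ε⁴.
  obtain ⟨m, hm⟩ := exists_nat_gt (2 / ε ^ 4)
  have hm0 : (0 : ℝ) < m := lt_trans (by positivity) hm
  have e1 : ∀ i : Fin m, ∀ᶠ l in atTop, ε < ‖ergodicAverage α χ (ns l) (x + j (z i))‖ := fun i =>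
    (hzS i).1.norm.eventually (lt_mem_nhds (hzS i).2)
  have e2 : ∀ i k : Fin m, i ≠ k → ∀ᶠ l in atTop, ‖((ns l : ℕ) : ℂ)⁻¹ *
      ∑ n ∈ Finset.range (ns l), χ (α^[n] (j (z i - z k)))‖ ≤ ε ^ 4 / 2 := fun i k hik =>
    hns.tendsto_atTop.eventually (hR _ (hzR fun he => hik (Fin.ext he)))
  have e3 : ∀ᶠ l in atTop, 0 < ns l := hns.tendsto_atTop.eventually (eventually_gt_atTop 0)
  have e2' : ∀ᶠ l in atTop, ∀ i k : Fin m, i ≠ k → ‖((ns l : ℕ) : ℂ)⁻¹ *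
      ∑ n ∈ Finset.range (ns l), χ (α^[n] (j (z i - z k)))‖ ≤ ε ^ 4 / 2 := by
    simp only [eventually_all]
    exact e2
  obtain ⟨l, h1, h2, h3⟩ := ((eventually_all.2 e1).and (e2'.and e3)).exists
  have hadd : ∀ n a b, α^[n] (a + b) = α^[n] a + α^[n] b := fun n a b =>
    iterate_map_add α n a b
  have hneg : ∀ n a, α^[n] (-a) = -α^[n] a := fun n a => iterate_map_neg α n a
  -- χ is multiplicative and unimodular, so the correlation of two points of the leaf is the average
  -- of χ at the leaf point given by their difference.
  have key := sum_sq_norm_average_le h3 (fun (i : Fin m) n => χ (α^[n] (x + j (z i))))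
    (fun i n => h.norm_eq_one _) hδ.le (fun i k hik => by
      refine le_of_eq_of_le ?_ (h2 i k hik)
      congr 2
      refine Finset.sum_congr rfl fun n _ => ?_
      rw [show j (z i - z k) = (x + j (z i)) + -(x + j (z k)) by rw [map_sub]; abel,
        hadd n (x + j (z i)), hneg,
        h.map_add, h.map_neg, Complex.inv_eq_conj (h.norm_eq_one _)])
  rw [Fintype.card_fin] at key
  have h4 : (m : ℝ) * ε ^ 2 ≤ ∑ i : Fin m, ‖((ns l : ℕ) : ℂ)⁻¹ *
      ∑ n ∈ Finset.range (ns l), χ (α^[n] (x + j (z i)))‖ ^ 2 := by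
    have : (m : ℝ) * ε ^ 2 = ∑ i : Fin m, ε ^ 2 := by simp
    rw [this]
    exact Finset.sum_le_sum fun i _ => pow_le_pow_left₀ hε.le (h1 i).le 2
  have h5 := (pow_le_pow_left₀ (by positivity) h4 2).trans key
  rw [div_lt_iff₀ (by positivity)] at hm
  nlinarith

/-- Each average has the same integral as χ by invariance, and bounded averages that tend to 0 have
integrals tending to 0. -/
theorem integral_eq_zero_of_tendsto [MeasurableSpace X] [BorelSpace X] {m : Measure X}
    [IsFiniteMeasure m] (hα : MeasurePreserving α m m) {χ : C(X, ℂ)} (h : IsLeafChar j χ)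
    {ns : ℕ → ℕ} (hns : StrictMono ns)
    (hlim : ∀ᵐ x ∂m, Tendsto (fun i => ergodicAverage α χ (ns i) x) atTop (𝓝 0)) :
    ∫ x, χ x ∂m = 0 := by
  have hχm : Measurable χ := χ.continuous.measurable
  have hint : ∀ n, Integrable (fun x => χ (α^[n] x)) m := fun n =>
    (integrable_const (1 : ℝ)).mono' (hχm.comp (hα.measurable.iterate n)).aestronglyMeasurable
      (Eventually.of_forall fun x => (h.norm_eq_one _).le)
  have h1 : ∀ n, ∫ x, χ (α^[n] x) ∂m = ∫ x, χ x ∂m := by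
    intro n
    have hn := hα.iterate n
    conv_rhs => rw [← hn.map_eq]
    rw [integral_map hn.measurable.aemeasurable hχm.aestronglyMeasurable]
  have h2 : ∀ N : ℕ, 0 < N → ∫ x, ergodicAverage α χ N x ∂m = ∫ x, χ x ∂m := by
    intro N hN
    simp only [ergodicAverage]
    rw [integral_const_mul, integral_finsetSum _ fun n _ => hint n]
    simp only [h1, Finset.sum_const, Finset.card_range, nsmul_eq_mul]
    rw [inv_mul_cancel_left₀ (by exact_mod_cast hN.ne')]
  have h3 : Tendsto (fun i => ∫ x, ergodicAverage α χ (ns i) x ∂m) atTop (𝓝 (∫ _, (0 : ℂ) ∂m)) :=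
    tendsto_integral_of_dominated_convergence (fun _ => (1 : ℝ))
      (fun i => (measurable_ergodicAverage hα.measurable hχm _).aestronglyMeasurable)
      (integrable_const _) (fun i => Eventually.of_forall fun x =>
        norm_ergodicAverage_le (fun y => (h.norm_eq_one y).le) _ _) hlim
  rw [integral_zero] at h3
  refine tendsto_nhds_unique (tendsto_const_nhds.congr' ?_) h3
  filter_upwards [hns.tendsto_atTop.eventually (eventually_gt_atTop 0)] with i hi
  exact (h2 _ hi).symm

end LeafConvergence


/-! ### The central leaf of the solenoid -/

section CentralLeaf

variable {K : Type*} [Field K] [NumberField K] {θ : K}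
variable {X : Type*} [AddCommGroup X] [TopologicalSpace X]
variable {L : Submodule (Algebra.adjoin ℤ ({θ, θ⁻¹} : Set K)) K}
variable (φ : (W θ ⧸ lattice θ L) ≃ₜ+ X)

include φ in
-- Only the existence of a nontrivial character matters here, so the trace character is taken with
-- the zero parametrization of a leaf.
theorem nontrivial_of_proj [IsTopologicalAddGroup X] [ConnectedSpace X] (hθ : θ ≠ 0) (hL : L.FG) :
    Nontrivial X := by
  obtain ⟨χ, hχ1, j, hj, hχ⟩ := exists_isLeafChar_ne_one φ hθ hL (0 : ℝ →+ W θ) continuous_const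
    fun z => (integralAtBad θ).zero_mem
  by_contra h
  rw [not_nontrivial_iff_subsingleton] at h
  refine hχ1 (ContinuousMap.ext fun x => ?_)
  rw [Subsingleton.elim x 0, hχ.map_zero]
  rfl

variable (hcx : ∀ v : CentralPlace θ, v.1.IsComplex)

/-- The parametrization of the central leaf through `0`. -/
def centralLeaf : (CentralPlace θ → ℂ) →+ X :=
  (⟨⟨proj φ, proj_zero φ⟩, proj_add φ⟩ : W θ →+ X).comp (central hcx)

theorem centralLeaf_apply (z : CentralPlace θ → ℂ) :
    centralLeaf φ hcx z = proj φ (central hcx z) := rfl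

theorem centralLeaf_injective (hroot : ∀ k : ℕ, 0 < k → θ ^ k ≠ 1) :
    Function.Injective (centralLeaf φ hcx) := by
  refine (injective_iff_map_eq_zero _).2 fun z hz => central_injective hcx ?_
  rw [map_zero]
  exact eq_zero_of_proj_eq_zero φ hroot _ (central_mem_W0 hcx z) hz

/-- The conjugates of `θ` of absolute value one, as elements of the circle. -/
def centralRotation (θ : K) (v : CentralPlace θ) : Circle :=
  ⟨centralConj θ v, mem_sphere_zero_iff_norm.2 (norm_centralConj v)⟩

omit [NumberField K] in
theorem centralRotation_pow_ne_one (hroot : ∀ k : ℕ, 0 < k → θ ^ k ≠ 1) (v : CentralPlace θ)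
    (k : ℕ) (hk : 0 < k) : centralRotation θ v ^ k ≠ 1 := fun h =>
  centralConj_pow_ne_one hroot v hk (congrArg (fun z : Circle => (z : ℂ)) h)

variable {α : X ≃ₜ+ X} (hφ : ∀ w : W θ, α (proj φ w) = proj φ (mulTheta θ w))

include hφ in
theorem apply_centralLeaf (z : CentralPlace θ → ℂ) :
    α (centralLeaf φ hcx z) = centralLeaf φ hcx fun v => centralRotation θ v * z v := by
  rw [centralLeaf_apply, centralLeaf_apply, hφ, mulTheta, ← central_mul]
  rfl

include hφ in
theorem finite_commonKer_centralLeaf [IsTopologicalAddGroup X] [ConnectedSpace X]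
    (hα : IsTotallyIrreducible α) (hθ : θ ≠ 0) (hL : L.FG) :
    (commonKer (centralLeaf φ hcx) : Set X).Finite := by
  obtain ⟨χ, hχ1, j, hj, hχ⟩ := exists_isLeafChar_ne_one φ hθ hL (central hcx)
    (continuous_central hcx) fun z => (integralAtBad θ).zero_mem
  obtain rfl : j = centralLeaf φ hcx := AddMonoidHom.ext hj
  let T : Circle → CentralPlace θ → (CentralPlace θ → ℂ) →L[ℝ] ℂ := fun c v =>
    (c : ℂ) • ContinuousLinearMap.proj (R := ℝ) (φ := fun _ : CentralPlace θ => ℂ) v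
  refine finite_commonKer hα (ContinuousLinearMap.pi fun v => T (centralRotation θ v) v)
    (ContinuousLinearMap.pi fun v => T (centralRotation θ v)⁻¹ v)
    (apply_centralLeaf φ hcx hφ) (fun z => ?_) hχ hχ1
  apply α.injective
  rw [α.apply_symm_apply, apply_centralLeaf φ hcx hφ]
  congr 1
  funext v
  change z v = (centralRotation θ v : ℂ) * (((centralRotation θ v)⁻¹ : Circle) * z v)
  rw [Circle.coe_inv, mul_inv_cancel_left₀ (Circle.coe_ne_zero _)]

end CentralLeaf

/-! ### Invariant hulls of a set -/

section Invariance

variable {X : Type*} [MeasurableSpace X] {μ : Measure X} {T : X → X}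

/-- The preimage of the union is contained in the union and has the same finite measure. -/
theorem iUnion_preimage_iterate_ae_eq [IsFiniteMeasure μ] (hT : MeasurePreserving T μ μ) {s : Set X}
    (hs : MeasurableSet s) :
    T ⁻¹' (⋃ n : ℕ, T^[n] ⁻¹' s) =ᵐ[μ] (⋃ n : ℕ, T^[n] ⁻¹' s : Set X) := by
  have hm : MeasurableSet (⋃ n : ℕ, T^[n] ⁻¹' s) :=
    MeasurableSet.iUnion fun n => hT.measurable.iterate n hs
  refine ae_eq_of_subset_of_measure_ge ?_ (hT.measure_preimage hm.nullMeasurableSet).ge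
    (hT.measurable hm).nullMeasurableSet (measure_ne_top _ _)
  intro x hx
  simp only [Set.mem_preimage, Set.mem_iUnion] at hx ⊢
  obtain ⟨n, hn⟩ := hx
  exact ⟨n + 1, hn⟩

theorem measurePreserving_restrict_iUnion [IsFiniteMeasure μ] (hT : MeasurePreserving T μ μ) {s : Set X}
    (hs : MeasurableSet s) :
    MeasurePreserving T (μ.restrict (⋃ n : ℕ, T^[n] ⁻¹' s))
      (μ.restrict (⋃ n : ℕ, T^[n] ⁻¹' s)) := by
  have hm : MeasurableSet (⋃ n : ℕ, T^[n] ⁻¹' s) :=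
    MeasurableSet.iUnion fun n => hT.measurable.iterate n hs
  have h := hT.restrict_preimage hm
  rwa [Measure.restrict_congr_set (iUnion_preimage_iterate_ae_eq hT hs)] at h

/-- A limit of Birkhoff averages that vanishes on `s` vanishes on all preimages of `s`. -/
theorem ae_restrict_tendsto_zero (hT : MeasurePreserving T μ μ)
    {f F : X → ℂ} (hf : ∀ x, ‖f x‖ ≤ 1) {ns : ℕ → ℕ} (hns : StrictMono ns)
    (hlim : ∀ᵐ x ∂μ, Tendsto (fun i => ergodicAverage T f (ns i) x) atTop (𝓝 (F x)))
    {s : Set X} (hs : MeasurableSet s) (hs0 : ∀ᵐ x ∂μ, x ∈ s → F x = 0) :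
    ∀ᵐ x ∂μ.restrict (⋃ n : ℕ, T^[n] ⁻¹' s),
      Tendsto (fun i => ergodicAverage T f (ns i) x) atTop (𝓝 0) := by
  have hm : MeasurableSet (⋃ n : ℕ, T^[n] ⁻¹' s) :=
    MeasurableSet.iUnion fun n => hT.measurable.iterate n hs
  rw [ae_restrict_iff' hm]
  have h1 : ∀ᵐ x ∂μ, ∀ n : ℕ, (T^[n] x ∈ s → F (T^[n] x) = 0) ∧
      Tendsto (fun i => ergodicAverage T f (ns i) (T^[n] x)) atTop (𝓝 (F (T^[n] x))) :=
    ae_all_iff.2 fun n => (hT.iterate n).quasiMeasurePreserving.ae (hs0.and hlim)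
  filter_upwards [h1] with x hx hxs
  obtain ⟨n, hn⟩ := Set.mem_iUnion.1 hxs
  -- Averages at a point and at its n-th iterate have the same limit, so the vanishing of F at one
  -- point of the forward orbit carries back to `x`.
  have h2 : ∀ n, Tendsto (fun i => ergodicAverage T f (ns i) (T^[n] x) -
      ergodicAverage T f (ns i) x) atTop (𝓝 0) := by
    intro n
    induction n with
    | zero => simp
    | succ n ih =>
      have h3 := ((tendsto_ergodicAverage_sub (T := T) hf (T^[n] x)).comp hns.tendsto_atTop).add ih
      rw [zero_add] at h3
      refine h3.congr fun i => ?_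
      rw [Function.comp_apply, ← Function.iterate_succ_apply' T n x]
      ring
  have h4 := (hx n).2.sub (h2 n)
  rw [(hx n).1 hn, sub_zero] at h4
  exact h4.congr fun i => by ring

end Invariance

/-! ### Finiteness of the leaf measure where some limit of averages is nonzero -/

section FiniteLeafMeasure

variable {K : Type*} [Field K] [NumberField K] {θ : K}
variable {X : Type*} [AddCommGroup X] [TopologicalSpace X] [IsTopologicalAddGroup X]
  [T2Space X] [MeasurableSpace X] [BorelSpace X]
variable {L : Submodule (Algebra.adjoin ℤ ({θ, θ⁻¹} : Set K)) K}
variable (φ : (W θ ⧸ lattice θ L) ≃ₜ+ X) {α : X ≃ₜ+ X}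

/-- At almost every point where the limit of the averages of a nontrivial leaf character is not
zero, the leaf measure is finite. -/
theorem ae_leafMeasure_lt_top_of_ne_zero (hφ : ∀ w : W θ, α (proj φ w) = proj φ (mulTheta θ w))
    (hα : IsTotallyIrreducible α) (hroot : ∀ k : ℕ, 0 < k → θ ^ k ≠ 1)
    (hcx : ∀ v : CentralPlace θ, v.1.IsComplex) {μ : Measure X} [IsProbabilityMeasure μ]
    {q : ℕ} {Δ : ℕ → Set (W θ)} {ν : ℕ → X → Measure X} {r₀ : ℝ}
    (hν : ∀ k, 1 ≤ k → IsDecomposition (leafAlgebra (proj φ) (scaled θ L q) (Δ k)) μ (ν k))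
    (hae : ∀ᵐ x ∂μ, (∃ ρ : Measure (W0 θ), IsLeafMeasure (proj φ) ν r₀ x ρ ∧
        ∀ r : ℝ, ρ (ball0 θ r) < ∞) ∧
      ∀ k, 1 ≤ k → ν k x (Set.range (leafMap (proj φ) x)) = 1)
    {χ : C(X, ℂ)} (hχ : IsLeafChar (centralLeaf φ hcx) χ) (hχ1 : χ ≠ 1) {ns : ℕ → ℕ}
    (hns : StrictMono ns) {F : X → ℂ} (hF : Measurable F)
    (hlim : ∀ᵐ x ∂μ, Tendsto (fun i => ergodicAverage α χ (ns i) x) atTop (𝓝 (F x))) :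
    ∀ᵐ x ∂μ, F x ≠ 0 → ∃ ρ : Measure (W0 θ), IsLeafMeasure (proj φ) ν r₀ x ρ ∧
      ρ Set.univ < ∞ := by
  -- Each `A n` meets every leaf in a bounded set, and together they exhaust {F ≠ 0} up to a null
  -- set. The points where the averages converge are built into `A n`, since the bound on a leaf
  -- needs convergence at the points themselves.
  set A : ℕ → Set X := fun n =>
    {x | Tendsto (fun i => ergodicAverage α χ (ns i) x) atTop (𝓝 (F x))} ∩
      {x | 1 / ((n : ℝ) + 1) < ‖F x‖} with hA
  have hαm : Measurable α := α.continuous_toFun.measurable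
  have hAm : ∀ n, MeasurableSet (A n) := fun n =>
    (measurableSet_tendsto_fun (fun i => measurable_ergodicAverage hαm χ.continuous.measurable _)
      hF).inter (measurableSet_lt measurable_const hF.norm)
  have hrec : ∀ᵐ x ∂μ, ∀ n, x ∈ A n → ¬ Tendsto (fun k => ν k x (A n)) atTop (𝓝 0) :=
    ae_all_iff.2 fun n => ae_not_tendsto_zero hν (hAm n)
  filter_upwards [hae, hlim, hrec] with x hx1 hx2 hx3 hx0
  obtain ⟨⟨ρ, hρ, hρr⟩, hrange⟩ := hx1
  obtain ⟨n, hn⟩ := exists_nat_one_div_lt (norm_pos_iff.2 hx0)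
  obtain ⟨r, hr⟩ := hχ.exists_bound_of_tendsto
    (fun δ hδ => hχ.exists_forall_eventually_norm_average_le (apply_centralLeaf φ hcx hφ)
      (centralLeaf_injective φ hcx hroot) hα hχ1 (centralRotation_pow_ne_one hroot) hδ)
    hns F (Nat.one_div_pos_of_nat (n := n)) x
  refine ⟨ρ, hρ, hρ.lt_top_of_not_tendsto φ hρr (fun k hk => (hν k hk).isProbability x) hrange
    ?_ (A := A n) (r := r) (fun u hu => ?_) (hx3 n ⟨hx2, hn⟩)⟩
  · exact (measurableEmbedding_leafMap φ (eq_zero_of_proj_eq_zero φ hroot) x).measurableSet_range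
  · obtain ⟨z, hz⟩ := exists_central_eq hcx u.2
    have hxu : leafMap (proj φ) x u = x + centralLeaf φ hcx z := by
      rw [leafMap_apply, centralLeaf_apply, hz]
    rw [hxu] at hu
    have := hr z hu.1 hu.2
    change ‖(u : W θ).1‖ < r
    rwa [← hz, norm_central]

end FiniteLeafMeasure

end CentralFoliation

end

/-! ### Conclusion: the bad set is null -/

theorem theoremt
    {X : Type*} [AddCommGroup X] [TopologicalSpace X] [IsTopologicalAddGroup X]
    [CompactSpace X] [T2Space X] [ConnectedSpace X] [MeasurableSpace X] [BorelSpace X]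
    (α : X ≃ₜ+ X)
    (h_nonexpansive : ¬ CentralFoliation.IsExpansive α)
    (h_ergodic : CentralFoliation.IsErgodic α)
    (h_irreducible : CentralFoliation.IsTotallyIrreducible α)
    -- the algebraic form of `α`: multiplication by `θ` on `W / ι(L)`
    {K : Type*} [Field K] [NumberField K] (θ : K) (hθ₀ : θ ≠ 0)
    (hθ : IntermediateField.adjoin ℚ {θ} = ⊤)
    (L : Submodule (Algebra.adjoin ℤ ({θ, θ⁻¹} : Set K)) K) (hL : L.FG)
    (φ : (CentralFoliation.W θ ⧸ CentralFoliation.lattice θ L) ≃ₜ+ X)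
    (hφ : ∀ w : CentralFoliation.W θ,
      α (CentralFoliation.proj φ w) =
        CentralFoliation.proj φ (CentralFoliation.mulTheta θ w))
    -- an invariant measure that is singular to normalized Haar measure
    (μ : Measure X) [IsProbabilityMeasure μ] (hμ : MeasurePreserving α μ μ)
    (h_singular : μ ⟂ₘ Measure.addHaarMeasure (⊤ : TopologicalSpace.PositiveCompacts X))
    -- the choices in the construction of the leaf measures
    (q : ℕ) (hq : 1 < q)
    (hq_unit : ∀ v : CentralFoliation.BadPlace θ, v.1.valuation K (q : K) = 1)
    (Δ : ℕ → Set (CentralFoliation.W θ))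
    (hΔ : CentralFoliation.IsFolnerSequence (CentralFoliation.proj φ) L q μ Δ)
    (ν : ℕ → X → Measure X)
    (hν : ∀ k, 1 ≤ k → CentralFoliation.IsDecomposition
      (CentralFoliation.leafAlgebra (CentralFoliation.proj φ)
        (CentralFoliation.scaled θ L q) (Δ k)) μ (ν k))
    (r₀ : ℝ)
    (hr₀ : ∀ x : X,
      @measurableAtom X (CentralFoliation.leafAlgebra (CentralFoliation.proj φ)
        (CentralFoliation.scaled θ L q) (Δ 1)) x ⊆
          CentralFoliation.leafBall (CentralFoliation.proj φ) x r₀) :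
    ∃ X' : Set X, MeasurableSet X' ∧ μ X' = 1 ∧
      ∀ x ∈ X', ∃ ρ : Measure (CentralFoliation.W0 θ),
        CentralFoliation.IsLeafMeasure (CentralFoliation.proj φ) ν r₀ x ρ ∧
          ρ Set.univ < ∞ := by
  have hnt : Nontrivial X := CentralFoliation.nontrivial_of_proj φ hθ₀ hL
  have hroot := CentralFoliation.pow_ne_one_of_isErgodic φ hφ h_ergodic
  have hcx : ∀ v : CentralFoliation.CentralPlace θ, v.1.IsComplex := fun v =>
    CentralFoliation.isComplex_of_central hroot v.2
  have hsc : SecondCountableTopology X := CentralFoliation.secondCountableTopology_of_proj φ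
  have hae := CentralFoliation.ae_exists_leafMeasure φ
    (CentralFoliation.eq_zero_of_proj_eq_zero φ hroot) hΔ
    (CentralFoliation.isPreconnected_ball0 hcx) (CentralFoliation.exists_isCompact_ball0 hcx) hν hr₀
  set B : Set X := {x | ¬ ∃ ρ : Measure (CentralFoliation.W0 θ),
    CentralFoliation.IsLeafMeasure (CentralFoliation.proj φ) ν r₀ x ρ ∧ ρ Set.univ < ∞} with hB
  -- The bad set need not be measurable, so it is replaced by a measurable hull.
  set s : Set X := toMeasurable μ B with hs
  have hsm : MeasurableSet s := measurableSet_toMeasurable μ B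
  set m : Measure X := μ.restrict (⋃ n : ℕ, α^[n] ⁻¹' s) with hm
  have hm0 : m = 0 := by
    have hH : (Measure.addHaarMeasure (⊤ : TopologicalSpace.PositiveCompacts X)) Set.univ = 1 := by
      rw [← TopologicalSpace.PositiveCompacts.coe_top]
      exact Measure.addHaarMeasure_self
    have : IsProbabilityMeasure
      (Measure.addHaarMeasure (⊤ : TopologicalSpace.PositiveCompacts X)) := ⟨hH⟩
    refine CentralFoliation.measure_eq_zero_of_forall_integral_eq_zero
      (CentralFoliation.finite_commonKer_centralLeaf φ hcx hφ h_irreducible hθ₀ hL) m _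
      (h_singular.restrict _) fun χ hχ hχ1 => ?_
    have hχn : ∀ x, ‖χ x‖ ≤ 1 := fun x => (hχ.norm_eq_one x).le
    obtain ⟨F, ns, hF, hns, hlim⟩ := CentralFoliation.exists_seq_tendsto_ergodicAverage hμ
      χ.continuous.measurable hχn
    have hfin := CentralFoliation.ae_leafMeasure_lt_top_of_ne_zero φ hφ h_irreducible hroot hcx hν
      hae hχ hχ1 hns hF hlim
    have hs0 : ∀ᵐ x ∂μ, x ∈ s → F x = 0 := by
      have hFm : MeasurableSet {x | F x ≠ 0} := hF (measurableSet_singleton 0).compl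
      have h1 : μ (s ∩ {x | F x ≠ 0}) = 0 := by
        -- A hull meets every measurable set in the same measure as the original set, so F vanishes
        -- almost everywhere on the hull as well.
        rw [hs, Measure.measure_toMeasurable_inter hFm (measure_ne_top _ _)]
        refine measure_mono_null ?_ (ae_iff.1 hfin)
        rintro x ⟨hxB, hx0⟩ hx
        exact hxB (hx hx0)
      rw [ae_iff]
      refine measure_mono_null (fun x hx => ?_) h1
      rw [Set.mem_ofPred_eq, Classical.not_imp] at hx
      exact hx
    exact CentralFoliation.integral_eq_zero_of_tendsto
      (CentralFoliation.measurePreserving_restrict_iUnion hμ hsm) hχ hns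
      (CentralFoliation.ae_restrict_tendsto_zero hμ hχn hns hlim hsm hs0)
  have hμs : μ s = 0 := by
    rw [hm, Measure.restrict_eq_zero] at hm0
    exact measure_mono_null (Set.subset_iUnion (fun n : ℕ => α^[n] ⁻¹' s) 0) hm0
  refine ⟨sᶜ, hsm.compl, (prob_compl_eq_one_iff hsm).2 hμs, fun x hx => ?_⟩
  by_contra hxB
  exact hx (subset_toMeasurable μ B hxB)
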